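/- **Setting.** Let $G$ be an $\ell$-group, i.e. a totally disconnected locally compact Hausdorff topological group, and assume that $G$ is unimodular, with Haar measure $\mu$. A *$G$-complex* $\mathcal X$ is a connected simplicial complex in which every nonempty cell lies in only finitely many cells, on which $G$ acts faithfully by automorphisms, such that the stabilizer of every nonempty cell is a compact open subgroup of $G$. It is *almost transitive* if $G\backslash\mathcal X$ is finite. For a subgroup $\Gamma\le G$ write $\Gamma\le_{\mathcal X}G$ if the partially ordered set $\Gamma\backslash\mathcal X$ of $\Gamma$-orbits of cells (with $\Gamma x\le\Gamma y$ iff $\gamma x\subseteq y$ for some $\gamma\in\Gamma$) is a simplicial complex and the projection $p_\Gamma:\mathcal X\to\Gamma\backslash\mathcal X$ is a cover map; such a $\Gamma$ is automatically discrete. Fix an almost transitive $G$-complex $\mathcal X$. **The category $\mathscr C=\mathscr C(G,\mathcal X)$.** Its objects are the quotients $\Gamma\backslash\mathcal X$ with $\Gamma\le_{\mathcal X}G$ (and $1\backslash\mathcal X=\mathcal X$). Its morphisms are the maps $p_\Gamma\circ g:\mathcal X\to\Gamma\backslash\mathcal X$ ($g\in G$, $\Gamma\le_{\mathcal X}G$)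 and the projections $\Gamma'\backslash\mathcal X\to\Gamma\backslash\mathcal X$ for $1\ne\Gamma'\le\Gamma\le_{\mathcal X}G$. In particular $\mathrm{End}_{\mathscr C}(\mathcal X)=G$, so $G$ acts on $S\mathcal X$ and on $F\mathcal X$ for functors $S$, $F$ on $\mathscr C$. Let $\mathtt{pHil}$ be the category of complex pre-Hilbert spaces and (not necessarily continuous) linear maps, and for a set $Y$ let $\tilde\ell^2(Y)$ be the pre-Hilbert space of finitely supported functions on $Y$, with standard basis $(\mathrm e_y)_{y\in Y}$; it is functorial in $Y$ via $f_*\mathrm e_y=\mathrm e_{f(y)}$. A functor $F:\mathscr C\to\mathtt{pHil}$ is *elementary* (via $S$) if there is a functor $S:\mathscr C\to\mathtt{Set}$ with: (E1) there is a unitary natural isomorphism $\tilde\ell^2\circ S\cong F$; (E2) for all $x\in S\mathcal X$ the group $\mathrm{Stab}_G(x)$ is compact open and is contained in the stabilizer of a nonempty cell of $\mathcal X$; (E3) for all $\Gamma\le_{\mathcal X}G$ the map $\Gamma x\mapsto (Sp_\Gamma)x$, $\Gamma\backslash S\mathcal X\to S(\Gamma\backslash\mathcal X)$, is bijective; (E4)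 $G\backslash S\mathcal X$ is finite. It is *semi-elementary* if $F\oplus F'$ is elementary for some functor $F':\mathscr C\to\mathtt{pHil}$. **Spectrum.** For a unital $*$-algebra $A$, a unitary representation is a Hilbert space $V$ on which $A$ acts by bounded operators with $\langle au,v\rangle=\langle u,a^*v\rangle$ and $AV$ dense in $V$; it is irreducible if it is nonzero and has no closed $A$-submodules except $0$ and $V$. If $V$ is irreducible, $V\prec V'$ (*weak containment*) means that for every unit vector $v\in V$, every $\varepsilon>0$ and every finite $T\subseteq A$ there is a unit vector $v'\in V'$ with $|\langle av,v\rangle-\langle av',v'\rangle|<\varepsilon$ for all $a\in T$. For a functor $F:\mathscr C\to\mathtt{pHil}$ let $A_F$ be the unital $*$-algebra of natural transformations $a=\{a_X:FX\to FX\}_{X\in\mathscr C}$ that admit a dual, i.e. a natural transformation $a^*:F\to F$ with $\langle a_Xu,v\rangle=\langle u,a_X^*v\rangle$ for all $X$, $u$, $v$. When $F$ is semi-elementary, $A_F$ acts by bounded operators on every $F(\Gamma\backslash\mathcal X)$, and $\mathrm{Spec}_F(\Gamma\backslash\mathcal X)$ is the set of (isomorphism classes of) irreducible unitary representations of $A_F$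 that are weakly contained in the Hilbert space completion of $F(\Gamma\backslash\mathcal X)$. For an open subgroup $N\le G$ of finite index, the coinvariants $(F\mathcal X)_N=F\mathcal X/\mathrm{span}\{\varphi-g\varphi: \varphi\in F\mathcal X,\ g\in N\}$ form a finite-dimensional $A_F$-module which is a unitary representation for some inner product, uniquely up to unitary isomorphism. The *trivial spectrum* $\mathfrak T_F$ is the set of irreducible unitary representations of $A_F$ weakly contained in $(F\mathcal X)_N$ for some such $N$. The quotient $\Gamma\backslash\mathcal X$ is *$F$-Ramanujan* if $\mathrm{Spec}_F(\Gamma\backslash\mathcal X)\subseteq\mathrm{Spec}_F(\mathcal X)\cup\mathfrak T_F$, and *completely Ramanujan* if it is $F$-Ramanujan for every semi-elementary $F:\mathscr C\to\mathtt{pHil}$. **Representations of $G$.** A unitary representation of $G$ is a Hilbert space with a continuous action of $G$ by unitary operators; it is irreducible if it is nonzero and has no closed $G$-invariant subspaces except $0$ and itself. $V\le V'$ means that there is a $G$-equivariant linear isometry $V\to V'$. For irreducible $V$, $V\prec V'$ means that for every unit vector $v\in V$, every $\varepsilon>0$ and every compact $C\subseteq G$ there is a unit vector $v'\in V'$ with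 $|\langle gv,v\rangle-\langle gv',v'\rangle|<\varepsilon$ for all $g\in C$. For $\Gamma\le_{\mathcal X}G$, $G$ acts on $L^2(\Gamma\backslash G)$ (with respect to the right-invariant measure induced by $\mu$) by $(g\varphi)(x)=\varphi(xg)$. An irreducible $V$ is *tempered* if $V\prec L^2(1\backslash G)$, and has *finite action* if the image of $G$ in the unitary group of $V$ is finite. For $K\le G$ let $V^K$ be the space of $K$-fixed vectors. **Theorem.** Let $F:\mathscr C(G,\mathcal X)\to\mathtt{pHil}$ be elementary via $S$, let $x_1,\dots,x_t$ be representatives of the $G$-orbits in $S\mathcal X$ (one for each orbit), let $K_n=\mathrm{Stab}_G(x_n)$, and let $\Gamma\le_{\mathcal X}G$. Then: 1. $\Gamma\backslash\mathcal X$ is $F$-Ramanujan if and only if every irreducible unitary representation $V\prec L^2(\Gamma\backslash G)$ of $G$ with $V^{K_1}+\dots+V^{K_t}\ne0$ is tempered or has finite action. 2. $\Gamma\backslash\mathcal X$ is completely Ramanujan if and only if every irreducible unitary representation $V\prec L^2(\Gamma\backslash G)$ of $G$ is tempered or has finite action. If $\Gamma\backslash\mathcal X$ is finite, then both equivalences remain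 true when "has finite action" is replaced by "is finite-dimensional", when "$V\prec L^2(\Gamma\backslash G)$" is replaced by "$V\le L^2(\Gamma\backslash G)$", and when both replacements are made. -/

import Mathlib

universe u v

noncomputable section

open CategoryTheory MeasureTheory Topology

namespace RamanujanQuotients

/-! ## Unitary representations of a topological group -/

/-- A unitary representation of `G`: a complex Hilbert space on which `G` acts by unitary operators
such that the action map `G × H → H` is (jointly) continuous. -/
structure UnitaryRep (G : Type u) [Group G] [TopologicalSpace G] : Type (u + 1) where
  carrier : Type u
  [normedAddCommGroup : NormedAddCommGroup carrier]
  [innerProductSpace : InnerProductSpace ℂ carrier]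
  [completeSpace : CompleteSpace carrier]
  π : G →* (carrier ≃ₗᵢ[ℂ] carrier)
  continuous_action : Continuous fun p : G × carrier => π p.1 p.2

attribute [instance] UnitaryRep.normedAddCommGroup UnitaryRep.innerProductSpace
  UnitaryRep.completeSpace

namespace UnitaryRep

section

variable {G : Type u} [Group G] [TopologicalSpace G]

/-- (Topological) irreducibility: nonzero, and no closed subrepresentations besides `0` and `V`. -/
def IsIrreducible (V : UnitaryRep G) : Prop :=
  Nontrivial V.carrier ∧ ∀ W : Submodule ℂ V.carrier, IsClosed (W : Set V.carrier) →
    (∀ g : G, ∀ w ∈ W, V.π g w ∈ W) → W = ⊥ ∨ W = ⊤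

/-- `V ≤ V'`: there is an inner product preserving `G`-homomorphism `V → V'`. -/
def IsContained (V V' : UnitaryRep G) : Prop :=
  ∃ f : V.carrier →ₗᵢ[ℂ] V'.carrier, ∀ (g : G) (v : V.carrier), f (V.π g v) = V'.π g (f v)

/-- Weak containment `V ≺ V'` (for irreducible `V`): the diagonal matrix coefficients of unit
vectors of `V` are approximated, uniformly on compact sets, by those of unit vectors of `V'`. -/
def IsWeaklyContained (V V' : UnitaryRep G) : Prop :=
  ∀ v : V.carrier, ‖v‖ = 1 → ∀ ε : ℝ, 0 < ε → ∀ C : Set G, IsCompact C →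
    ∃ v' : V'.carrier, ‖v'‖ = 1 ∧
      ∀ g ∈ C, ‖inner ℂ v (V.π g v) - inner ℂ v' (V'.π g v')‖ < ε

/-- `V` has finite action: the image of `G` in the unitary group of `V` is finite. -/
def HasFiniteAction (V : UnitaryRep G) : Prop := (Set.range V.π).Finite

/-- `V` is finite-dimensional. -/
def IsFiniteDimensional (V : UnitaryRep G) : Prop := FiniteDimensional ℂ V.carrier

/-- The space `V^K` of vectors fixed by the subgroup `K`. -/
def fixed (V : UnitaryRep G) (K : Subgroup G) : Submodule ℂ V.carrier where
  carrier := {v | ∀ k ∈ K, V.π k v = v}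
  add_mem' ha hb k hk := by rw [map_add, ha k hk, hb k hk]
  zero_mem' k _ := map_zero _
  smul_mem' c v hv k hk := by rw [map_smul, hv k hk]

end

section

variable {G : Type u} [Group G]

/-- Translation `φ ↦ φ(· g)` on `L²(Y, ν)`, for a measure-preserving right action
`(y, g) ↦ r g y` of `G` on `Y`. -/
def translate {Y : Type u} [MeasurableSpace Y] (ν : Measure Y) (r : G → Y → Y)
    (hmp : ∀ g, MeasurePreserving (r g) ν ν) (g : G) : Lp ℂ 2 ν →ₗᵢ[ℂ] Lp ℂ 2 ν :=
  Lp.compMeasurePreservingₗᵢ ℂ (r g) (hmp g)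

theorem translate_one {Y : Type u} [MeasurableSpace Y] (ν : Measure Y) (r : G → Y → Y)
    (hmp : ∀ g, MeasurePreserving (r g) ν ν) (hone : ∀ y, r 1 y = y) (φ : Lp ℂ 2 ν) :
    translate ν r hmp 1 φ = φ := by
  have h : r 1 = id := funext hone
  have := Lp.compMeasurePreserving_id_apply (μb := ν) φ
  refine Eq.trans ?_ this
  change Lp.compMeasurePreserving (r 1) _ φ = _
  congr 2

theorem translate_mul {Y : Type u} [MeasurableSpace Y] (ν : Measure Y) (r : G → Y → Y)
    (hmp : ∀ g, MeasurePreserving (r g) ν ν) (hmul : ∀ g h y, r (g * h) y = r h (r g y))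
    (g h : G) (φ : Lp ℂ 2 ν) :
    translate ν r hmp (g * h) φ = translate ν r hmp g (translate ν r hmp h φ) := by
  have e : r (g * h) = r h ∘ r g := funext (hmul g h)
  have := Lp.compMeasurePreserving_comp_apply φ (hmp h) (hmp g)
  simp only [translate]
  refine Eq.trans ?_ this
  change Lp.compMeasurePreserving (r (g * h)) _ φ = _
  congr 2

variable [TopologicalSpace G]

/-- A continuous measure-preserving right action `(y, g) ↦ r g y` of `G` on `Y` gives the unitary
representation `(g φ)(y) = φ(y g)` on `L²(Y, ν)`. -/
def ofRightAction {Y : Type u} [TopologicalSpace Y] [MeasurableSpace Y] [BorelSpace Y] [R1Space Y]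
    (ν : Measure Y) [ν.InnerRegularCompactLTTop] [IsLocallyFiniteMeasure ν]
    (r : G → Y → Y) (hcont : Continuous fun p : G × Y => r p.1 p.2)
    (hone : ∀ y, r 1 y = y) (hmul : ∀ g h y, r (g * h) y = r h (r g y))
    (hmp : ∀ g, MeasurePreserving (r g) ν ν) : UnitaryRep G where
  carrier := Lp ℂ 2 ν
  π :=
    { toFun := fun g =>
        { (translate ν r hmp g).toLinearMap with
          invFun := translate ν r hmp g⁻¹
          left_inv := fun φ => by
            refine (translate_mul ν r hmp hmul g⁻¹ g φ).symm.trans ?_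
            rw [inv_mul_cancel, translate_one ν r hmp hone]
          right_inv := fun φ => by
            refine (translate_mul ν r hmp hmul g g⁻¹ φ).symm.trans ?_
            rw [mul_inv_cancel, translate_one ν r hmp hone]
          norm_map' := (translate ν r hmp g).norm_map }
      map_one' := LinearIsometryEquiv.ext fun φ => translate_one ν r hmp hone φ
      map_mul' := fun g h => LinearIsometryEquiv.ext fun φ => translate_mul ν r hmp hmul g h φ }
  continuous_action := by
    let c : C(G, C(Y, Y)) := ContinuousMap.curry ⟨fun p : G × Y => r p.1 p.2, hcont⟩
    exact continuous_snd.compMeasurePreservingLp (p := 2) (E := ℂ) (μ := ν) (ν := ν)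
      (f := fun p : G × Lp ℂ 2 ν => p.2) (g := fun p : G × Lp ℂ 2 ν => c p.1)
      (c.continuous.comp continuous_fst) (fun p => hmp p.1) (by simp)

end

end UnitaryRep

/-! ## The space `Γ \ G` and its canonical measure -/

section Coset

variable {G : Type u} [Group G]

/-- The space `Γ \ G` of right cosets `Γ x`, with the quotient topology and its Borel
`σ`-algebra. -/
def RightCosets (Γ : Subgroup G) : Type u := Quotient (QuotientGroup.rightRel Γ)

namespace RightCosets

/-- The projection `x ↦ Γ x`. -/
def mk (Γ : Subgroup G) (x : G) : RightCosets Γ := Quotient.mk (QuotientGroup.rightRel Γ) x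

theorem mk_eq_mk {Γ : Subgroup G} {x y : G} : mk Γ x = mk Γ y ↔ y * x⁻¹ ∈ Γ :=
  Quotient.eq.trans QuotientGroup.rightRel_apply

theorem mk_surjective (Γ : Subgroup G) : Function.Surjective (mk Γ) := Quotient.mk_surjective

/-- Right translation `Γ x ↦ Γ x g`. -/
def mulRight (Γ : Subgroup G) (g : G) : RightCosets Γ → RightCosets Γ :=
  Quotient.map' (fun x => x * g) fun x y h => by
    rw [QuotientGroup.rightRel_apply] at h ⊢
    simpa [mul_assoc] using h

theorem mulRight_mk (Γ : Subgroup G) (g x : G) : mulRight Γ g (mk Γ x) = mk Γ (x * g) := rfl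

variable [TopologicalSpace G]

instance (Γ : Subgroup G) : TopologicalSpace (RightCosets Γ) :=
  inferInstanceAs (TopologicalSpace (Quotient (QuotientGroup.rightRel Γ)))

instance (Γ : Subgroup G) : MeasurableSpace (RightCosets Γ) := borel _

instance (Γ : Subgroup G) : BorelSpace (RightCosets Γ) := ⟨rfl⟩

variable [IsTopologicalGroup G]

theorem isOpenQuotientMap_mk (Γ : Subgroup G) : IsOpenQuotientMap (mk Γ) :=
  MulAction.isOpenQuotientMap_quotientMk (Γ := Γ) (T := G)

instance (Γ : Subgroup G) [T2Space G] [DiscreteTopology Γ] : T2Space (RightCosets Γ) := by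
  rw [t2Space_iff_of_isOpenQuotientMap (isOpenQuotientMap_mk Γ)]
  have hc : IsClosed (Γ : Set G) := Subgroup.isClosed_of_discrete
  have : {q : G × G | mk Γ q.1 = mk Γ q.2} = (fun q : G × G => q.2 * q.1⁻¹) ⁻¹' (Γ : Set G) := by
    ext q; exact mk_eq_mk
  rw [this]
  exact hc.preimage (by fun_prop)

instance (Γ : Subgroup G) [LocallyCompactSpace G] : LocallyCompactSpace (RightCosets Γ) :=
  (isOpenQuotientMap_mk Γ).locallyCompactSpace

instance (Γ : Subgroup G) [SecondCountableTopology G] : SecondCountableTopology (RightCosets Γ) :=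
  (isOpenQuotientMap_mk Γ).isQuotientMap.secondCountableTopology (isOpenQuotientMap_mk Γ).isOpenMap

theorem continuous_mulRight (Γ : Subgroup G) :
    Continuous fun p : G × RightCosets Γ => mulRight Γ p.1 p.2 := by
  have h : IsOpenQuotientMap (Prod.map (id : G → G) (mk Γ)) :=
    IsOpenQuotientMap.id.prodMap (isOpenQuotientMap_mk Γ)
  rw [← h.continuous_comp_iff]
  exact (isOpenQuotientMap_mk Γ).continuous.comp (continuous_snd.mul continuous_fst)

/-- A discrete subgroup of a second countable group has a Borel fundamental domain: a Borel set
meeting every right coset `Γ x` in exactly one point. -/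
theorem exists_fundamentalDomain [SecondCountableTopology G] [MeasurableSpace G] [BorelSpace G]
    (Γ : Subgroup G) [DiscreteTopology Γ] :
    ∃ D : Set G, MeasurableSet D ∧ ∀ x : G, ∃! γ : Γ, γ • x ∈ D := by
  classical
  obtain ⟨U, hU, hUΓ⟩ : ∃ U : Set G, IsOpen U ∧ ∀ γ : Γ, (γ : G) ∈ U ↔ γ = 1 := by
    obtain ⟨U, hU, h⟩ := isOpen_induced_iff.1 (isOpen_discrete ({1} : Set Γ))
    exact ⟨U, hU, fun γ => by simpa using Set.ext_iff.1 h γ⟩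
  have h1 : (1 : G) ∈ U := by simpa using (hUΓ 1).2 rfl
  obtain ⟨W, hW, hW1, hWU⟩ : ∃ W : Set G, IsOpen W ∧ 1 ∈ W ∧ ∀ a ∈ W, ∀ b ∈ W, a * b⁻¹ ∈ U := by
    have hc : Continuous fun p : G × G => p.1 * p.2⁻¹ := by fun_prop
    have ho : IsOpen ((fun p : G × G => p.1 * p.2⁻¹) ⁻¹' U) := hU.preimage hc
    obtain ⟨A, B, hA, hB, hA1, hB1, hAB⟩ := isOpen_prod_iff.1 ho 1 1 (by simpa using h1)
    exact ⟨A ∩ B, hA.inter hB, ⟨hA1, hB1⟩, fun a ha b hb =>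
      hAB (show (a, b) ∈ A ×ˢ B from ⟨ha.1, hb.2⟩)⟩
  have hnhds : ∀ x : G, (fun y => y * x⁻¹) ⁻¹' W ∈ 𝓝 x := fun x =>
    (hW.preimage (by fun_prop)).mem_nhds (by simpa using hW1)
  obtain ⟨c, hc, hcover⟩ := TopologicalSpace.countable_cover_nhds hnhds
  have hne : c.Nonempty := by
    by_contra h
    rw [Set.not_nonempty_iff_eq_empty] at h
    subst h
    simpa using Set.ext_iff.1 hcover (1 : G)
  obtain ⟨s, rfl⟩ := hc.exists_eq_range hne
  -- the `n`-th open set of the cover, and its saturation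
  let O : ℕ → Set G := fun n => (fun y => y * (s n)⁻¹) ⁻¹' W
  have hO : ∀ n, IsOpen (O n) := fun n => hW.preimage (by fun_prop)
  let T : ℕ → Set G := fun n => ⋃ γ : Γ, (fun y => (γ : G) * y) ⁻¹' O n
  have hT : ∀ n, IsOpen (T n) := fun n => isOpen_iUnion fun γ => (hO n).preimage (by fun_prop)
  have hTmem : ∀ n x, x ∈ T n ↔ ∃ γ : Γ, (γ : G) * x ∈ O n := fun n x => by simp [T]
  have hTinv : ∀ n (γ : Γ) x, (γ : G) * x ∈ T n ↔ x ∈ T n := fun n γ x => by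
    rw [hTmem, hTmem]
    constructor
    · rintro ⟨δ, h⟩
      exact ⟨δ * γ, by simpa [mul_assoc] using h⟩
    · rintro ⟨δ, h⟩
      exact ⟨δ * γ⁻¹, by simpa [mul_assoc] using h⟩
  refine ⟨⋃ n, O n \ ⋃ m ∈ Finset.range n, T m, ?_, fun x => ?_⟩
  · exact MeasurableSet.iUnion fun n => (hO n).measurableSet.diff
      ((Finset.range n).measurableSet_biUnion fun m _ => (hT m).measurableSet)
  · have hex : ∃ n, x ∈ T n := by
      have : x ∈ ⋃ y ∈ Set.range s, (fun z => z * y⁻¹) ⁻¹' W := hcover ▸ Set.mem_univ x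
      simp only [Set.mem_range, Set.iUnion_exists, Set.iUnion_iUnion_eq', Set.mem_iUnion] at this
      obtain ⟨n, hn⟩ := this
      exact ⟨n, (hTmem n x).2 ⟨1, by simpa [O] using hn⟩⟩
    have hmem : ∀ γ : Γ, (γ • x ∈ ⋃ n, O n \ ⋃ m ∈ Finset.range n, T m) ↔
        (γ : G) * x ∈ O (Nat.find hex) := by
      intro γ
      have e : γ • x = (γ : G) * x := rfl
      rw [e]
      simp only [Set.mem_iUnion, Set.mem_sdiff, Finset.mem_range, not_exists]
      constructor
      · rintro ⟨n, hn, hlt⟩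
        have hle : Nat.find hex = n := by
          rw [Nat.find_eq_iff]
          exact ⟨(hTmem n x).2 ⟨γ, hn⟩, fun m hm h => hlt m hm ((hTinv m γ x).2 h)⟩
        rwa [hle]
      · intro h
        exact ⟨_, h, fun m hm h' => Nat.find_min hex hm ((hTinv m γ x).1 h')⟩
    obtain ⟨γ, hγ⟩ := (hTmem _ x).1 (Nat.find_spec hex)
    refine ⟨γ, (hmem γ).2 hγ, fun δ hδ => ?_⟩
    have hδ' := (hmem δ).1 hδ
    have h2 := hWU _ hδ' _ hγ
    have h3 : (δ * γ⁻¹ : Γ) = 1 := by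
      rw [← hUΓ]
      simpa [mul_assoc] using h2
    exact mul_inv_eq_one.1 h3

/-- A Borel fundamental domain for the action of `Γ` on `G` by left translations. -/
def fundamentalDomain [SecondCountableTopology G] [MeasurableSpace G] [BorelSpace G]
    (Γ : Subgroup G) [DiscreteTopology Γ] : Set G :=
  (exists_fundamentalDomain Γ).choose

variable [SecondCountableTopology G] [MeasurableSpace G] [BorelSpace G]

theorem isFundamentalDomain (Γ : Subgroup G) [DiscreteTopology Γ] (μ : Measure G) :
    IsFundamentalDomain Γ (fundamentalDomain Γ) μ :=
  .mk' (exists_fundamentalDomain Γ).choose_spec.1.nullMeasurableSet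
    (exists_fundamentalDomain Γ).choose_spec.2

/-- The canonical measure `μ_{Γ \ G}` on `Γ \ G`: the image of the restriction of the Haar measure
to a fundamental domain of `Γ`. -/
def measure (Γ : Subgroup G) [DiscreteTopology Γ] (μ : Measure G) : Measure (RightCosets Γ) :=
  (μ.restrict (fundamentalDomain Γ)).map (mk Γ)

/-- The characteristic property of `μ_{Γ \ G}`:
`∫_G f dμ = ∫_{Γ \ G} (∑_γ f(γ x)) dμ_{Γ \ G}(Γ x)`. -/
theorem lintegral_measure (Γ : Subgroup G) [DiscreteTopology Γ] (μ : Measure G)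
    [μ.IsMulLeftInvariant] (f : G → ENNReal) (fHat : RightCosets Γ → ENNReal)
    (hmeas : Measurable fHat) (hf : ∀ x, fHat (mk Γ x) = ∑' γ : Γ, f (γ * x))
    (hfm : Measurable f) :
    ∫⁻ q, fHat q ∂(measure Γ μ) = ∫⁻ x, f x ∂μ := by
  have : Countable Γ := TopologicalSpace.separableSpace_iff_countable.1 inferInstance
  rw [measure, lintegral_map hmeas (isOpenQuotientMap_mk Γ).continuous.measurable,
    (isFundamentalDomain Γ μ).lintegral_eq_tsum'' f]
  simp_rw [hf]
  exact lintegral_tsum fun γ => (hfm.comp (measurable_const_mul _)).aemeasurable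

theorem measurePreserving_mulRight (Γ : Subgroup G) [DiscreteTopology Γ] (μ : Measure G)
    [μ.IsMulLeftInvariant] [μ.IsMulRightInvariant] (g : G) :
    MeasurePreserving (mulRight Γ g) (measure Γ μ) (measure Γ μ) := by
  have : Countable Γ := TopologicalSpace.separableSpace_iff_countable.1 inferInstance
  have hmk : Measurable (mk Γ) := (isOpenQuotientMap_mk Γ).continuous.measurable
  have hr : Measurable (mulRight Γ g) :=
    ((continuous_mulRight Γ).comp (Continuous.prodMk_right g)).measurable
  refine ⟨hr, Measure.ext fun A hA => ?_⟩
  rw [Measure.map_apply hr hA, measure, Measure.map_apply hmk (hr hA), Measure.map_apply hmk hA,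
    Measure.restrict_apply (hmk (hr hA)), Measure.restrict_apply (hmk hA)]
  have hD := (exists_fundamentalDomain Γ).choose_spec
  -- the right translate of the fundamental domain
  have hD' : IsFundamentalDomain Γ ((fun x => x * g⁻¹) ⁻¹' fundamentalDomain Γ) μ := by
    refine .mk' ((measurable_mul_const g⁻¹) hD.1).nullMeasurableSet fun x => ?_
    have : ∃! γ : Γ, γ • (x * g⁻¹) ∈ fundamentalDomain Γ := hD.2 (x * g⁻¹)
    simpa only [Set.mem_preimage, Subgroup.smul_def, smul_eq_mul, mul_assoc] using this
  have hset : mk Γ ⁻¹' (mulRight Γ g ⁻¹' A) ∩ fundamentalDomain Γ =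
      (fun x => x * g) ⁻¹' (mk Γ ⁻¹' A ∩ (fun x => x * g⁻¹) ⁻¹' fundamentalDomain Γ) := by
    ext x
    simp [mulRight_mk]
  rw [hset, measure_preimage_mul_right]
  refine hD'.measure_set_eq (isFundamentalDomain Γ μ) (hmk hA) fun γ => ?_
  ext x
  have : mk Γ (γ • x) = mk Γ x := by
    rw [mk_eq_mk, Subgroup.smul_def, smul_eq_mul, mul_inv_rev, mul_inv_cancel_left]
    exact Γ.inv_mem γ.2
  simp [this]

instance (Γ : Subgroup G) [DiscreteTopology Γ] (μ : Measure G)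
    [μ.IsMulLeftInvariant] [IsLocallyFiniteMeasure μ] :
    IsLocallyFiniteMeasure (measure Γ μ) := by
  have : Countable Γ := TopologicalSpace.separableSpace_iff_countable.1 inferInstance
  refine ⟨fun q => ?_⟩
  obtain ⟨x, rfl⟩ := mk_surjective Γ q
  obtain ⟨O, hxO, hO, hfin⟩ := μ.exists_isOpen_measure_lt_top x
  have hopen := (isOpenQuotientMap_mk Γ).isOpenMap O hO
  refine ⟨mk Γ '' O, hopen.mem_nhds ⟨x, hxO, rfl⟩, lt_of_le_of_lt ?_ hfin⟩
  have hmk : Measurable (mk Γ) := (isOpenQuotientMap_mk Γ).continuous.measurable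
  rw [measure, Measure.map_apply hmk hopen.measurableSet,
    Measure.restrict_apply (hmk hopen.measurableSet), (isFundamentalDomain Γ μ).measure_eq_tsum O]
  refine (measure_mono fun y hy => ?_).trans (measure_iUnion_le _)
  obtain ⟨⟨z, hz, hzy⟩, hyD⟩ := hy
  rw [mk_eq_mk] at hzy
  refine Set.mem_iUnion.2 ⟨⟨_, hzy⟩, ⟨z, hz, ?_⟩, hyD⟩
  simp [Subgroup.smul_def]

instance (Γ : Subgroup G) [T2Space G] [LocallyCompactSpace G] [DiscreteTopology Γ] (μ : Measure G)
    [μ.IsMulLeftInvariant] [IsLocallyFiniteMeasure μ] :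
    (measure Γ μ).InnerRegularCompactLTTop := by
  let := TopologicalSpace.metrizableSpaceMetric (RightCosets Γ)
  infer_instance

end RightCosets

/-- The unitary representation `L²(Γ \ G)`, with `(g φ)(x) = φ(x g)`. -/
def UnitaryRep.L2RightCosets {G : Type u} [Group G] [TopologicalSpace G] [IsTopologicalGroup G]
    [T2Space G] [LocallyCompactSpace G] [SecondCountableTopology G] [MeasurableSpace G]
    [BorelSpace G] (Γ : Subgroup G) [DiscreteTopology Γ] (μ : Measure G) [μ.IsHaarMeasure]
    [μ.IsMulRightInvariant] : UnitaryRep G :=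
  UnitaryRep.ofRightAction (RightCosets.measure Γ μ) (RightCosets.mulRight Γ)
    (RightCosets.continuous_mulRight Γ)
    (by
      intro y
      obtain ⟨x, rfl⟩ := RightCosets.mk_surjective Γ y
      rw [RightCosets.mulRight_mk, mul_one])
    (by
      intro g h y
      obtain ⟨x, rfl⟩ := RightCosets.mk_surjective Γ y
      simp only [RightCosets.mulRight_mk, mul_assoc])
    (RightCosets.measurePreserving_mulRight Γ μ)

end Coset

/-! ## Simplicial complexes, cover maps and `G`-complexes -/

open Classical in
/-- The image `{f v | v ∈ s}` of a finite set `s`. -/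
def cellImage {V W : Type v} (f : V → W) (s : Finset V) : Finset W := s.image f

theorem mem_cellImage {V W : Type v} {f : V → W} {s : Finset V} {w : W} :
    w ∈ cellImage f s ↔ ∃ v ∈ s, f v = w := by
  classical
  simp [cellImage]

/-- A cover map `X → Y`, given by a map `f` of vertices: a surjective, dimension preserving morphism
of simplicial complexes which for every vertex `v` of `X` induces a bijection from the cells of `X`
containing `v` to the cells of `Y` containing `f v`. -/
structure IsCoverMap {V W : Type v} (X : AbstractSimplicialComplex V)
    (Y : AbstractSimplicialComplex W) (f : V → W) : Prop where
  map_mem : ∀ s ∈ X.faces, cellImage f s ∈ Y.faces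
  injOn : ∀ s ∈ X.faces, Set.InjOn f s
  surjective : Function.Surjective f
  bijOn_star : ∀ v : V, Set.BijOn (cellImage f) {s ∈ X.faces | v ∈ s}
    {t ∈ Y.faces | f v ∈ t}

/-- The image `g s = {g v | v ∈ s}` of a finite set of vertices. -/
def cellSMul {G : Type u} {V : Type v} [Group G] [MulAction G V] (g : G) (s : Finset V) :
    Finset V :=
  s.map (MulAction.toPerm g).toEmbedding

section CellSMul

variable {G : Type u} {V : Type v} [Group G] [MulAction G V]

theorem mem_cellSMul {g : G} {s : Finset V} {v : V} : v ∈ cellSMul g s ↔ ∃ w ∈ s, g • w = v := by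
  simp only [cellSMul, Finset.mem_map]; rfl

theorem one_cellSMul (s : Finset V) : cellSMul (1 : G) s = s := by
  ext v; simp [mem_cellSMul]

theorem mul_cellSMul (g h : G) (s : Finset V) :
    cellSMul (g * h) s = cellSMul g (cellSMul h s) := by
  ext v; simp [mem_cellSMul, mul_smul]

theorem cellSMul_singleton (g : G) (v : V) : cellSMul g {v} = {g • v} := by
  ext w; simp [mem_cellSMul, eq_comm]

theorem cellImage_cellSMul {W : Type v} (f : V → W) (g : G) (hf : ∀ v, f (g • v) = f v)
    (s : Finset V) : cellImage f (cellSMul g s) = cellImage f s := by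
  ext w; simp [mem_cellImage, mem_cellSMul, hf]

end CellSMul

/-- A `G`-complex with vertex set `V`: a connected, locally finite simplicial complex (whose
nonempty cells are the members of `faces`) on which `G` acts faithfully by automorphisms, such that
the stabilizer of every nonempty cell is a compact open subgroup of `G`. -/
structure GComplex (G : Type u) (V : Type v) [Group G] [TopologicalSpace G] [MulAction G V]
    extends AbstractSimplicialComplex V where
  smul_mem : ∀ (g : G), ∀ s ∈ faces, cellSMul g s ∈ faces
  faithful : ∀ g : G, (∀ v : V, g • v = v) → g = 1
  locallyFinite : ∀ s ∈ faces, {t ∈ faces | s ⊆ t}.Finite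
  connected : ∀ v w : V, Relation.ReflTransGen (fun a b => ∃ s ∈ faces, a ∈ s ∧ b ∈ s) v w
  isCompact_stabilizer : ∀ s ∈ faces, IsCompact {g : G | cellSMul g s = s}
  isOpen_stabilizer : ∀ s ∈ faces, IsOpen {g : G | cellSMul g s = s}

namespace GComplex

section Vertex

variable {G : Type u} {V : Type v} [Group G] [MulAction G V]

/-- The projection `V → Γ \ V`. -/
def mkVertex (V : Type v) [MulAction G V] (Γ : Subgroup G) (x : V) :
    MulAction.orbitRel.Quotient Γ V :=
  Quotient.mk'' x

theorem mkVertex_eq {Γ : Subgroup G} {x y : V} :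
    mkVertex V Γ x = mkVertex V Γ y ↔ ∃ γ ∈ Γ, γ • y = x := by
  unfold mkVertex
  rw [Quotient.eq'', MulAction.orbitRel_apply, MulAction.mem_orbit_iff]
  exact ⟨fun ⟨γ, h⟩ => ⟨γ, γ.2, h⟩, fun ⟨γ, hγ, h⟩ => ⟨⟨γ, hγ⟩, h⟩⟩

theorem mkVertex_surjective (Γ : Subgroup G) : Function.Surjective (mkVertex V Γ) :=
  Quotient.mk''_surjective

end Vertex

section Basic

variable {G : Type u} {V : Type v} [Group G] [TopologicalSpace G] [MulAction G V]
  (X : GComplex G V)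

/-- The nonempty cells of `X`. -/
def Cell : Type v := {s : Finset V // s ∈ X.faces}

instance : MulAction G X.Cell where
  smul g s := ⟨cellSMul g s.1, X.smul_mem g s.1 s.2⟩
  one_smul s := Subtype.ext (one_cellSMul s.1)
  mul_smul g h s := Subtype.ext (mul_cellSMul g h s.1)

/-- `X` is almost transitive: `G \ X` is finite. -/
def AlmostTransitive : Prop := Finite (MulAction.orbitRel.Quotient G X.Cell)

/-- The simplicial complex with vertex set `Γ \ V` whose cells are the images of the cells
of `X`. -/
def quotientComplex (Γ : Subgroup G) :
    AbstractSimplicialComplex (MulAction.orbitRel.Quotient Γ V) where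
  faces := cellImage (mkVertex V Γ) '' X.faces
  isRelLowerSet_faces := by
    rintro _ ⟨s, hs, rfl⟩
    obtain ⟨hne, hlow⟩ := X.isRelLowerSet_faces hs
    obtain ⟨x, hx⟩ := hne
    refine ⟨⟨_, mem_cellImage.2 ⟨x, hx, rfl⟩⟩, fun t hts ht => ?_⟩
    classical
    obtain ⟨t', ht', rfl⟩ := Finset.subset_image_iff.1 (show t ⊆ s.image (mkVertex V Γ) from
      fun w hw => by simpa [mem_cellImage] using hts hw)
    refine ⟨t', hlow (Finset.coe_subset.1 ht') (Finset.image_nonempty.1 ht), ?_⟩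
    ext w; simp [mem_cellImage]
  singleton_mem v := by
    obtain ⟨x, rfl⟩ := mkVertex_surjective Γ v
    exact ⟨{x}, X.singleton_mem x, by ext w; simp [mem_cellImage, eq_comm]⟩

/-- `Γ ≤_X G`, i.e. `Γ \ X` is a `G`-quotient of `X`: the partially ordered set `Γ \ X` of
`Γ`-orbits of cells, where `Γ s ≤ Γ t` iff `γ s ⊆ t` for some `γ ∈ Γ`, is a simplicial complex
(namely, it is identified by `Γ s ↦ {Γ v | v ∈ s}` with the complex of the images of the cells),
and the projection from `X` to this complex is a cover map. -/
structure IsQuotient (Γ : Subgroup G) : Prop where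
  le_iff : ∀ s ∈ X.faces, ∀ t ∈ X.faces,
    cellImage (mkVertex V Γ) s ⊆ cellImage (mkVertex V Γ) t ↔ ∃ γ ∈ Γ, cellSMul γ s ⊆ t
  isCoverMap : IsCoverMap X.toAbstractSimplicialComplex (X.quotientComplex Γ) (mkVertex V Γ)

/-- `Γ \ X` is finite. -/
def IsFiniteQuotient (Γ : Subgroup G) : Prop := Finite (MulAction.orbitRel.Quotient Γ X.Cell)

theorem isQuotient_bot : X.IsQuotient ⊥ := by
  have hinj : Function.Injective (mkVertex V (⊥ : Subgroup G)) := fun x y h => by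
    obtain ⟨γ, hγ, h⟩ := mkVertex_eq.1 h
    rw [Subgroup.mem_bot.1 hγ, one_smul] at h
    exact h.symm
  have hmem : ∀ (s : Finset V) (v : V),
      mkVertex V (⊥ : Subgroup G) v ∈ cellImage (mkVertex V ⊥) s ↔ v ∈ s := fun s v => by
    rw [mem_cellImage]
    exact ⟨fun ⟨w, hw, e⟩ => hinj e ▸ hw, fun h => ⟨v, h, rfl⟩⟩
  have hsub : ∀ s t : Finset V,
      cellImage (mkVertex V (⊥ : Subgroup G)) s ⊆ cellImage (mkVertex V ⊥) t ↔ s ⊆ t :=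
    fun s t => by
      refine ⟨fun h v hv => (hmem t v).1 (h ((hmem s v).2 hv)), fun h w hw => ?_⟩
      obtain ⟨v, hv, rfl⟩ := mem_cellImage.1 hw
      exact (hmem t v).2 (h hv)
  refine ⟨fun s _ t _ => ?_, ⟨fun s hs => ⟨s, hs, rfl⟩, fun s _ => hinj.injOn,
    mkVertex_surjective _, fun v => ⟨fun s hs => ⟨⟨s, hs.1, rfl⟩, (hmem s v).2 hs.2⟩, ?_, ?_⟩⟩⟩
  · rw [hsub]
    simp [Subgroup.mem_bot, one_cellSMul]
  · intro s _ t _ h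
    exact ((hsub s t).1 h.le).antisymm ((hsub t s).1 h.ge)
  · rintro _ ⟨⟨s, hs, rfl⟩, hv⟩
    exact ⟨s, ⟨hs, (hmem s v).1 hv⟩, rfl⟩

theorem isOpen_smul_eq (X : GComplex G V) (x : V) : IsOpen {g : G | g • x = x} := by
  convert X.isOpen_stabilizer {x} (X.singleton_mem x) using 1
  ext g; simp [cellSMul_singleton]

theorem isCompact_smul_eq (X : GComplex G V) (x : V) : IsCompact {g : G | g • x = x} := by
  convert X.isCompact_stabilizer {x} (X.singleton_mem x) using 1
  ext g; simp [cellSMul_singleton]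

variable {X}

/-- If `Γ ≤_X G`, then `Γ` acts freely on the vertices of `X`. -/
theorem IsQuotient.eq_one {Γ : Subgroup G} (h : X.IsQuotient Γ) {γ : G} (hγ : γ ∈ Γ) {x : V}
    (hx : γ • x = x) : γ = 1 := by
  have hfix : ∀ y, Relation.ReflTransGen (fun a b => ∃ s ∈ X.faces, a ∈ s ∧ b ∈ s) x y →
      γ • y = y := by
    intro y hy
    induction hy with
    | refl => exact hx
    | @tail b c _ hbc ih =>
      obtain ⟨s, hs, hb, hc⟩ := hbc
      have hmk : ∀ v, mkVertex V Γ (γ • v) = mkVertex V Γ v := fun v =>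
        mkVertex_eq.2 ⟨γ, hγ, rfl⟩
      have hmem : b ∈ cellSMul γ s := mem_cellSMul.2 ⟨b, hb, ih⟩
      have hs' : cellSMul γ s = s :=
        (h.isCoverMap.bijOn_star b).injOn ⟨X.smul_mem γ s hs, hmem⟩ ⟨hs, hb⟩
          (cellImage_cellSMul _ γ hmk s)
      have hγc : γ • c ∈ s := by
        rw [← hs']
        exact mem_cellSMul.2 ⟨c, hc, rfl⟩
      exact h.isCoverMap.injOn s hs hγc hc (hmk c)
  exact X.faithful γ fun y => hfix y (X.connected x y)

theorem subsingleton_of_isEmpty (X : GComplex G V) [IsEmpty V] : Subsingleton G :=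
  ⟨fun g h => by
    rw [X.faithful g fun x => isEmptyElim x, X.faithful h fun x => isEmptyElim x]⟩

theorem countable_vertices (X : GComplex G V) : Countable V := by
  rcases isEmpty_or_nonempty V with hV | ⟨⟨x⟩⟩
  · infer_instance
  · let N : V → Set V := fun a => ⋃ s ∈ {t ∈ X.faces | ({a} : Finset V) ⊆ t}, (s : Set V)
    have hN : ∀ a, (N a).Countable := fun a =>
      ((X.locallyFinite {a} (X.singleton_mem a)).countable).biUnion fun s _ =>
        s.finite_toSet.countable
    let B : ℕ → Set V := fun n => Nat.rec {x} (fun _ b => ⋃ a ∈ b, N a) n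
    have hB : ∀ n, (B n).Countable := by
      intro n
      induction n with
      | zero => exact Set.countable_singleton x
      | succ n ih => exact ih.biUnion fun a _ => hN a
    have hall : ∀ y, ∃ n, y ∈ B n := by
      intro y
      have := X.connected x y
      induction this with
      | refl => exact ⟨0, rfl⟩
      | @tail b c _ hbc ih =>
        obtain ⟨n, hn⟩ := ih
        obtain ⟨s, hs, hb, hc⟩ := hbc
        refine ⟨n + 1, Set.mem_biUnion hn ?_⟩
        exact Set.mem_biUnion (show s ∈ {t ∈ X.faces | ({b} : Finset V) ⊆ t} from
          ⟨hs, by simpa using hb⟩) hc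
    rw [← Set.countable_univ_iff]
    exact (Set.countable_iUnion hB).mono fun y _ => Set.mem_iUnion.2 (hall y)

end Basic

section Topology

variable {G : Type u} {V : Type v} [Group G] [TopologicalSpace G] [IsTopologicalGroup G]
  [MulAction G V]

theorem IsQuotient.discreteTopology {X : GComplex G V} {Γ : Subgroup G} (h : X.IsQuotient Γ) :
    DiscreteTopology Γ := by
  rcases isEmpty_or_nonempty V with hV | ⟨⟨x⟩⟩
  · have := X.subsingleton_of_isEmpty
    infer_instance
  · refine discreteTopology_of_isOpen_singleton_one ?_
    convert (X.isOpen_smul_eq x).preimage (continuous_subtype_val (p := (· ∈ Γ))) using 1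
    ext γ
    constructor
    · rintro rfl
      simp
    · intro hγ
      exact Subtype.ext (h.eq_one γ.2 hγ)

theorem isOpen_smul_eq' (X : GComplex G V) (x y : V) : IsOpen {g : G | g • x = y} := by
  by_cases h : ∃ k : G, k • x = y
  · obtain ⟨k, rfl⟩ := h
    convert (X.isOpen_smul_eq x).preimage (continuous_const_mul k⁻¹) using 1
    ext g
    simp only [Set.mem_ofPred_eq, Set.mem_preimage, mul_smul, inv_smul_eq_iff]
  · convert isOpen_empty
    ext g
    simp only [Set.mem_ofPred_eq, Set.mem_empty_iff_false, iff_false]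
    exact fun hg => h ⟨g, hg⟩

/-- A group acting on a `G`-complex is second countable. -/
theorem secondCountableTopology (X : GComplex G V) : SecondCountableTopology G := by
  have hc := X.countable_vertices
  rcases isEmpty_or_nonempty V with hV | ⟨⟨x⟩⟩
  · have := X.subsingleton_of_isEmpty
    infer_instance
  · have hbasis : TopologicalSpace.IsTopologicalBasis
        (Set.range fun P : Finset (V × V) => {g : G | ∀ p ∈ P, g • p.1 = p.2}) := by
      refine TopologicalSpace.isTopologicalBasis_of_isOpen_of_nhds ?_ ?_
      · rintro _ ⟨P, rfl⟩
        have : {g : G | ∀ p ∈ P, g • p.1 = p.2} = ⋂ p ∈ P, {g : G | g • p.1 = p.2} := by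
          ext g; simp
        change IsOpen {g : G | ∀ p ∈ P, g • p.1 = p.2}
        rw [this]
        exact isOpen_biInter_finset fun p _ => X.isOpen_smul_eq' p.1 p.2
      · intro k U hk hU
        -- translate `U` to a neighbourhood of the identity
        let U' : Set G := (fun g => k * g) ⁻¹' U
        have hU' : IsOpen U' := hU.preimage (continuous_const_mul k)
        have hcl : ∀ y : V, IsClosed {g : G | g • y = y} := fun y =>
          Subgroup.isClosed_of_isOpen (MulAction.stabilizer G y) (X.isOpen_smul_eq y)
        obtain ⟨t, ht⟩ := ((X.isCompact_smul_eq x).inter_right hU'.isClosed_compl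
          ).elim_finite_subfamily_closed (fun y : V => {g : G | g • y = y}) hcl (by
            rw [Set.eq_empty_iff_forall_notMem]
            rintro g ⟨⟨_, hg⟩, hg'⟩
            refine hg ?_
            rw [X.faithful g fun y => Set.mem_iInter.1 hg' y]
            change k * 1 ∈ U
            rwa [mul_one])
        classical
        refine ⟨_, ⟨(insert x t).image fun y => (y, k • y), rfl⟩, ?_, ?_⟩
        · intro p hp
          obtain ⟨y, _, rfl⟩ := Finset.mem_image.1 hp
          rfl
        · intro g hg
          have hg' : ∀ y ∈ insert x t, (k⁻¹ * g) • y = y := fun y hy => by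
            rw [mul_smul, inv_smul_eq_iff]
            exact hg (y, k • y) (Finset.mem_image_of_mem _ hy)
          by_contra hgU
          refine Set.eq_empty_iff_forall_notMem.1 ht (k⁻¹ * g) ⟨⟨?_, ?_⟩, ?_⟩
          · exact hg' x (Finset.mem_insert_self _ _)
          · change ¬ k * (k⁻¹ * g) ∈ U
            rwa [mul_inv_cancel_left]
          · exact Set.mem_iInter₂.2 fun y hy => hg' y (Finset.mem_insert_of_mem hy)
    exact hbasis.secondCountableTopology (Set.countable_range _)

end Topology

section L2

variable {G : Type u} {V : Type v} [Group G] [TopologicalSpace G] [IsTopologicalGroup G]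
  [LocallyCompactSpace G] [T2Space G] [MeasurableSpace G] [BorelSpace G] [MulAction G V]
  (X : GComplex G V)

/-- The unitary representation `L²(Γ \ G)` of `G`, for `Γ ≤_X G`. -/
def L2Quotient {Γ : Subgroup G} (hΓ : X.IsQuotient Γ) (μ : Measure G) [μ.IsHaarMeasure]
    [μ.IsMulRightInvariant] : UnitaryRep G :=
  have := X.secondCountableTopology
  have := hΓ.discreteTopology
  UnitaryRep.L2RightCosets Γ μ

/-- The unitary representation `L²(1 \ G)` of `G`. -/
def L2Group (μ : Measure G) [μ.IsHaarMeasure] [μ.IsMulRightInvariant] : UnitaryRep G :=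
  X.L2Quotient X.isQuotient_bot μ

/-- A unitary representation is tempered if it is weakly contained in `L²(1 \ G)`. -/
def IsTempered (μ : Measure G) [μ.IsHaarMeasure] [μ.IsMulRightInvariant] (W : UnitaryRep G) :
    Prop :=
  W.IsWeaklyContained (X.L2Group μ)

end L2

end GComplex

/-! ## The category `𝒞(G, X)` of `G`-quotients of `X` -/

namespace GComplex

section QuotCat

variable {G : Type u} {V : Type v} [Group G] [TopologicalSpace G] [MulAction G V]

/-- The objects of `𝒞(G, X)`: the quotients `Γ \ X` with `Γ ≤_X G`. -/
structure QuotCat (X : GComplex G V) where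
  Γ : Subgroup G
  isQuotient : X.IsQuotient Γ

namespace QuotCat

variable {X : GComplex G V}

/-- The morphisms `Γ' \ X → Γ \ X` of `𝒞(G, X)`, viewed as maps of vertices: the projection
`Γ' v ↦ Γ v` if `Γ' ≤ Γ`, and moreover the maps `v ↦ Γ g v` (`g ∈ G`) if `Γ' = 1`. -/
def IsMor (A B : X.QuotCat)
    (f : MulAction.orbitRel.Quotient A.Γ V → MulAction.orbitRel.Quotient B.Γ V) : Prop :=
  (A.Γ ≤ B.Γ ∧ ∀ v, f (mkVertex V A.Γ v) = mkVertex V B.Γ v) ∨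
    (A.Γ = ⊥ ∧ ∃ g : G, ∀ v, f (mkVertex V A.Γ v) = mkVertex V B.Γ (g • v))

theorem IsMor.comp {A B C : X.QuotCat}
    {f : MulAction.orbitRel.Quotient A.Γ V → MulAction.orbitRel.Quotient B.Γ V}
    {f' : MulAction.orbitRel.Quotient B.Γ V → MulAction.orbitRel.Quotient C.Γ V}
    (hf : IsMor A B f) (hf' : IsMor B C f') : IsMor A C (f' ∘ f) := by
  rcases hf with ⟨hAB, h⟩ | ⟨hA, g, h⟩ <;> rcases hf' with ⟨hBC, h'⟩ | ⟨hB, g', h'⟩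
  · exact Or.inl ⟨hAB.trans hBC, fun v => by simp [h, h']⟩
  · exact Or.inr ⟨le_bot_iff.1 (hB ▸ hAB), g', fun v => by simp [h, h']⟩
  · exact Or.inr ⟨hA, g, fun v => by simp [h, h']⟩
  · exact Or.inr ⟨hA, g' * g, fun v => by simp [h, h', mul_smul]⟩

instance : Category X.QuotCat where
  Hom A B := {f : MulAction.orbitRel.Quotient A.Γ V → MulAction.orbitRel.Quotient B.Γ V //
    IsMor A B f}
  id A := ⟨id, Or.inl ⟨le_rfl, fun _ => rfl⟩⟩
  comp f g := ⟨g.1 ∘ f.1, f.2.comp g.2⟩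

variable (X) in
/-- The object `X = 1 \ X`. -/
def base : X.QuotCat := ⟨⊥, X.isQuotient_bot⟩

/-- The identification of `1 \ V` with `V`. -/
def vertexOfBot : MulAction.orbitRel.Quotient (⊥ : Subgroup G) V → V :=
  Quotient.lift id fun a b h => by
    obtain ⟨γ, h⟩ := MulAction.orbitRel_apply.1 h
    have hγ : γ = 1 := Subsingleton.elim _ _
    subst hγ
    simpa using h.symm

/-- The morphism `p_Γ ∘ g : X → Γ \ X`, `v ↦ Γ g v`. -/
def projMul (A : X.QuotCat) (g : G) : base X ⟶ A :=
  ⟨fun q => mkVertex V A.Γ (g • vertexOfBot q), Or.inr ⟨rfl, g, fun _ => rfl⟩⟩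

/-- The quotient map `p_Γ : X → Γ \ X`. -/
def proj (A : X.QuotCat) : base X ⟶ A := projMul A 1

variable (X) in
/-- The endomorphism of `X = 1 \ X` given by `g ∈ G`. -/
def act (g : G) : base X ⟶ base X := projMul (base X) g

theorem act_one : act X 1 = 𝟙 (base X) := by
  refine Subtype.ext (funext fun q => ?_)
  obtain ⟨v, rfl⟩ := mkVertex_surjective _ q
  change mkVertex V ⊥ ((1 : G) • v) = mkVertex V ⊥ v
  rw [one_smul]

theorem act_mul (g h : G) : act X (g * h) = act X h ≫ act X g := by
  refine Subtype.ext (funext fun q => ?_)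
  obtain ⟨v, rfl⟩ := mkVertex_surjective _ q
  change mkVertex V ⊥ ((g * h) • v) = mkVertex V ⊥ (g • h • v)
  rw [mul_smul]

/-- The set `S(X)`, for a functor `S` from `𝒞(G, X)` to sets. -/
def Fiber (S : X.QuotCat ⥤ Type u) : Type u := S.obj (base X)

/-- The action of `G` on `S(X)`. -/
instance (S : X.QuotCat ⥤ Type u) : MulAction G (Fiber S) where
  smul g x := S.map (act X g) x
  one_smul x := by
    change S.map (act X 1) x = x
    rw [act_one, S.map_id]
    rfl
  mul_smul g h x := by
    change S.map (act X (g * h)) x = S.map (act X g) (S.map (act X h) x)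
    rw [act_mul, S.map_comp]
    rfl

end QuotCat

end QuotCat

end GComplex

/-! ## Pre-Hilbert spaces and (semi-)elementary functors -/

/-- Bundled complex pre-Hilbert spaces. -/
structure PHil : Type (u + 1) where
  carrier : Type u
  [normedAddCommGroup : NormedAddCommGroup carrier]
  [innerProductSpace : InnerProductSpace ℂ carrier]

attribute [instance] PHil.normedAddCommGroup PHil.innerProductSpace

namespace PHil

/-- The category of pre-Hilbert spaces and (not necessarily continuous) linear maps. -/
instance : Category PHil.{u} where
  Hom E E' := E.carrier →ₗ[ℂ] E'.carrier
  id E := LinearMap.id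
  comp f g := g ∘ₗ f

/-- The linear map underlying a morphism. -/
def lin {E E' : PHil.{u}} (f : E ⟶ E') : E.carrier →ₗ[ℂ] E'.carrier := f

theorem lin_comp {E E' E'' : PHil.{u}} (f : E ⟶ E') (g : E' ⟶ E'') (v : E.carrier) :
    lin (f ≫ g) v = lin g (lin f v) := rfl

theorem lin_id {E : PHil.{u}} (v : E.carrier) : lin (𝟙 E) v = v := rfl

end PHil

/-- The space of finitely supported functions `Y → ℂ`. -/
def FinL2 (Y : Type u) : Type u := Y →₀ ℂ

namespace FinL2

instance (Y : Type u) : AddCommGroup (FinL2 Y) := inferInstanceAs (AddCommGroup (Y →₀ ℂ))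

instance (Y : Type u) : Module ℂ (FinL2 Y) := inferInstanceAs (Module ℂ (Y →₀ ℂ))

/-- The inner product `∑ y, conj (φ y) * ψ y` (conjugate-linear in the first variable). -/
abbrev core (Y : Type u) : InnerProductSpace.Core ℂ (FinL2 Y) where
  inner φ ψ := Finsupp.sum (α := Y) φ fun y c => starRingEnd ℂ c * (show Y →₀ ℂ from ψ) y
  conj_inner_symm φ ψ := by
    classical
    let φ' : Y →₀ ℂ := φ
    let ψ' : Y →₀ ℂ := ψ
    change starRingEnd ℂ (ψ'.sum fun y c => starRingEnd ℂ c * φ' y) =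
      φ'.sum fun y c => starRingEnd ℂ c * ψ' y
    rw [Finsupp.sum_of_support_subset ψ' (Finset.subset_union_left (s₂ := φ'.support)) _
      (by simp), Finsupp.sum_of_support_subset φ' (Finset.subset_union_right (s₁ := ψ'.support)) _
      (by simp), map_sum]
    refine Finset.sum_congr rfl fun y _ => ?_
    simp [mul_comm]
  re_inner_nonneg φ := by
    let φ' : Y →₀ ℂ := φ
    change 0 ≤ RCLike.re (φ'.sum fun y c => starRingEnd ℂ c * φ' y)
    rw [Finsupp.sum, map_sum]
    refine Finset.sum_nonneg fun y _ => ?_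
    rw [← Complex.normSq_eq_conj_mul_self]
    exact Complex.normSq_nonneg _
  add_left φ φ' ψ := by
    classical
    exact Finsupp.sum_add_index' (by simp) (by simp [add_mul])
  smul_left φ ψ r := by
    let φ' : Y →₀ ℂ := φ
    let ψ' : Y →₀ ℂ := ψ
    change (r • φ').sum (fun y c => starRingEnd ℂ c * ψ' y) =
      starRingEnd ℂ r * φ'.sum fun y c => starRingEnd ℂ c * ψ' y
    rw [Finsupp.sum_smul_index (by simp), Finsupp.mul_sum]
    simp [mul_assoc]
  definite φ h := by
    let φ' : Y →₀ ℂ := φ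
    change (φ'.sum fun y c => starRingEnd ℂ c * φ' y) = 0 at h
    change φ' = 0
    simp_rw [Finsupp.sum, ← Complex.normSq_eq_conj_mul_self] at h
    have h' : ∑ y ∈ φ'.support, Complex.normSq (φ' y) = 0 := by exact_mod_cast h
    rw [Finset.sum_eq_zero_iff_of_nonneg fun y _ => Complex.normSq_nonneg _] at h'
    ext y
    by_contra hy
    exact hy (Complex.normSq_eq_zero.1 (h' y (Finsupp.mem_support_iff.2 hy)))

instance (Y : Type u) : NormedAddCommGroup (FinL2 Y) := (core Y).toNormedAddCommGroup

instance (Y : Type u) : InnerProductSpace ℂ (FinL2 Y) := InnerProductSpace.ofCore (core Y).toCore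

theorem inner_single (Y : Type u) (y z : Y) (a b : ℂ) :
    inner ℂ (show FinL2 Y from Finsupp.single y a) (show FinL2 Y from Finsupp.single z b) =
      starRingEnd ℂ a * Finsupp.single z b y := by
  change Finsupp.sum (Finsupp.single y a) (fun x c => starRingEnd ℂ c * Finsupp.single z b x) = _
  rw [Finsupp.sum_single_index (by simp)]

end FinL2

/-- The functor `Y ↦` (finitely supported functions on `Y`), sending a map `f` to the linear map
`f_*` with `f_* e_y = e_{f y}`. -/
def finL2Functor : Type u ⥤ PHil.{u} where
  obj Y := ⟨FinL2 Y⟩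
  map {Y Z} f := (Finsupp.lmapDomain ℂ ℂ (fun y : Y => f y) : (Y →₀ ℂ) →ₗ[ℂ] (Z →₀ ℂ))
  map_id _ := Finsupp.lmapDomain_id ℂ ℂ
  map_comp {Y Z _} f g := Finsupp.lmapDomain_comp ℂ ℂ (fun y : Y => f y) (fun z : Z => g z)

/-- The (orthogonal) direct sum of two functors to pre-Hilbert spaces. -/
def directSum {C : Type*} [Category C] (F F' : C ⥤ PHil.{u}) : C ⥤ PHil.{u} where
  obj A := ⟨WithLp 2 ((F.obj A).carrier × (F'.obj A).carrier)⟩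
  map {A B} f := ((WithLp.linearEquiv 2 ℂ ((F.obj B).carrier × (F'.obj B).carrier)).symm.toLinearMap
    ∘ₗ ((PHil.lin (F.map f)).prodMap (PHil.lin (F'.map f)))
    ∘ₗ (WithLp.linearEquiv 2 ℂ ((F.obj A).carrier × (F'.obj A).carrier)).toLinearMap :
      WithLp 2 ((F.obj A).carrier × (F'.obj A).carrier) →ₗ[ℂ]
        WithLp 2 ((F.obj B).carrier × (F'.obj B).carrier))
  map_id A := by
    rw [F.map_id, F'.map_id]
    rfl
  map_comp f g := by
    rw [F.map_comp, F'.map_comp]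
    rfl

section Elementary

variable {G : Type u} {V : Type v} [Group G] [TopologicalSpace G] [MulAction G V]
  {X : GComplex G V}

open GComplex GComplex.QuotCat

/-- `F` is elementary by means of the functor `S` from `𝒞(G, X)` to sets. -/
structure ElementaryBy (S : X.QuotCat ⥤ Type u) (F : X.QuotCat ⥤ PHil.{u}) : Prop where
  /-- There is a unitary natural isomorphism `ℓ̃² ∘ S ≅ F`. -/
  exists_iso : ∃ η : S ⋙ finL2Functor ≅ F, ∀ (A : X.QuotCat) (φ ψ : FinL2 (S.obj A)),
    inner ℂ (PHil.lin (η.hom.app A) φ) (PHil.lin (η.hom.app A) ψ) = inner ℂ φ ψ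
  /-- Stabilizers in `S(X)` are compact and open, and each one stabilizes a nonempty cell. -/
  isCompact_stabilizer : ∀ x : Fiber S, IsCompact (MulAction.stabilizer G x : Set G)
  isOpen_stabilizer : ∀ x : Fiber S, IsOpen (MulAction.stabilizer G x : Set G)
  stabilizer_le : ∀ x : Fiber S, ∃ c : X.Cell,
    MulAction.stabilizer G x ≤ MulAction.stabilizer G c
  /-- `Γ x ↦ (S p_Γ) x` is a bijection from `Γ \ S(X)` to `S(Γ \ X)`. -/
  proj_surjective : ∀ A : X.QuotCat, Function.Surjective fun x : Fiber S => S.map (proj A) x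
  proj_eq_iff : ∀ (A : X.QuotCat) (x y : Fiber S),
    S.map (proj A) x = S.map (proj A) y ↔ ∃ γ ∈ A.Γ, γ • x = y
  /-- `G \ S(X)` is finite. -/
  finite_orbits : Finite (MulAction.orbitRel.Quotient G (Fiber S))

/-- Elementary functors. -/
def IsElementary (F : X.QuotCat ⥤ PHil.{u}) : Prop :=
  ∃ S : X.QuotCat ⥤ Type u, ElementaryBy S F

/-- Semi-elementary functors: those `F` for which `F ⊕ F'` is elementary for some `F'`. -/
def IsSemiElementary (F : X.QuotCat ⥤ PHil.{u}) : Prop :=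
  ∃ F' : X.QuotCat ⥤ PHil.{u}, IsElementary (directSum F F')

end Elementary

/-! ## The algebra of associated operators -/

section Operators

variable {C : Type*} [Category C] (F : C ⥤ PHil.{u})

/-- Families of linear operators `a_Y : F Y → F Y`, for `Y` in `C`. -/
abbrev OpFamily : Type _ := (Y : C) → Module.End ℂ (F.obj Y).carrier

variable {F}

/-- The family `a` is a natural transformation `F → F`. -/
def IsNatural (a : OpFamily F) : Prop :=
  ∀ ⦃Y Z : C⦄ (f : Y ⟶ Z) (v : (F.obj Y).carrier),
    a Z (PHil.lin (F.map f) v) = PHil.lin (F.map f) (a Y v)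

/-- `b_Y` is a dual of `a_Y` for every `Y`. -/
def IsDual (a b : OpFamily F) : Prop :=
  ∀ (Y : C) (u v : (F.obj Y).carrier), inner ℂ (a Y u) v = inner ℂ u (b Y v)

theorem IsDual.symm {a b : OpFamily F} (h : IsDual a b) : IsDual b a := fun Y u v => by
  rw [← inner_conj_symm, ← h Y v u, inner_conj_symm]

theorem IsDual.unique {a b c : OpFamily F} (h : IsDual a b) (h' : IsDual a c) : b = c := by
  funext Y
  ext v
  exact ext_inner_left ℂ fun u => by rw [← h Y u v, ← h' Y u v]

theorem IsDual.add {a b a' b' : OpFamily F} (h : IsDual a b) (h' : IsDual a' b') :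
    IsDual (a + a') (b + b') := fun Y u v => by
  change inner ℂ (a Y u + a' Y u) v = inner ℂ u (b Y v + b' Y v)
  rw [inner_add_left, inner_add_right, h Y, h' Y]

theorem IsDual.mul {a b a' b' : OpFamily F} (h : IsDual a b) (h' : IsDual a' b') :
    IsDual (a * a') (b' * b) := fun Y u v => by
  change inner ℂ (a Y (a' Y u)) v = inner ℂ u (b' Y (b Y v))
  rw [h Y, h' Y]

theorem IsDual.smul {a b : OpFamily F} (h : IsDual a b) (r : ℂ) :
    IsDual (r • a) (starRingEnd ℂ r • b) := fun Y u v => by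
  change inner ℂ (r • a Y u) v = inner ℂ u (starRingEnd ℂ r • b Y v)
  rw [inner_smul_left, inner_smul_right, h Y]

theorem IsDual.algebraMap (r : ℂ) :
    IsDual (algebraMap ℂ (OpFamily F) r) (algebraMap ℂ (OpFamily F) (starRingEnd ℂ r)) :=
  fun Y u v => by
    change inner ℂ (r • u) v = inner ℂ u (starRingEnd ℂ r • v)
    rw [inner_smul_left, inner_smul_right]

theorem IsNatural.add {a b : OpFamily F} (ha : IsNatural a) (hb : IsNatural b) :
    IsNatural (a + b) := fun Y Z f v => by
  change a Z _ + b Z _ = PHil.lin (F.map f) (a Y v + b Y v)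
  rw [ha f, hb f, map_add]

theorem IsNatural.mul {a b : OpFamily F} (ha : IsNatural a) (hb : IsNatural b) :
    IsNatural (a * b) := fun Y Z f v => by
  change a Z (b Z _) = PHil.lin (F.map f) (a Y (b Y v))
  rw [hb f, ha f]

theorem IsNatural.smul {a : OpFamily F} (ha : IsNatural a) (r : ℂ) :
    IsNatural (r • a) := fun Y Z f v => by
  change r • a Z _ = PHil.lin (F.map f) (r • a Y v)
  rw [ha f, map_smul]

theorem IsNatural.algebraMap (r : ℂ) : IsNatural (algebraMap ℂ (OpFamily F) r) :=
  fun Y Z f v => by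
    change r • PHil.lin (F.map f) v = PHil.lin (F.map f) (r • v)
    rw [map_smul]

variable (F) in
/-- The algebra of `(C, F)`-operators: the natural transformations `a : F → F` that admit a dual,
i.e. a natural transformation `b : F → F` such that `b_Y` is a dual of `a_Y` for all `Y`. -/
def opAlgebra : Subalgebra ℂ (OpFamily F) where
  carrier := {a | IsNatural a ∧ ∃ b, IsNatural b ∧ IsDual a b}
  mul_mem' := fun ⟨ha, b, hb, hab⟩ ⟨ha', b', hb', hab'⟩ =>
    ⟨ha.mul ha', b' * b, hb'.mul hb, hab.mul hab'⟩
  add_mem' := fun ⟨ha, b, hb, hab⟩ ⟨ha', b', hb', hab'⟩ =>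
    ⟨ha.add ha', b + b', hb.add hb', hab.add hab'⟩
  algebraMap_mem' r := ⟨.algebraMap r, _, .algebraMap _, .algebraMap r⟩

/-- The dual of a `(C, F)`-operator. -/
def opDual (a : opAlgebra F) : opAlgebra F :=
  ⟨a.2.2.choose, a.2.2.choose_spec.1, a.1, a.2.1, a.2.2.choose_spec.2.symm⟩

theorem isDual_opDual (a : opAlgebra F) : IsDual a.1 (opDual a).1 := a.2.2.choose_spec.2

theorem eq_opDual {a b : opAlgebra F} (h : IsDual a.1 b.1) : opDual a = b :=
  Subtype.ext ((isDual_opDual a).unique h)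

/-- The `*`-algebra structure: the involution is given by taking duals. -/
instance : StarRing (opAlgebra F) where
  star := opDual
  star_involutive a := eq_opDual (isDual_opDual a).symm
  star_mul a b := eq_opDual ((isDual_opDual a).mul (isDual_opDual b))
  star_add a b := eq_opDual ((isDual_opDual a).add (isDual_opDual b))

theorem inner_star (a : opAlgebra F) (Y : C) (u v : (F.obj Y).carrier) :
    inner ℂ (a.1 Y u) v = inner ℂ u ((star a).1 Y v) := isDual_opDual a Y u v

instance : StarModule ℂ (opAlgebra F) where
  star_smul r a := eq_opDual ((isDual_opDual a).smul r)

end Operators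

/-! ## Unitary representations of `*`-algebras -/

/-- A unitary representation of a unital `*`-algebra `A`: a Hilbert space with an action of `A` by
bounded operators such that `⟨a u, v⟩ = ⟨u, a^* v⟩` and such that `A V` is dense in `V`. -/
structure AlgRep (A : Type u) [Ring A] [Algebra ℂ A] [StarRing A] : Type (u + 1) where
  carrier : Type u
  [normedAddCommGroup : NormedAddCommGroup carrier]
  [innerProductSpace : InnerProductSpace ℂ carrier]
  [completeSpace : CompleteSpace carrier]
  ρ : A →⋆ₙₐ[ℂ] (carrier →L[ℂ] carrier)
  dense_smooth : Dense (Submodule.span ℂ {w : carrier | ∃ a v, w = ρ a v} : Set carrier)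

attribute [instance] AlgRep.normedAddCommGroup AlgRep.innerProductSpace AlgRep.completeSpace

namespace AlgRep

variable {A : Type u} [Ring A] [Algebra ℂ A] [StarRing A]

/-- (Topological) irreducibility: nonzero, and no closed submodules besides `0` and `V`. -/
def IsIrreducible (V : AlgRep A) : Prop :=
  Nontrivial V.carrier ∧ ∀ W : Submodule ℂ V.carrier, IsClosed (W : Set V.carrier) →
    (∀ a : A, ∀ w ∈ W, V.ρ a w ∈ W) → W = ⊥ ∨ W = ⊤

/-- Weak containment `V ≺ V'` (for irreducible `V`). -/
def IsWeaklyContained (V V' : AlgRep A) : Prop :=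
  ∀ v : V.carrier, ‖v‖ = 1 → ∀ ε : ℝ, 0 < ε → ∀ T : Finset A,
    ∃ v' : V'.carrier, ‖v'‖ = 1 ∧
      ∀ a ∈ T, ‖inner ℂ v (V.ρ a v) - inner ℂ v' (V'.ρ a v')‖ < ε

end AlgRep

/-! ## Spectrum, trivial spectrum and Ramanujan quotients -/

section Ramanujan

variable {G : Type u} {V : Type v} [Group G] [TopologicalSpace G] [MulAction G V]
  {X : GComplex G V}

open GComplex GComplex.QuotCat

/-- `U` is the unitary representation of the algebra of `(𝒞, F)`-operators on the Hilbert space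
completion of the pre-Hilbert space `F(Γ \ X)`. -/
def IsCompletionAt (F : X.QuotCat ⥤ PHil.{u}) (A : X.QuotCat) (U : AlgRep (opAlgebra F)) : Prop :=
  ∃ j : (F.obj A).carrier →ₗᵢ[ℂ] U.carrier, DenseRange j ∧
    ∀ (a : opAlgebra F) (φ : (F.obj A).carrier), j (a.1 A φ) = U.ρ a (j φ)

/-- The irreducible representation `W` belongs to the `F`-spectrum of `Γ \ X`. -/
def InSpectrum (F : X.QuotCat ⥤ PHil.{u}) (A : X.QuotCat) (W : AlgRep (opAlgebra F)) : Prop :=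
  ∃ U : AlgRep (opAlgebra F), IsCompletionAt F A U ∧ W.IsWeaklyContained U

/-- The subspace of `F(X)` spanned by the elements `φ - g φ` with `φ ∈ F(X)` and `g ∈ N`. -/
def coinvKer (F : X.QuotCat ⥤ PHil.{u}) (N : Subgroup G) :
    Submodule ℂ (F.obj (base X)).carrier :=
  Submodule.span ℂ {ψ | ∃ φ, ∃ g ∈ N, ψ = φ - PHil.lin (F.map (act X g)) φ}

/-- `U` is a unitary representation whose underlying module over the algebra of `(𝒞, F)`-operators
is the space of coinvariants `F(X)_N`. -/
def IsCoinvariants (F : X.QuotCat ⥤ PHil.{u}) (N : Subgroup G) (U : AlgRep (opAlgebra F)) :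
    Prop :=
  ∃ e : ((F.obj (base X)).carrier ⧸ coinvKer F N) ≃ₗ[ℂ] U.carrier,
    ∀ (a : opAlgebra F) (φ : (F.obj (base X)).carrier),
      e ((coinvKer F N).mkQ (a.1 (base X) φ)) = U.ρ a (e ((coinvKer F N).mkQ φ))

/-- The irreducible representation `W` belongs to the trivial `F`-spectrum: it belongs to the
spectrum of `F(X)_N` for some open finite index subgroup `N` of `G`. -/
def InTrivialSpectrum (F : X.QuotCat ⥤ PHil.{u}) (W : AlgRep (opAlgebra F)) : Prop :=
  ∃ N : Subgroup G, IsOpen (N : Set G) ∧ N.FiniteIndex ∧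
    ∃ U : AlgRep (opAlgebra F), IsCoinvariants F N U ∧ W.IsWeaklyContained U

/-- `Γ \ X` is `F`-Ramanujan: its `F`-spectrum is contained in the union of the `F`-spectrum of `X`
and the trivial `F`-spectrum. -/
def FRamanujan (F : X.QuotCat ⥤ PHil.{u}) (A : X.QuotCat) : Prop :=
  ∀ W : AlgRep (opAlgebra F), W.IsIrreducible → InSpectrum F A W →
    InSpectrum F (base X) W ∨ InTrivialSpectrum F W

/-- `Γ \ X` is completely Ramanujan. -/
def CompletelyRamanujan (A : X.QuotCat) : Prop :=
  ∀ F : X.QuotCat ⥤ PHil.{u}, IsSemiElementary F → FRamanujan F A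

end Ramanujan

end RamanujanQuotients

end

open CategoryTheory MeasureTheory RamanujanQuotients

/-!
Both equivalences compare irreducible unitary representations of `G` with irreducible unitary
representations of the algebra `A_F` of adjointable natural transformations of `F`.

*The algebra.* A semi-elementary functor `F` is a direct summand of `ℓ̃² ∘ S` for a functor `S` to
sets (`Summand`). Since `S(Γ \ X)` is the orbit space `Γ \ S(X)`, an element of `A_F` is determined
by its action at the object `X`, so `A_F` is the algebra of `G`-invariant kernels on `Ω = S(X)`,
compressed by the idempotent that projects to `F(X)` (`Summand.kernelAlgebra`). This is all that is
used of `A_F`, and `KernelAlgebra` isolates it. Invariant kernels are spanned by the kernels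
`(u, v) ↦ μ {g | g y = u, g z = v}` (`transport`), which define elements `τ y z` of `A_F`.

*The correspondence.* A unitary representation `H` of `G` yields the representation
`KernelAlgebra.rep` of `A_F` on the equivariant families `f : Ω → H` fixed by the idempotent. The
inner products of the values of families are matrix coefficients, `⟨f, τ y z f'⟩ = ⟨f y, f' z⟩`
(`KernelAlgebra.inner_ρ_τ`). Conversely, the coefficients of a family are given by those of its
values at orbit representatives, which are fixed by the stabilizers. Therefore
* irreducible representations of `G` yield irreducible representations of `A_F`, or zero
  (`KernelAlgebra.isIrreducible_rep`);
* weak containment passes in both directions (`KernelAlgebra.isWeaklyContained_rep`,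
  `KernelAlgebra.isWeaklyContained_of_coef_mem`);
* an irreducible representation of `A_F` that is weakly contained in the representation obtained from
  some `H` itself comes from an irreducible representation of `G`, which is constructed from its Gram
  matrix `⟨w, τ y z w⟩` (`KernelAlgebra.exists_irreducible_of_coef_mem`).

*The spectra.* The completion of `F(Γ \ X)` corresponds to `L²(Γ \ G)`, by pulling functions on
`Γ \ S(X)` back along the maps `Γ g ↦ Γ g x` (`Summand.isCompletionAt_rep`). For an open normal
subgroup `N` of finite index, the coinvariants `F(X)_N` correspond to the functions on `G / N`
(`Summand.isCoinvariants_rep`), so the trivial spectrum corresponds to the representations with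
finite action (`Summand.inTrivialSpectrum_rep`, `Summand.hasFiniteAction_of_inTrivialSpectrum`). This
gives the criterion `Summand.fRamanujan_iff`, in which `V` runs over the irreducible representations
with nonzero equivariant families. When `F` is elementary, these are the `V` with nonzero vectors
fixed by the stabilizer of some orbit representative (`Summand.nontrivial_rep_iff`).

*Complete Ramanujan quotients.* As `G` is totally disconnected, every irreducible `V` has nonzero
vectors fixed by some compact open subgroup `K` of the stabilizer of a vertex, and
`Γ \ X ↦ Γ \ G / K` defines an elementary functor (`elementaryBy_cosetFunctor`), whose criterion
applies to `V`.

*Finite quotients.* In this case `Γ \ G` is compact, so `L²(Γ \ G)^K` is finite-dimensional for `K`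
compact open. By compactness of balls, the coefficient of a `K`-fixed vector of `V ≺ L²(Γ \ G)` is
then equal to one of `L²(Γ \ G)`, so that `V ≤ L²(Γ \ G)`
(`GComplex.IsFiniteQuotient.isWeaklyContained_iff`). If moreover `V` is finite-dimensional, then the
kernel `N` of the action is open, `V` consists of functions on the finite set `Γ N \ G`, and the
action is finite (`GComplex.IsFiniteQuotient.hasFiniteAction_iff`).
-/

noncomputable section

open CategoryTheory MeasureTheory Topology

set_option linter.unusedSectionVars false

namespace RamanujanQuotients

/-! ### Weak containment through diagonal matrix coefficients -/

/-- Closure in the topology of pointwise convergence, in the form in which it occurs in the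
definition of weak containment. -/
theorem mem_closure_fun_iff {ι : Type*} {s : Set (ι → ℂ)} {d : ι → ℂ} :
    d ∈ closure s ↔ ∀ ε : ℝ, 0 < ε → ∀ T : Finset ι, ∃ e ∈ s, ∀ a ∈ T, ‖d a - e a‖ < ε := by
  constructor
  · intro h ε hε T
    have ho : IsOpen {e : ι → ℂ | ∀ a ∈ T, ‖d a - e a‖ < ε} := by
      have : {e : ι → ℂ | ∀ a ∈ T, ‖d a - e a‖ < ε} = ⋂ a ∈ T, {e : ι → ℂ | ‖d a - e a‖ < ε} := by
        ext; simp
      rw [this]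
      exact isOpen_biInter_finset fun a _ => isOpen_lt (by fun_prop) continuous_const
    obtain ⟨e, he, hes⟩ := mem_closure_iff.1 h _ ho (by simp [hε])
    exact ⟨e, hes, he⟩
  · intro h
    rw [mem_closure_iff_nhds]
    intro t ht
    rw [nhds_pi, Filter.mem_pi] at ht
    obtain ⟨I, hI, V, hV, hsub⟩ := ht
    choose r hr hrV using fun i => Metric.mem_nhds_iff.1 (hV i)
    classical
    obtain ⟨ε, hε, hle⟩ : ∃ ε : ℝ, 0 < ε ∧ ∀ i ∈ hI.toFinset, ε ≤ r i := by
      induction hI.toFinset using Finset.induction_on with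
      | empty => exact ⟨1, one_pos, by simp⟩
      | insert a s _ ih =>
        obtain ⟨ε, hε, h⟩ := ih
        refine ⟨min ε (r a), lt_min hε (hr a), fun i hi => ?_⟩
        rcases Finset.mem_insert.1 hi with rfl | hi
        · exact min_le_right _ _
        · exact (min_le_left _ _).trans (h i hi)
    obtain ⟨e, hes, he⟩ := h ε hε hI.toFinset
    refine ⟨e, hsub fun i hi => hrV i ?_, hes⟩
    rw [Metric.mem_ball, dist_comm, dist_eq_norm]
    exact (he i (hI.mem_toFinset.2 hi)).trans_le (hle i (hI.mem_toFinset.2 hi))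

namespace AlgRep

variable {A : Type u} [Ring A] [Algebra ℂ A] [StarRing A]

/-- The diagonal matrix coefficient `a ↦ ⟨w, a w⟩` of a vector `w`. -/
def coef (U : AlgRep A) (w : U.carrier) : A → ℂ := fun a => inner ℂ w (U.ρ a w)

theorem continuous_coef (U : AlgRep A) : Continuous U.coef :=
  continuous_pi fun a => continuous_id.inner (U.ρ a).continuous

/-- Since `A V` is dense in `V`, the unit of `A` acts as the identity. -/
theorem ρ_one (U : AlgRep A) : U.ρ 1 = 1 := by
  refine ContinuousLinearMap.ext_on U.dense_smooth ?_
  rintro _ ⟨a, v, rfl⟩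
  change (U.ρ 1 * U.ρ a) v = U.ρ a v
  rw [← map_mul, one_mul]

theorem ρ_mul (U : AlgRep A) (a b : A) (w : U.carrier) : U.ρ (a * b) w = U.ρ a (U.ρ b w) := by
  rw [map_mul]; rfl

theorem inner_ρ_left (U : AlgRep A) (a : A) (v w : U.carrier) :
    inner ℂ (U.ρ a v) w = inner ℂ v (U.ρ (star a) w) := by
  rw [map_star, ContinuousLinearMap.star_eq_adjoint, ContinuousLinearMap.adjoint_inner_right]

theorem coef_one (U : AlgRep A) (w : U.carrier) : U.coef w 1 = (‖w‖ : ℂ) ^ 2 := by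
  rw [coef, ρ_one]
  exact inner_self_eq_norm_sq_to_K w

theorem coef_smul (U : AlgRep A) (c : ℂ) (w : U.carrier) :
    U.coef (c • w) = (starRingEnd ℂ c * c) • U.coef w := by
  funext a
  simp only [coef, map_smul, inner_smul_left, inner_smul_right, Pi.smul_apply, smul_eq_mul]
  ring

theorem coef_ρ (U : AlgRep A) (b : A) (w : U.carrier) (a : A) :
    U.coef (U.ρ b w) a = U.coef w (star b * a * b) := by
  simp only [coef, ρ_mul, inner_ρ_left]

/-- Weak containment, stated for unit vectors, extends to all vectors by scaling. -/
theorem IsWeaklyContained.coef_mem {W U : AlgRep A} (h : W.IsWeaklyContained U) (w : W.carrier) :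
    W.coef w ∈ closure (Set.range U.coef) := by
  rcases eq_or_ne w 0 with rfl | hw
  · refine subset_closure ⟨0, ?_⟩
    funext a
    simp [coef]
  · have hn : (‖w‖ : ℂ) ≠ 0 := by simpa using hw
    have h1 : W.coef ((‖w‖ : ℂ)⁻¹ • w) ∈ closure (Set.range U.coef) := by
      rw [mem_closure_fun_iff]
      intro ε hε T
      obtain ⟨v', -, h'⟩ := h ((‖w‖ : ℂ)⁻¹ • w) (by simp [norm_smul, hw]) ε hε T
      exact ⟨_, ⟨v', rfl⟩, h'⟩
    have h2 : W.coef w = (starRingEnd ℂ (‖w‖ : ℂ) * ‖w‖) • W.coef ((‖w‖ : ℂ)⁻¹ • w) := by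
      rw [← coef_smul, smul_inv_smul₀ hn]
    rw [h2]
    refine map_mem_closure (continuous_const_smul _) h1 ?_
    rintro _ ⟨v, rfl⟩
    exact ⟨(‖w‖ : ℂ) • v, coef_smul _ _ _⟩

/-- Approximating vectors need not be taken of norm `1`: their norms are controlled by the
coefficient at `1`. -/
theorem isWeaklyContained_of_coef_mem {W U : AlgRep A}
    (h : ∀ w, W.coef w ∈ closure (Set.range U.coef)) : W.IsWeaklyContained U := by
  intro w hw ε hε T
  -- along the filter `l`, coefficients of `U` converge to that of `w`, and dividing by the value at
  -- `1`, which tends to `1`, normalizes the vectors without changing the limit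
  have hne := mem_closure_iff_comap_neBot.1 (h w)
  set l := Filter.comap ((↑) : Set.range U.coef → (A → ℂ)) (𝓝 (W.coef w))
  have hl : Filter.Tendsto ((↑) : Set.range U.coef → (A → ℂ)) l (𝓝 (W.coef w)) :=
    Filter.tendsto_comap
  have hla : ∀ a, Filter.Tendsto (fun e : Set.range U.coef => e.1 a) l (𝓝 (W.coef w a)) :=
    fun a => (tendsto_pi_nhds.1 hl) a
  have h1 : W.coef w 1 = 1 := by rw [coef_one, hw]; simp
  have hq : ∀ a ∈ T, ∀ᶠ e in l, ‖W.coef w a - (e.1 1)⁻¹ * e.1 a‖ < ε := by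
    intro a _
    have ht : Filter.Tendsto (fun e : Set.range U.coef => ‖W.coef w a - (e.1 1)⁻¹ * e.1 a‖) l
        (𝓝 ‖W.coef w a - (W.coef w 1)⁻¹ * W.coef w a‖) :=
      (tendsto_const_nhds.sub (((hla 1).inv₀ (by simp [h1])).mul (hla a))).norm
    refine ht.eventually_lt_const ?_
    simpa [h1] using hε
  have hn : ∀ᶠ e in l, e.1 1 ≠ 0 := (hla 1).eventually_ne (by simp [h1])
  obtain ⟨⟨_, v, rfl⟩, hv1, hv⟩ := (hn.and ((Filter.eventually_all_finset T).2 hq)).exists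
  have hv0 : (‖v‖ : ℂ) ≠ 0 := by
    intro h0
    apply hv1
    simp [coef_one, h0]
  refine ⟨(‖v‖ : ℂ)⁻¹ • v, ?_, fun a ha => ?_⟩
  · rw [norm_smul, norm_inv, Complex.norm_real, norm_norm]
    exact inv_mul_cancel₀ (by simpa using hv0)
  · have h2 := hv a ha
    have h3 : U.coef ((‖v‖ : ℂ)⁻¹ • v) a = (U.coef v 1)⁻¹ * U.coef v a := by
      rw [coef_smul, coef_one, Pi.smul_apply, smul_eq_mul, map_inv₀, Complex.conj_ofReal, sq,
        mul_inv]
    rw [← h3] at h2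
    exact h2

/-- Every nonzero vector of an irreducible representation is cyclic. -/
theorem IsIrreducible.dense_orbit {W : AlgRep A} (hW : W.IsIrreducible) {w : W.carrier}
    (hw : w ≠ 0) :
    Dense (Submodule.span ℂ (Set.range fun a => W.ρ a w) : Set W.carrier) := by
  set M := (Submodule.span ℂ (Set.range fun a => W.ρ a w)).topologicalClosure
  have hinv : ∀ a : A, ∀ x ∈ M, W.ρ a x ∈ M := by
    intro a x hx
    refine map_mem_closure (W.ρ a).continuous hx fun y hy => ?_
    refine Submodule.span_induction (p := fun y _ => W.ρ a y ∈
      Submodule.span ℂ (Set.range fun a => W.ρ a w)) ?_ ?_ ?_ ?_ hy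
    · rintro _ ⟨b, rfl⟩
      exact Submodule.subset_span ⟨a * b, W.ρ_mul a b w⟩
    · rw [map_zero]
      exact Submodule.zero_mem _
    · intro y z _ _ h1 h2
      rw [map_add]
      exact Submodule.add_mem _ h1 h2
    · intro c y _ h1
      rw [map_smul]
      exact Submodule.smul_mem _ _ h1
  rcases hW.2 M (Submodule.isClosed_topologicalClosure _) hinv with h0 | h1
  · exfalso
    have : w ∈ M := Submodule.le_topologicalClosure _
      (Submodule.subset_span ⟨1, by change W.ρ 1 w = w; rw [ρ_one]; rfl⟩)
    rw [h0] at this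
    exact hw ((Submodule.mem_bot ℂ).1 this)
  · exact Submodule.dense_iff_topologicalClosure_eq_top.2 h1

/-- For an irreducible representation, weak containment can be tested on a single nonzero vector,
because every nonzero vector is cyclic. -/
theorem IsIrreducible.isWeaklyContained {W U : AlgRep A} (hW : W.IsIrreducible) {w : W.carrier}
    (hw : w ≠ 0) (h : W.coef w ∈ closure (Set.range U.coef)) : W.IsWeaklyContained U := by
  have hcl : IsClosed {w : W.carrier | W.coef w ∈ closure (Set.range U.coef)} :=
    isClosed_closure.preimage W.continuous_coef
  -- the coefficient of `b w` is a continuous function of the coefficient of `w`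
  have hb : ∀ b : A, W.coef (W.ρ b w) ∈ closure (Set.range U.coef) := by
    intro b
    have e : W.coef (W.ρ b w) = (fun d : A → ℂ => fun a => d (star b * a * b)) (W.coef w) :=
      funext fun a => coef_ρ _ _ _ _
    rw [e]
    refine map_mem_closure (continuous_pi fun a => continuous_apply _) h ?_
    rintro _ ⟨v, rfl⟩
    exact ⟨U.ρ b v, funext fun a => coef_ρ _ _ _ _⟩
  have hspan : ∀ x ∈ Submodule.span ℂ (Set.range fun a => W.ρ a w), ∃ b, x = W.ρ b w := by
    intro x hx
    induction hx using Submodule.span_induction with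
    | mem x hx => obtain ⟨b, rfl⟩ := hx; exact ⟨b, rfl⟩
    | zero => exact ⟨0, by rw [map_zero]; rfl⟩
    | add x y _ _ hx hy =>
      obtain ⟨b, rfl⟩ := hx
      obtain ⟨c, rfl⟩ := hy
      exact ⟨b + c, by rw [map_add]; rfl⟩
    | smul r x _ hx =>
      obtain ⟨b, rfl⟩ := hx
      exact ⟨r • b, by rw [map_smul]; rfl⟩
  refine isWeaklyContained_of_coef_mem fun x => ?_
  refine closure_minimal (s := Submodule.span ℂ (Set.range fun a => W.ρ a w)) ?_ hcl
    (hW.dense_orbit hw x)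
  intro y hy
  obtain ⟨b, rfl⟩ := hspan y hy
  exact hb b

end AlgRep

namespace UnitaryRep

variable {G : Type u} [Group G] [TopologicalSpace G]

theorem π_mul (V : UnitaryRep G) (g h : G) (v : V.carrier) : V.π (g * h) v = V.π g (V.π h v) := by
  rw [map_mul]; rfl

theorem π_one (V : UnitaryRep G) (v : V.carrier) : V.π 1 v = v := by
  rw [map_one]; rfl

theorem π_inv_apply (V : UnitaryRep G) (g : G) (v : V.carrier) : V.π g⁻¹ (V.π g v) = v := by
  rw [← π_mul, inv_mul_cancel, π_one]

theorem π_apply_inv (V : UnitaryRep G) (g : G) (v : V.carrier) : V.π g (V.π g⁻¹ v) = v := by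
  rw [← π_mul, mul_inv_cancel, π_one]

theorem inner_π_left (V : UnitaryRep G) (g : G) (v w : V.carrier) :
    inner ℂ (V.π g v) w = inner ℂ v (V.π g⁻¹ w) := by
  rw [← (V.π g⁻¹).inner_map_map, π_inv_apply]

theorem continuous_π_apply (V : UnitaryRep G) (v : V.carrier) : Continuous fun g => V.π g v :=
  V.continuous_action.comp (continuous_id.prodMk continuous_const)

/-- The diagonal matrix coefficient `g ↦ ⟨v, g v⟩` of a vector `v`. -/
def coef (V : UnitaryRep G) (v : V.carrier) : G → ℂ := fun g => inner ℂ v (V.π g v)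

theorem norm_coef_sub_le (V : UnitaryRep G) (v w : V.carrier) (g : G) :
    ‖V.coef v g - V.coef w g‖ ≤ ‖v - w‖ * (‖v‖ + ‖w‖) := by
  have e : V.coef v g - V.coef w g =
      inner ℂ (v - w) (V.π g v) + inner ℂ w (V.π g (v - w)) := by
    simp only [coef, map_sub, inner_sub_left, inner_sub_right]
    ring
  rw [e]
  refine (norm_add_le _ _).trans ?_
  have h1 := norm_inner_le_norm (𝕜 := ℂ) (v - w) (V.π g v)
  have h2 := norm_inner_le_norm (𝕜 := ℂ) w (V.π g (v - w))
  rw [LinearIsometryEquiv.norm_map] at h1 h2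
  nlinarith

theorem norm_coef_le (V : UnitaryRep G) (v : V.carrier) (g : G) : ‖V.coef v g‖ ≤ ‖v‖ ^ 2 := by
  have h1 := norm_inner_le_norm (𝕜 := ℂ) v (V.π g v)
  rw [LinearIsometryEquiv.norm_map] at h1
  rw [sq]
  exact h1

theorem coef_apply_one (V : UnitaryRep G) (v : V.carrier) : V.coef v 1 = (‖v‖ : ℂ) ^ 2 := by
  rw [coef, π_one]
  exact inner_self_eq_norm_sq_to_K v

theorem coef_smul (V : UnitaryRep G) (c : ℂ) (v : V.carrier) (g : G) :
    V.coef (c • v) g = (starRingEnd ℂ c * c) * V.coef v g := by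
  simp only [coef, map_smul, inner_smul_left, inner_smul_right]
  ring

theorem coef_of_mem_fixed {V : UnitaryRep G} {K : Subgroup G} {v : V.carrier} (hv : v ∈ V.fixed K)
    {k : G} (hk : k ∈ K) : V.coef v k = (‖v‖ : ℂ) ^ 2 := by
  rw [coef, hv k hk]
  exact inner_self_eq_norm_sq_to_K v

/-- To prove weak containment it suffices to approximate the coefficients of the vectors of a dense
set by those of arbitrary vectors. -/
theorem isWeaklyContained_of_dense {V V' : UnitaryRep G} {D : Set V.carrier} (hD : Dense D)
    (h : ∀ v ∈ D, ∀ ε : ℝ, 0 < ε → ∀ C : Set G, IsCompact C →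
      ∃ v' : V'.carrier, ∀ g ∈ C, ‖V.coef v g - V'.coef v' g‖ < ε) : V.IsWeaklyContained V' := by
  intro v hv ε hε C hC
  set η : ℝ := min (ε / 4) (1 / 4) with hη
  have hη0 : 0 < η := by positivity
  have hη1 : η ≤ ε / 4 := min_le_left _ _
  have hη2 : η ≤ 1 / 4 := min_le_right _ _
  obtain ⟨u, hu, hud⟩ := Metric.dense_iff.1 hD v (η / 4) (by positivity)
  rw [Metric.mem_ball, dist_eq_norm] at hu
  -- the approximation at `1` makes `‖v'‖` almost `1`, so that `v'` may be normalized
  obtain ⟨v', hv'⟩ := h u hud (η / 4) (by positivity) (insert 1 C) (hC.insert 1)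
  have hun : ‖u‖ ≤ 2 := by
    have := norm_le_norm_add_norm_sub' u v
    linarith
  have hclose : ∀ g ∈ insert 1 C, ‖V.coef v g - V'.coef v' g‖ < η := by
    intro g hg
    have h1 := V.norm_coef_sub_le v u g
    have h2 := hv' g hg
    have h3 := norm_sub_le_norm_sub_add_norm_sub (V.coef v g) (V.coef u g) (V'.coef v' g)
    rw [norm_sub_rev v u, hv] at h1
    nlinarith [norm_nonneg (u - v)]
  have hn := hclose 1 (Set.mem_insert _ _)
  rw [coef_apply_one, coef_apply_one, hv, ← Complex.ofReal_pow, ← Complex.ofReal_pow,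
    ← Complex.ofReal_sub, Complex.norm_real, Real.norm_eq_abs, abs_lt] at hn
  set n : ℝ := ‖v'‖ ^ 2 with hnd
  have hnpos : 0 < n := by linarith [hn.2]
  have hv0 : ‖v'‖ ≠ 0 := fun h0 => by rw [hnd, h0] at hnpos; norm_num at hnpos
  refine ⟨((‖v'‖ : ℂ)⁻¹) • v', ?_, fun g hg => ?_⟩
  · rw [norm_smul, norm_inv, Complex.norm_real, norm_norm]
    exact inv_mul_cancel₀ hv0
  · have e : inner ℂ (((‖v'‖ : ℂ)⁻¹) • v') (V'.π g (((‖v'‖ : ℂ)⁻¹) • v')) =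
        (n : ℂ)⁻¹ * V'.coef v' g := by
      have := V'.coef_smul (‖v'‖ : ℂ)⁻¹ v' g
      rw [coef] at this
      rw [this, map_inv₀, Complex.conj_ofReal, hnd, Complex.ofReal_pow, sq, mul_inv]
    rw [e]
    have h1 := hclose g (Set.mem_insert_of_mem _ hg)
    have h2 := V'.norm_coef_le v' g
    have hnc : (n : ℂ) ≠ 0 := by exact_mod_cast hnpos.ne'
    have e2 : V.coef v g - (n : ℂ)⁻¹ * V'.coef v' g =
        (V.coef v g - V'.coef v' g) + (n : ℂ)⁻¹ * ((n - 1 : ℝ) : ℂ) * V'.coef v' g := by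
      push_cast
      field_simp
      ring
    have h4 : ‖(n : ℂ)⁻¹ * ((n - 1 : ℝ) : ℂ) * V'.coef v' g‖ ≤ η := by
      rw [norm_mul, norm_mul, norm_inv, Complex.norm_real, Complex.norm_real,
        Real.norm_of_nonneg hnpos.le, Real.norm_eq_abs]
      have h5 : |n - 1| ≤ η := abs_le.2 ⟨by linarith [hn.2], by linarith [hn.1]⟩
      calc n⁻¹ * |n - 1| * ‖V'.coef v' g‖ ≤ n⁻¹ * η * n := by gcongr
        _ = η := by field_simp
    change ‖V.coef v g - (n : ℂ)⁻¹ * V'.coef v' g‖ < ε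
    rw [e2]
    refine (norm_add_le _ _).trans_lt ?_
    linarith

theorem isWeaklyContained_of_isContained {V V' : UnitaryRep G} (h : V.IsContained V') :
    V.IsWeaklyContained V' := by
  obtain ⟨f, hf⟩ := h
  intro v hv ε hε C _
  refine ⟨f v, by rw [f.norm_map, hv], fun g _ => ?_⟩
  rw [← hf, f.inner_map_map, sub_self, norm_zero]
  exact hε

end UnitaryRep

/-! ### Families of vectors and their Gram matrices -/

theorem denseRange_linearCombination {ι E : Type*} [NormedAddCommGroup E] [InnerProductSpace ℂ E]
    {f : ι → E} (hf : Dense (Submodule.span ℂ (Set.range f) : Set E)) :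
    DenseRange (Finsupp.linearCombination ℂ f) := by
  rw [DenseRange, ← LinearMap.coe_range, Finsupp.range_linearCombination]
  exact hf

theorem inner_linearCombination {ι E : Type*} [NormedAddCommGroup E] [InnerProductSpace ℂ E]
    (f : ι → E) (φ ψ : ι →₀ ℂ) :
    inner ℂ (Finsupp.linearCombination ℂ f φ) (Finsupp.linearCombination ℂ f ψ) =
      φ.sum fun y c => ψ.sum fun z d => starRingEnd ℂ c * d * inner ℂ (f y) (f z) := by
  simp only [Finsupp.linearCombination_apply, Finsupp.sum, sum_inner, inner_sum, inner_smul_left,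
    inner_smul_right, Finset.mul_sum]
  rw [Finset.sum_comm]
  refine Finset.sum_congr rfl fun y _ => Finset.sum_congr rfl fun z _ => ?_
  ring

/-- A total family is carried isometrically to any family with the same Gram matrix. -/
theorem exists_linearIsometry_of_gram {ι E E' : Type*} [NormedAddCommGroup E]
    [InnerProductSpace ℂ E] [NormedAddCommGroup E'] [InnerProductSpace ℂ E'] [CompleteSpace E']
    {f : ι → E} {f' : ι → E'} (hf : Dense (Submodule.span ℂ (Set.range f) : Set E))
    (h : ∀ i j, inner ℂ (f i) (f j) = inner ℂ (f' i) (f' j)) :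
    ∃ θ : E →ₗᵢ[ℂ] E', ∀ i, θ (f i) = f' i := by
  set e := Finsupp.linearCombination ℂ f
  set e' := Finsupp.linearCombination ℂ f'
  have hd : DenseRange e := denseRange_linearCombination hf
  have hn : ∀ c, ‖e' c‖ = ‖e c‖ := by
    intro c
    have : inner ℂ (e' c) (e' c) = inner ℂ (e c) (e c) := by
      rw [inner_linearCombination, inner_linearCombination]
      simp only [h]
    rw [@norm_eq_sqrt_re_inner ℂ, @norm_eq_sqrt_re_inner ℂ, this]
  have hC : ∃ C, ∀ x, ‖e' x‖ ≤ C * ‖e x‖ := ⟨1, fun x => by rw [hn, one_mul]⟩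
  set θ := e'.extendOfNorm e
  have hθ : ∀ c, θ (e c) = e' c := LinearMap.extendOfNorm_eq hd hC
  refine ⟨⟨θ.toLinearMap, fun x => ?_⟩, fun i => ?_⟩
  · refine hd.induction_on (p := fun x => ‖θ x‖ = ‖x‖) x ?_ ?_
    · exact isClosed_eq (by fun_prop) (by fun_prop)
    · intro c
      rw [hθ, hn]
  · have := hθ (Finsupp.single i 1)
    simpa [e, e'] using this

/-- A vector orthogonal to a total family vanishes. -/
theorem eq_zero_of_inner_total {ι E : Type*} [NormedAddCommGroup E] [InnerProductSpace ℂ E]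
    {f : ι → E} (hf : Dense (Submodule.span ℂ (Set.range f) : Set E)) {v : E}
    (h : ∀ i, inner ℂ v (f i) = 0) : v = 0 := by
  refine hf.eq_zero_of_inner_left ℂ fun w hw => ?_
  induction hw using Submodule.span_induction with
  | mem x hx => obtain ⟨i, rfl⟩ := hx; exact h i
  | zero => simp
  | add x y _ _ hx hy => rw [inner_add_right, hx, hy, add_zero]
  | smul c x _ hx => rw [inner_smul_right, hx, mul_zero]

/-- A positive semidefinite kernel is the Gram matrix of a total family of vectors of some Hilbert
space. -/
theorem exists_hilbert_of_kernel {Ω : Type u} (κ : Ω → Ω → ℂ)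
    (hsymm : ∀ y z, starRingEnd ℂ (κ z y) = κ y z)
    (hpos : ∀ φ : Ω →₀ ℂ,
      0 ≤ (φ.sum fun y c => φ.sum fun z d => starRingEnd ℂ c * d * κ y z).re) :
    ∃ (E : Type u) (_ : NormedAddCommGroup E) (_ : InnerProductSpace ℂ E) (_ : CompleteSpace E)
      (f : Ω → E), (∀ y z, inner ℂ (f y) (f z) = κ y z) ∧
        Dense (Submodule.span ℂ (Set.range f) : Set E) := by
  -- finitely supported functions with the form defined by `κ`; completing also identifies with `0`
  -- the vectors of norm `0`
  let core : PreInnerProductSpace.Core ℂ (Ω →₀ ℂ) :=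
    { inner := fun φ ψ => φ.sum fun y c => ψ.sum fun z d => starRingEnd ℂ c * d * κ y z
      conj_inner_symm := fun φ ψ => by
        change starRingEnd ℂ (ψ.sum fun y c => φ.sum fun z d => starRingEnd ℂ c * d * κ y z) =
          φ.sum fun y c => ψ.sum fun z d => starRingEnd ℂ c * d * κ y z
        simp only [Finsupp.sum, map_sum, map_mul, Complex.conj_conj, hsymm]
        rw [Finset.sum_comm]
        refine Finset.sum_congr rfl fun y _ => Finset.sum_congr rfl fun z _ => ?_
        ring
      re_inner_nonneg := hpos
      add_left := fun φ φ' ψ => by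
        change (φ + φ').sum (fun y c => ψ.sum fun z d => starRingEnd ℂ c * d * κ y z) = _
        rw [Finsupp.sum_add_index'] <;> intros <;> simp [add_mul, Finsupp.sum_add]
      smul_left := fun φ ψ r => by
        change (r • φ).sum (fun y c => ψ.sum fun z d => starRingEnd ℂ c * d * κ y z) =
          starRingEnd ℂ r * φ.sum fun y c => ψ.sum fun z d => starRingEnd ℂ c * d * κ y z
        rw [Finsupp.sum_smul_index (by intros; simp), Finsupp.mul_sum]
        refine Finsupp.sum_congr fun y _ => ?_
        rw [Finsupp.mul_sum]
        refine Finsupp.sum_congr fun z _ => ?_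
        simp only [map_mul]
        ring }
  -- a copy of `Ω →₀ ℂ` without instances, to carry the seminorm
  let H0 : Type u := Ω →₀ ℂ
  let _ : AddCommGroup H0 := inferInstanceAs (AddCommGroup (Ω →₀ ℂ))
  let _ : Module ℂ H0 := inferInstanceAs (Module ℂ (Ω →₀ ℂ))
  let core' : PreInnerProductSpace.Core ℂ H0 := core
  let _ : SeminormedAddCommGroup H0 := InnerProductSpace.Core.toSeminormedAddCommGroup (𝕜 := ℂ)
  let _ : InnerProductSpace ℂ H0 := InnerProductSpace.ofCore core'
  let f0 : Ω → H0 := fun y => Finsupp.single y (1 : ℂ)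
  have hin : ∀ y z, inner ℂ (f0 y) (f0 z) = κ y z := by
    intro y z
    change Finsupp.sum (Finsupp.single y (1 : ℂ)) (fun y c => Finsupp.sum (Finsupp.single z (1 : ℂ))
      fun z d => starRingEnd ℂ c * d * κ y z) = _
    rw [Finsupp.sum_single_index (by simp), Finsupp.sum_single_index (by simp)]
    simp
  refine ⟨UniformSpace.Completion H0, inferInstance, inferInstance, inferInstance,
    fun y => (f0 y : UniformSpace.Completion H0), fun y z => ?_, ?_⟩
  · rw [UniformSpace.Completion.inner_coe, hin]
  · refine Dense.mono ?_ UniformSpace.Completion.denseRange_coe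
    rintro _ ⟨φ, rfl⟩
    have hφ : φ ∈ Submodule.span ℂ (Set.range f0) := by
      have : Submodule.span ℂ (Set.range f0) = ⊤ := by
        have := (Finsupp.basisSingleOne (R := ℂ) (ι := Ω)).span_eq
        simpa using this
      rw [this]
      trivial
    have h2 := Submodule.mem_map_of_mem
      (f := (UniformSpace.Completion.toComplL (𝕜 := ℂ) (E := H0)).toLinearMap) hφ
    rw [Submodule.map_span, ← Set.range_comp] at h2
    exact h2

namespace UnitaryRep

variable {G : Type u} [Group G] [TopologicalSpace G] [IsTopologicalGroup G]

/-! ### Vectors fixed by compact open subgroups -/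

/-- The average of `k ↦ k v` over `K` is a fixed vector, as close to `v` as all the `k v` are. -/
theorem exists_mem_fixed_norm_sub_le [T2Space G] [MeasurableSpace G] [BorelSpace G]
    (μ : Measure G) [μ.IsHaarMeasure] (V : UnitaryRep G) {K : Subgroup G}
    (hK : IsOpen (K : Set G)) (hKc : IsCompact (K : Set G)) (v : V.carrier) {ε : ℝ}
    (h : ∀ k ∈ K, ‖V.π k v - v‖ ≤ ε) : ∃ p ∈ V.fixed K, ‖p - v‖ ≤ ε := by
  have hKm : MeasurableSet (K : Set G) := hK.measurableSet
  have hint : IntegrableOn (fun k => V.π k v) (K : Set G) μ :=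
    (V.continuous_π_apply v).continuousOn.integrableOn_compact hKc
  refine ⟨⨍ k in (K : Set G), V.π k v ∂μ, fun k0 hk0 => ?_, ?_⟩
  · rw [setAverage_eq, RCLike.real_smul_eq_coe_smul (K := ℂ), map_smul]
    congr 1
    have e1 : V.π k0 (∫ k in (K : Set G), V.π k v ∂μ) =
        ∫ k in (K : Set G), V.π k0 (V.π k v) ∂μ :=
      ((V.π k0).toContinuousLinearEquiv.toContinuousLinearMap.integral_comp_comm hint).symm
    rw [e1, ← integral_indicator hKm, ← integral_indicator hKm,
      ← integral_mul_left_eq_self ((K : Set G).indicator fun k => V.π k v) k0]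
    congr 1
    funext k
    have : k0 * k ∈ K ↔ k ∈ K := K.mul_mem_cancel_left hk0
    by_cases hk : k ∈ K
    · rw [Set.indicator_of_mem (show k ∈ (K : Set G) from hk),
        Set.indicator_of_mem (show k0 * k ∈ (K : Set G) from this.2 hk), π_mul]
    · rw [Set.indicator_of_notMem (show k ∉ (K : Set G) from hk),
        Set.indicator_of_notMem (show k0 * k ∉ (K : Set G) from fun h => hk (this.1 h))]
  · have := Convex.set_average_mem (μ := μ) (t := (K : Set G)) (s := Metric.closedBall v ε)
      (f := fun k => V.π k v) (convex_closedBall v ε) Metric.isClosed_closedBall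
      (hK.measure_pos μ ⟨1, K.one_mem⟩).ne' hKc.measure_lt_top.ne
      ((ae_restrict_iff' hKm).2 (Filter.Eventually.of_forall fun k hk => by
        rw [Metric.mem_closedBall, dist_eq_norm]; exact h k hk)) hint
    rwa [Metric.mem_closedBall, dist_eq_norm] at this

/-- If `V ≺ H`, the coefficients of `K`-fixed vectors of `V` are pointwise limits of coefficients
of bounded `K`-fixed vectors of `H`. -/
theorem IsWeaklyContained.coef_mem_closure_fixed [T2Space G] [MeasurableSpace G] [BorelSpace G]
    (μ : Measure G) [μ.IsHaarMeasure] {V H : UnitaryRep G} (hVH : V.IsWeaklyContained H)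
    {K : Subgroup G} (hK : IsOpen (K : Set G)) (hKc : IsCompact (K : Set G)) {v : V.carrier}
    (hv : v ∈ V.fixed K) :
    V.coef v ∈ closure (H.coef '' {p | p ∈ H.fixed K ∧ ‖p‖ ≤ ‖v‖ + 1}) := by
  -- the case of unit vectors, from which the general case follows by scaling
  have key : ∀ w ∈ V.fixed K, ‖w‖ = 1 → ∀ δ : ℝ, 0 < δ → ∀ T : Finset G,
      ∃ p ∈ H.fixed K, ‖p‖ ≤ 1 + δ ∧ ∀ g ∈ T, ‖V.coef w g - H.coef p g‖ < δ := by
    intro w hw hw1 ε hε T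
    set δ : ℝ := min (ε / 8) 1 with hδ
    have hδ0 : 0 < δ := by positivity
    have hδ1 : δ ≤ ε / 8 := min_le_left _ _
    have hδ2 : δ ≤ 1 := min_le_right _ _
    obtain ⟨v', hv'1, hv'⟩ := hVH w hw1 (min (ε / 8) (δ ^ 2 / 2)) (by positivity)
      ((K : Set G) ∪ T) (hKc.union T.finite_toSet.isCompact)
    -- on `K` the coefficient of `w` is `1`, hence that of `v'` is almost `1` and `v'` is almost
    -- fixed; averaging `v'` over `K` then changes it little
    have hmove : ∀ k ∈ K, ‖H.π k v' - v'‖ ≤ δ := by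
      intro k hk
      have h1 := (hv' k (Or.inl hk)).trans_le (min_le_right _ _)
      have h2 : inner ℂ w (V.π k w) = (1 : ℂ) := by
        have := coef_of_mem_fixed hw hk
        rw [coef] at this
        rw [this, hw1]; norm_num
      rw [h2] at h1
      have h3 : 1 - (inner ℂ v' (H.π k v')).re ≤ δ ^ 2 / 2 := by
        have := Complex.re_le_norm ((1 : ℂ) - inner ℂ v' (H.π k v'))
        simp only [Complex.sub_re, Complex.one_re] at this
        linarith
      have h4 := @norm_sub_sq ℂ _ _ _ _ v' (H.π k v')
      rw [LinearIsometryEquiv.norm_map, hv'1] at h4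
      rw [norm_sub_rev]
      have h5 : ‖v' - H.π k v'‖ ^ 2 ≤ δ ^ 2 := by
        rw [h4]
        change 1 ^ 2 - 2 * (inner ℂ v' (H.π k v')).re + 1 ^ 2 ≤ δ ^ 2
        linarith
      exact le_of_sq_le_sq h5 hδ0.le
    obtain ⟨p, hp, hpv⟩ := exists_mem_fixed_norm_sub_le μ H hK hKc v' hmove
    have hpn : ‖p‖ ≤ 1 + δ := by
      have := norm_le_norm_add_norm_sub' p v'
      linarith
    refine ⟨p, hp, by linarith, fun g hg => ?_⟩
    have h1 := (hv' g (Or.inr hg)).trans_le (min_le_left _ _)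
    have h2 := H.norm_coef_sub_le p v' g
    have h3 := norm_sub_le_norm_sub_add_norm_sub (V.coef w g) (H.coef v' g) (H.coef p g)
    have h4 : ‖V.coef w g - H.coef v' g‖ < ε / 8 := h1
    rw [norm_sub_rev (H.coef v' g)] at h3
    nlinarith [norm_nonneg (p - v')]
  rcases eq_or_ne v 0 with rfl | hv0
  · refine subset_closure ⟨0, ⟨Submodule.zero_mem _, by simp⟩, ?_⟩
    funext g
    simp [coef]
  · have hn : 0 < ‖v‖ := norm_pos_iff.2 hv0
    have hnc : (‖v‖ : ℂ) ≠ 0 := by exact_mod_cast hn.ne'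
    rw [mem_closure_fun_iff]
    intro ε hε T
    obtain ⟨w, hw⟩ : ∃ w, w = (‖v‖ : ℂ)⁻¹ • v := ⟨_, rfl⟩
    have hvw : v = (‖v‖ : ℂ) • w := by rw [hw, smul_inv_smul₀ hnc]
    obtain ⟨p, hp, hpn, hpT⟩ := key w (hw ▸ Submodule.smul_mem _ _ hv)
      (by simp [hw, norm_smul, hv0])
      (min (ε / ‖v‖ ^ 2) (1 / ‖v‖)) (by positivity) T
    refine ⟨_, ⟨(‖v‖ : ℂ) • p, ⟨Submodule.smul_mem _ _ hp, ?_⟩, rfl⟩, fun g hg => ?_⟩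
    · rw [norm_smul, Complex.norm_real, norm_norm]
      calc ‖v‖ * ‖p‖ ≤ ‖v‖ * (1 + 1 / ‖v‖) := by
            gcongr
            exact hpn.trans (by gcongr; exact min_le_right _ _)
        _ = ‖v‖ + 1 := by field_simp
    · have h1 := (hpT g hg).trans_le (min_le_left _ _)
      have h2 : V.coef v g = (‖v‖ : ℂ) ^ 2 * V.coef w g := by
        have := V.coef_smul (‖v‖ : ℂ) w g
        rw [← hvw] at this
        rw [this]
        rw [Complex.conj_ofReal, sq]
      rw [h2, coef_smul, Complex.conj_ofReal, ← sq, ← mul_sub, norm_mul, norm_pow,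
        Complex.norm_real, norm_norm]
      rwa [lt_div_iff₀' (by positivity)] at h1

/-- A compact open subgroup of a totally disconnected group contains arbitrarily small open
subgroups. -/
theorem exists_isOpen_subgroup_le [T2Space G] [TotallyDisconnectedSpace G] {K₀ : Subgroup G}
    (hK₀ : IsOpen (K₀ : Set G)) (hK₀c : IsCompact (K₀ : Set G)) {O : Set G} (hO : O ∈ 𝓝 (1 : G)) :
    ∃ K ≤ K₀, IsOpen (K : Set G) ∧ IsCompact (K : Set G) ∧ (K : Set G) ⊆ O := by
  have : CompactSpace K₀ := isCompact_iff_compactSpace.1 hK₀c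
  obtain ⟨U, hUO, hU, hU1⟩ := mem_nhds_iff.1 hO
  obtain ⟨N, hN⟩ := ProfiniteGrp.exist_openNormalSubgroup_sub_open_nhds_of_one
    (G := K₀) (hU.preimage continuous_subtype_val) (show (1 : G) ∈ U from hU1)
  have hNo : IsOpen ((N.toSubgroup.map K₀.subtype : Subgroup G) : Set G) := by
    rw [Subgroup.coe_map]
    exact hK₀.isOpenMap_subtype_val _ N.isOpen'
  refine ⟨N.toSubgroup.map K₀.subtype, Subgroup.map_subtype_le _, hNo, ?_, ?_⟩
  · exact hK₀c.of_isClosed_subset (Subgroup.isClosed_of_isOpen _ hNo) (Subgroup.map_subtype_le _)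
  · rintro _ ⟨x, hx, rfl⟩
    exact hUO (hN hx)

/-- Smooth vectors are dense: near every vector there is one fixed by an open subgroup. -/
theorem exists_smooth_near [T2Space G] [TotallyDisconnectedSpace G] [MeasurableSpace G]
    [BorelSpace G] (μ : Measure G) [μ.IsHaarMeasure] (V : UnitaryRep G) {K₀ : Subgroup G}
    (hK₀ : IsOpen (K₀ : Set G)) (hK₀c : IsCompact (K₀ : Set G)) (v : V.carrier) {ε : ℝ}
    (hε : 0 < ε) : ∃ K ≤ K₀, IsOpen (K : Set G) ∧ IsCompact (K : Set G) ∧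
      ∃ p ∈ V.fixed K, ‖p - v‖ ≤ ε := by
  have hO : {g : G | ‖V.π g v - v‖ < ε} ∈ 𝓝 (1 : G) := by
    refine IsOpen.mem_nhds ?_ ?_
    · exact isOpen_lt ((V.continuous_π_apply v).sub continuous_const).norm continuous_const
    · simpa using hε
  obtain ⟨K, hle, hKo, hKc, hK⟩ := exists_isOpen_subgroup_le hK₀ hK₀c hO
  exact ⟨K, hle, hKo, hKc,
    exists_mem_fixed_norm_sub_le μ V hKo hKc v fun k hk => (hK hk).le⟩

/-- Every nonzero representation has a nonzero vector fixed by a small open subgroup. -/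
theorem exists_fixed_ne_bot [T2Space G] [TotallyDisconnectedSpace G] [MeasurableSpace G]
    [BorelSpace G] (μ : Measure G) [μ.IsHaarMeasure] (V : UnitaryRep G) [Nontrivial V.carrier]
    {K₀ : Subgroup G} (hK₀ : IsOpen (K₀ : Set G)) (hK₀c : IsCompact (K₀ : Set G)) :
    ∃ K ≤ K₀, IsOpen (K : Set G) ∧ IsCompact (K : Set G) ∧ V.fixed K ≠ ⊥ := by
  obtain ⟨v, hv⟩ := exists_ne (0 : V.carrier)
  have hn : 0 < ‖v‖ := norm_pos_iff.2 hv
  obtain ⟨K, hle, hKo, hKc, p, hp, hpv⟩ := exists_smooth_near μ V hK₀ hK₀c v (half_pos hn)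
  refine ⟨K, hle, hKo, hKc, fun h => ?_⟩
  rw [h, Submodule.mem_bot] at hp
  rw [hp, zero_sub, norm_neg] at hpv
  linarith

end UnitaryRep

/-! ### Invariant kernels on a set with compact open stabilizers -/

/-- All point stabilizers of the action of `G` on `Ω` are compact and open. -/
class CompactOpenStabilizers (G : Type u) (Ω : Type u) [Group G] [TopologicalSpace G]
    [MulAction G Ω] : Prop where
  isOpen : ∀ x : Ω, IsOpen (MulAction.stabilizer G x : Set G)
  isCompact : ∀ x : Ω, IsCompact (MulAction.stabilizer G x : Set G)

section Shift

variable {G : Type u} [Group G] {Ω : Type u} [MulAction G Ω]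

/-- Translation of finitely supported functions by a group element. -/
def shift (g : G) :
    (Ω →₀ ℂ) →ₗ[ℂ] (Ω →₀ ℂ) :=
  Finsupp.lmapDomain ℂ ℂ (g • ·)

theorem shift_single (g : G) (x : Ω) (c : ℂ) :
    shift g (Finsupp.single x c) = Finsupp.single (g • x) c := Finsupp.mapDomain_single

theorem shift_apply (g : G) (φ : Ω →₀ ℂ) (x : Ω) : shift g φ (g • x) = φ x :=
  Finsupp.mapDomain_apply (MulAction.injective g) φ x

theorem shift_apply' (g : G) (φ : Ω →₀ ℂ) (x : Ω) : shift g φ x = φ (g⁻¹ • x) := by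
  rw [← shift_apply g φ, smul_inv_smul]

end Shift

section Transport

variable {G : Type u} [Group G] [TopologicalSpace G] [IsTopologicalGroup G]
  {Ω : Type u} [MulAction G Ω] [CompactOpenStabilizers G Ω]

theorem setOf_smul_eq_smul (y : Ω) (h : G) :
    {g : G | g • y = h • y} = (fun g => h⁻¹ * g) ⁻¹' (MulAction.stabilizer G y : Set G) := by
  ext g
  simp [mul_smul, inv_smul_eq_iff]

variable (G) in
theorem isOpen_setOf_smul_eq (y u : Ω) : IsOpen {g : G | g • y = u} := by
  by_cases h : ∃ k : G, k • y = u
  · obtain ⟨k, rfl⟩ := h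
    rw [setOf_smul_eq_smul]
    exact (CompactOpenStabilizers.isOpen y).preimage (continuous_const_mul k⁻¹)
  · convert isOpen_empty
    ext g
    exact iff_of_false (fun hg => h ⟨g, hg⟩) id

variable (G) in
theorem isCompact_setOf_smul_eq (y u : Ω) : IsCompact {g : G | g • y = u} := by
  by_cases h : ∃ k : G, k • y = u
  · obtain ⟨k, rfl⟩ := h
    rw [setOf_smul_eq_smul]
    exact (Homeomorph.mulLeft k⁻¹).isCompact_preimage.2 (CompactOpenStabilizers.isCompact y)
  · convert isCompact_empty
    ext g
    exact iff_of_false (fun hg => h ⟨g, hg⟩) id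

/-- A compact subset of `G` moves a point of `Ω` to finitely many points. -/
theorem finite_image_smul {C : Set G} (hC : IsCompact C) (z : Ω) :
    ((fun g : G => g • z) '' C).Finite := by
  let _ : TopologicalSpace Ω := ⊥
  have : DiscreteTopology Ω := ⟨rfl⟩
  have hc : Continuous fun g : G => g • z :=
    continuous_discrete_rng.2 fun v => isOpen_setOf_smul_eq G z v
  exact isCompact_iff_finite.1 (hC.image hc)

variable (G) in
theorem finite_transport (y z u : Ω) : {v : Ω | ∃ g : G, g • y = u ∧ g • z = v}.Finite :=
  (finite_image_smul (isCompact_setOf_smul_eq G y u) z).subset fun _ ⟨g, hg, hv⟩ => ⟨g, hg, hv⟩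

variable [MeasurableSpace G] [BorelSpace G] (μ : Measure G) [μ.IsHaarMeasure]

/-- Splitting a set of finite measure along the values of `g ↦ p g`. -/
theorem sum_measureReal_fiber {B : Set G} (hB : MeasurableSet B) (hfin : μ B ≠ ⊤) {p : G → Ω}
    (hp : ∀ v, MeasurableSet {g | p g = v}) (s : Finset Ω) (hs : ∀ g ∈ B, p g ∈ s) :
    ∑ v ∈ s, μ.real {g | g ∈ B ∧ p g = v} = μ.real B := by
  have e : B = ⋃ v ∈ s, {g | g ∈ B ∧ p g = v} := by
    ext g
    simp only [Set.mem_iUnion, Set.mem_ofPred_eq, exists_prop]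
    exact ⟨fun h => ⟨p g, hs g h, h, rfl⟩, fun ⟨_, _, h, _⟩ => h⟩
  conv_rhs => rw [e]
  rw [measureReal_biUnion_finset (f := fun v => {g | g ∈ B ∧ p g = v}) 
    (fun v _ w _ hvw => ?_) (fun v _ => hB.inter (hp v))
    (fun v _ => ne_top_of_le_ne_top hfin (measure_mono fun g hg => hg.1))]
  rw [Function.onFun, Set.disjoint_left]
  rintro g ⟨_, h1⟩ ⟨_, h2⟩
  exact hvw (h1.symm.trans h2)

/-- The row at `u` of the kernel `(u, v) ↦ μ {g | g y = u, g z = v}`. -/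
def transportRow (y z u : Ω) : Ω →₀ ℂ :=
  Finsupp.onFinset (finite_transport G y z u).toFinset
    (fun v => (μ.real {g : G | g • y = u ∧ g • z = v} : ℂ)) fun v hv => by
      rw [Set.Finite.mem_toFinset]
      by_contra h
      apply hv
      have : {g : G | g • y = u ∧ g • z = v} = ∅ := by
        ext g
        exact iff_of_false (fun hg => h ⟨g, hg⟩) id
      simp [this]

/-- The operator on finitely supported functions given by the `G`-invariant kernel
`(u, v) ↦ μ {g | g y = u, g z = v}`. -/
def transport (y z : Ω) : (Ω →₀ ℂ) →ₗ[ℂ] (Ω →₀ ℂ) :=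
  Finsupp.linearCombination ℂ (transportRow μ y z)

theorem transport_single (y z u : Ω) :
    transport μ y z (Finsupp.single u 1) = transportRow μ y z u := by
  simp [transport]

theorem transportRow_apply (y z u v : Ω) :
    transportRow μ y z u v = (μ.real {g : G | g • y = u ∧ g • z = v} : ℂ) := rfl

theorem transport_symm (y z u v : Ω) :
    transport μ y z (Finsupp.single u 1) v = transport μ z y (Finsupp.single v 1) u := by
  simp only [transport_single, transportRow_apply, and_comm]

theorem transport_shift (y z : Ω) (g : G) (φ : Ω →₀ ℂ) :
    transport μ y z (shift g φ) = shift g (transport μ y z φ) := by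
  suffices transport μ y z ∘ₗ shift g = shift g ∘ₗ transport μ y z from LinearMap.congr_fun this φ
  ext u v
  simp only [LinearMap.comp_apply, Finsupp.lsingle_apply, shift_single, shift_apply']
  rw [transport_single, transport_single, transportRow_apply, transportRow_apply]
  congr 1
  rw [Measure.real, Measure.real, ← measure_preimage_mul μ g]
  congr 2
  ext h
  simp [mul_smul, eq_inv_smul_iff]

/-- If `F (g z)` is the same vector `c` for all `g` with `g y = u`, the kernel sums `F` to a
multiple of `c`. -/
theorem linearCombination_transportRow {E : Type*} [AddCommGroup E] [Module ℂ E] (y z u : Ω)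
    (F : Ω → E) (c : E) (h : ∀ g : G, g • y = u → F (g • z) = c) :
    Finsupp.linearCombination ℂ F (transportRow μ y z u) =
      (μ.real {g : G | g • y = u} : ℂ) • c := by
  rw [Finsupp.linearCombination_apply, Finsupp.sum_of_support_subset (transportRow μ y z u)
    (s := (finite_transport G y z u).toFinset) Finsupp.support_onFinset_subset _
    (by simp), ← sum_measureReal_fiber μ (isOpen_setOf_smul_eq G y u).measurableSet
    (isCompact_setOf_smul_eq G y u).measure_lt_top.ne (p := fun g => g • z)
    (fun v => (isOpen_setOf_smul_eq G z v).measurableSet) (finite_transport G y z u).toFinset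
    (fun g hg => by
      rw [Set.Finite.mem_toFinset]
      exact ⟨g, hg, rfl⟩), Complex.ofReal_sum, Finset.sum_smul]
  refine Finset.sum_congr rfl fun v hv => ?_
  rw [Set.Finite.mem_toFinset] at hv
  obtain ⟨g, hg, rfl⟩ := hv
  rw [h g hg]
  rfl

theorem measureReal_smul_eq_smul (y : Ω) (h : G) :
    μ.real {g : G | g • y = h • y} = μ.real (MulAction.stabilizer G y : Set G) := by
  rw [setOf_smul_eq_smul, Measure.real, measure_preimage_mul, Measure.real]

theorem measureReal_smul_smul_eq [μ.IsMulRightInvariant] (y : Ω) (h : G) :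
    μ.real {g : G | g • h • y = y} = μ.real (MulAction.stabilizer G y : Set G) := by
  have : {g : G | g • h • y = y} = (fun g => g * h) ⁻¹' (MulAction.stabilizer G y : Set G) := by
    ext g
    simp [mul_smul]
  rw [this, Measure.real, measure_preimage_mul_right, Measure.real]

theorem measureReal_stabilizer_pos (y : Ω) :
    0 < μ.real (MulAction.stabilizer G y : Set G) :=
  ENNReal.toReal_pos
    ((CompactOpenStabilizers.isOpen y).measure_pos μ ⟨1, (MulAction.stabilizer G y).one_mem⟩).ne'
    (CompactOpenStabilizers.isCompact y).measure_lt_top.ne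

end Transport

/-- Representatives of the `G`-orbits of `Ω`, one for each orbit. -/
structure OrbitReps (G : Type u) (Ω : Type u) [Group G] [MulAction G Ω] (t : ℕ) where
  rep : Fin t → Ω
  existsUnique : ∀ y, ∃! n, y ∈ MulAction.orbit G (rep n)

namespace OrbitReps

variable {G : Type u} [Group G] {Ω : Type u} [MulAction G Ω] {t : ℕ} (R : OrbitReps G Ω t)

/-- The index of the orbit of a point. -/
def idx (x : Ω) : Fin t := (R.existsUnique x).choose

/-- A group element carrying the representative of the orbit of `x` to `x`. -/
def elt (x : Ω) : G := (MulAction.mem_orbit_iff.1 (R.existsUnique x).choose_spec.1).choose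

theorem elt_smul (x : Ω) : R.elt x • R.rep (R.idx x) = x :=
  (MulAction.mem_orbit_iff.1 (R.existsUnique x).choose_spec.1).choose_spec

theorem idx_eq {x : Ω} {n : Fin t} {g : G} (h : g • R.rep n = x) : R.idx x = n :=
  ((R.existsUnique x).choose_spec.2 n ⟨g, h⟩).symm

theorem idx_rep (n : Fin t) : R.idx (R.rep n) = n := R.idx_eq (one_smul G _)

theorem idx_smul (g : G) (x : Ω) : R.idx (g • x) = R.idx x :=
  R.idx_eq (g := g * R.elt x) (by rw [mul_smul, elt_smul])

variable [TopologicalSpace G] [IsTopologicalGroup G] [CompactOpenStabilizers G Ω]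
  [MeasurableSpace G] [BorelSpace G] (μ : Measure G) [μ.IsHaarMeasure]

/-- The measure of the stabilizer of the `n`-th representative. -/
def mass (n : Fin t) : ℝ := μ.real (MulAction.stabilizer G (R.rep n) : Set G)

theorem mass_pos (n : Fin t) : 0 < R.mass μ n := measureReal_stabilizer_pos μ _

theorem mass_ne_zero (n : Fin t) : (R.mass μ n : ℂ) ≠ 0 := by
  exact_mod_cast (R.mass_pos μ n).ne'

/-- The pairing `∑ₙ μ(stab rₙ)⁻¹ ⟨f rₙ, f' rₙ⟩` of two families of vectors indexed by `Ω`, with `rₙ`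
running over the representatives of the orbits. -/
def pairing {E : Type*} [NormedAddCommGroup E] [InnerProductSpace ℂ E] (f f' : Ω → E) : ℂ :=
  ∑ n, (R.mass μ n : ℂ)⁻¹ * inner ℂ (f (R.rep n)) (f' (R.rep n))

theorem pairing_conj_symm {E : Type*} [NormedAddCommGroup E] [InnerProductSpace ℂ E]
    (f f' : Ω → E) : starRingEnd ℂ (R.pairing μ f f') = R.pairing μ f' f := by
  simp [pairing, map_sum, inner_conj_symm]

/-- The operators `transport μ y z` represent the sesquilinear forms `⟨f y, f' z⟩`. -/
theorem pairing_transport [μ.IsMulRightInvariant] {H : UnitaryRep G} {f f' : Ω → H.carrier}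
    (hf : ∀ (g : G) x, f (g • x) = H.π g (f x)) (hf' : ∀ (g : G) x, f' (g • x) = H.π g (f' x))
    (y z : Ω) :
    R.pairing μ f (fun x => Finsupp.linearCombination ℂ f' (transport μ y z (Finsupp.single x 1))) =
      inner ℂ (f y) (f' z) := by
  have hy := R.elt_smul y
  -- only the orbit of `y` contributes, as the row of the kernel at `rₙ` involves `g` with `g y =
  -- rₙ`
  rw [pairing, Finset.sum_eq_single (R.idx y)]
  · set n := R.idx y
    set h := R.elt y
    have key : inner ℂ (f (R.rep n)) (Finsupp.linearCombination ℂ f'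
        (transport μ y z (Finsupp.single (R.rep n) 1))) =
          (R.mass μ n : ℂ) * inner ℂ (f y) (f' z) := by
      have hm : μ.real {g : G | g • y = R.rep n} = R.mass μ n := by
        rw [← hy, measureReal_smul_smul_eq]; rfl
      rw [transport_single, ← hm, ← smul_eq_mul, ← linearCombination_transportRow μ y z (R.rep n)
        (fun v => inner ℂ (f (R.rep n)) (f' v))]
      · simp only [Finsupp.linearCombination_apply, Finsupp.sum, inner_sum, inner_smul_right,
          smul_eq_mul]
      · intro g hg
        rw [← hg, hf, hf', LinearIsometryEquiv.inner_map_map]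
    rw [key, inv_mul_cancel_left₀ (R.mass_ne_zero μ n)]
  · intro n _ hn
    have : transport μ y z (Finsupp.single (R.rep n) 1) = 0 := by
      rw [transport_single]
      ext v
      rw [transportRow_apply]
      have : {g : G | g • y = R.rep n ∧ g • z = v} = ∅ := by
        ext g
        refine iff_of_false (fun hg => hn ?_) id
        rw [← R.idx_rep n, ← hg.1, idx_smul]
      simp [this]
    rw [this]
    simp
  · simp

/-- An equivariant operator is a linear combination of the operators `transport μ rₙ v`. -/
theorem eq_sum_transport {L : (Ω →₀ ℂ) →ₗ[ℂ] (Ω →₀ ℂ)}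
    (hL : ∀ (g : G) φ, L (shift g φ) = shift g (L φ)) :
    L = ∑ n, (L (Finsupp.single (R.rep n) 1)).sum fun v c =>
      ((R.mass μ n : ℂ)⁻¹ * c) • transport μ (R.rep n) v := by
  ext u w
  simp only [LinearMap.comp_apply, Finsupp.lsingle_apply, LinearMap.sum_apply, Finsupp.sum,
    LinearMap.smul_apply, Finsupp.finsetSum_apply, Finsupp.smul_apply, smul_eq_mul,
    transport_single, transportRow_apply]
  have hu := R.elt_smul u
  -- only the orbit of `u` contributes, and there the sum over `v` decomposes the set of all `g`
  -- with `g rₙ = u` according to the value `v` of `g⁻¹ w`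
  rw [Finset.sum_eq_single (R.idx u)]
  · set n := R.idx u
    set h := R.elt u
    set φ := L (Finsupp.single (R.rep n) 1) with hφ
    set c := L (Finsupp.single u 1) w with hc
    have hval : ∀ g : G, g • R.rep n = u → φ (g⁻¹ • w) = c := by
      intro g hg
      rw [hφ, hc, ← hg, ← shift_single, hL, shift_apply']
    have hterm : ∀ v ∈ φ.support, (R.mass μ n : ℂ)⁻¹ * φ v *
        (μ.real {g : G | g • R.rep n = u ∧ g • v = w} : ℂ) =
        (R.mass μ n : ℂ)⁻¹ * c *
          (μ.real {g : G | g ∈ {g : G | g • R.rep n = u} ∧ g⁻¹ • w = v} : ℂ) := by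
      intro v _
      have e : {g : G | g • R.rep n = u ∧ g • v = w} =
          {g : G | g ∈ {g : G | g • R.rep n = u} ∧ g⁻¹ • w = v} := by
        ext g
        change _ ∧ _ ↔ _ ∧ _
        rw [inv_smul_eq_iff, eq_comm (a := w)]
        rfl
      rw [e]
      rcases Set.eq_empty_or_nonempty
        {g : G | g ∈ {g : G | g • R.rep n = u} ∧ g⁻¹ • w = v} with h0 | ⟨g, hg, hgv⟩
      · rw [h0]
        simp
      · rw [← hgv, hval g hg]
    rw [Finset.sum_congr rfl hterm, ← Finset.mul_sum]
    by_cases hc0 : c = 0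
    · simp [hc0]
    · rw [← Complex.ofReal_sum, sum_measureReal_fiber μ
        (isOpen_setOf_smul_eq G (R.rep n) u).measurableSet
        (isCompact_setOf_smul_eq G (R.rep n) u).measure_lt_top.ne
        (p := fun g => g⁻¹ • w) (fun v => ?_) φ.support (fun g hg => ?_)]
      · have hm : μ.real {g : G | g • R.rep n = u} = R.mass μ n := by
          rw [← hu, measureReal_smul_eq_smul]; rfl
        rw [hm]
        field_simp [R.mass_ne_zero μ n]
      · have : {g : G | g⁻¹ • w = v} = {g : G | g • v = w} := by
          ext g
          change _ = _ ↔ _ = _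
          rw [inv_smul_eq_iff, eq_comm]
        rw [this]
        exact (isOpen_setOf_smul_eq G v w).measurableSet
      · rw [Finsupp.mem_support_iff, hval g hg]
        exact hc0
  · intro n _ hn
    refine Finset.sum_eq_zero fun v _ => ?_
    have : {g : G | g • R.rep n = u ∧ g • v = w} = ∅ := by
      ext g
      exact iff_of_false (fun hg => hn (R.idx_eq hg.1).symm) id
    simp [this]
  · simp

theorem mem_span_transport (R : OrbitReps G Ω t) {L : (Ω →₀ ℂ) →ₗ[ℂ] (Ω →₀ ℂ)}
    (hL : ∀ (g : G) φ, L (shift g φ) = shift g (L φ)) :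
    L ∈ Submodule.span ℂ (Set.range fun p : Ω × Ω => transport μ p.1 p.2) := by
  rw [R.eq_sum_transport μ hL]
  exact Submodule.sum_mem _ fun n _ => Submodule.sum_mem _ fun v _ => Submodule.smul_mem _ _
    (Submodule.subset_span ⟨(R.rep n, v), rfl⟩)

/-- Conjugate transposed equivariant kernels act by adjoint operators: by `mem_span_transport` this
reduces to `pairing_transport`. -/
theorem pairing_adjoint [μ.IsMulRightInvariant] {H : UnitaryRep G} {f f' : Ω → H.carrier}
    (hf : ∀ (g : G) x, f (g • x) = H.π g (f x)) (hf' : ∀ (g : G) x, f' (g • x) = H.π g (f' x))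
    {L L' : (Ω →₀ ℂ) →ₗ[ℂ] (Ω →₀ ℂ)} (hL : ∀ (g : G) φ, L (shift g φ) = shift g (L φ))
    (hLL' : ∀ x y, L' (Finsupp.single x 1) y = starRingEnd ℂ (L (Finsupp.single y 1) x)) :
    R.pairing μ (fun x => Finsupp.linearCombination ℂ f (L (Finsupp.single x 1))) f' =
      R.pairing μ f (fun x => Finsupp.linearCombination ℂ f' (L' (Finsupp.single x 1))) := by
  suffices key : ∀ M ∈ Submodule.span ℂ (Set.range fun p : Ω × Ω => transport μ p.1 p.2),
      ∃ M' : (Ω →₀ ℂ) →ₗ[ℂ] (Ω →₀ ℂ),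
        (∀ x y, M' (Finsupp.single x 1) y = starRingEnd ℂ (M (Finsupp.single y 1) x)) ∧
        R.pairing μ (fun x => Finsupp.linearCombination ℂ f (M (Finsupp.single x 1))) f' =
          R.pairing μ f (fun x => Finsupp.linearCombination ℂ f' (M' (Finsupp.single x 1))) by
    obtain ⟨M', hM', h⟩ := key L (R.mem_span_transport μ hL)
    have : L' = M' := by
      ext x y
      simp only [LinearMap.comp_apply, Finsupp.lsingle_apply]
      rw [hM', hLL']
    rw [h, this]
  intro M hM
  induction hM using Submodule.span_induction with
  | mem M hM =>
    obtain ⟨⟨y, z⟩, rfl⟩ := hM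
    refine ⟨transport μ z y, fun u v => ?_, ?_⟩
    · rw [transport_symm, transport_single, transportRow_apply, Complex.conj_ofReal]
    · rw [R.pairing_transport μ hf hf', ← pairing_conj_symm, R.pairing_transport μ hf' hf,
        inner_conj_symm]
  | zero => exact ⟨0, by simp, by simp [pairing]⟩
  | add M N _ _ hM hN =>
    obtain ⟨M', hM', h1⟩ := hM
    obtain ⟨N', hN', h2⟩ := hN
    refine ⟨M' + N', fun x y => by simp [hM', hN'], ?_⟩
    simp only [pairing, LinearMap.add_apply, map_add, inner_add_left, inner_add_right, mul_add,
      Finset.sum_add_distrib] at h1 h2 ⊢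
    rw [h1, h2]
  | smul c M _ hM =>
    obtain ⟨M', hM', h1⟩ := hM
    refine ⟨starRingEnd ℂ c • M', fun x y => by simp [hM'], ?_⟩
    simp only [pairing, LinearMap.smul_apply, map_smul, inner_smul_left, inner_smul_right,
      mul_left_comm _ (starRingEnd ℂ c), ← Finset.mul_sum] at h1 ⊢
    rw [h1]

end OrbitReps

/-! ### Equivariant families of vectors as a module over an algebra of invariant kernels -/

/-- A `*`-algebra `A` acting from the right, by `G`-invariant kernels, on the finitely supported
functions on `Ω`; the idempotent `Ψ 1` need not be the identity. The kernels compressed from the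
operators `transport μ y z` are required to belong to `A`. -/
structure KernelAlgebra {G : Type u} [Group G] [TopologicalSpace G] [IsTopologicalGroup G]
    [MeasurableSpace G] [BorelSpace G] (μ : Measure G) [μ.IsHaarMeasure]
    (A : Type u) [Ring A] [Algebra ℂ A] [StarRing A]
    (Ω : Type u) [MulAction G Ω] [CompactOpenStabilizers G Ω] where
  Ψ : A →ₗ[ℂ] (Ω →₀ ℂ) →ₗ[ℂ] (Ω →₀ ℂ)
  Ψ_mul : ∀ a b, Ψ (a * b) = Ψ b ∘ₗ Ψ a
  Ψ_shift : ∀ a (g : G) φ, Ψ a (shift g φ) = shift g (Ψ a φ)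
  Ψ_star : ∀ a x y, Ψ (star a) (Finsupp.single x 1) y = starRingEnd ℂ (Ψ a (Finsupp.single y 1) x)
  τ : Ω → Ω → A
  Ψ_τ : ∀ y z, Ψ (τ y z) = Ψ 1 ∘ₗ transport μ y z ∘ₗ Ψ 1

namespace KernelAlgebra

variable {G : Type u} [Group G] [TopologicalSpace G] [IsTopologicalGroup G]
  [MeasurableSpace G] [BorelSpace G] {μ : Measure G} [μ.IsHaarMeasure]
  {A : Type u} [Ring A] [Algebra ℂ A] [StarRing A]
  {Ω : Type u} [MulAction G Ω] [CompactOpenStabilizers G Ω] {t : ℕ}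
  (D : KernelAlgebra μ A Ω) (R : OrbitReps G Ω t) (H : UnitaryRep G)

/-- The families of vectors `f : Ω → H` with `f (g x) = g (f x)` that are fixed by the idempotent
`Ψ 1`. -/
def fn : Submodule ℂ (Ω → H.carrier) where
  carrier := {f | (∀ (g : G) x, f (g • x) = H.π g (f x)) ∧
    ∀ x, Finsupp.linearCombination ℂ f (D.Ψ 1 (Finsupp.single x 1)) = f x}
  add_mem' {f f'} hf hf' := by
    refine ⟨fun g x => by simp [hf.1, hf'.1], fun x => ?_⟩
    have e : Finsupp.linearCombination ℂ (f + f') =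
        Finsupp.linearCombination ℂ f + Finsupp.linearCombination ℂ f' := by
      ext; simp
    rw [e, LinearMap.add_apply, hf.2, hf'.2, Pi.add_apply]
  zero_mem' := ⟨fun g x => by simp, fun x => by simp⟩
  smul_mem' c f hf := by
    refine ⟨fun g x => by simp [hf.1], fun x => ?_⟩
    have e : Finsupp.linearCombination ℂ (c • f) = c • Finsupp.linearCombination ℂ f := by
      ext; simp
    rw [e, LinearMap.smul_apply, hf.2, Pi.smul_apply]

/-- The operator `a` on families of vectors. -/
def act (a : A) : (Ω → H.carrier) →ₗ[ℂ] (Ω → H.carrier) where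
  toFun f x := Finsupp.linearCombination ℂ f (D.Ψ a (Finsupp.single x 1))
  map_add' f f' := by
    funext x
    simp [Finsupp.linearCombination_apply, Finsupp.sum_add]
  map_smul' c f := by
    funext x
    simp [Finsupp.linearCombination_apply, Finsupp.smul_sum, smul_comm c]

variable {H}

theorem Ψ_mul_apply (a b : A) (φ : Ω →₀ ℂ) : D.Ψ (a * b) φ = D.Ψ b (D.Ψ a φ) := by
  rw [D.Ψ_mul]; rfl

theorem linearCombination_act (a : A) (f : Ω → H.carrier) (φ : Ω →₀ ℂ) :
    Finsupp.linearCombination ℂ (D.act H a f) φ = Finsupp.linearCombination ℂ f (D.Ψ a φ) := by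
  suffices Finsupp.linearCombination ℂ (D.act H a f) = Finsupp.linearCombination ℂ f ∘ₗ D.Ψ a from
    LinearMap.congr_fun this φ
  ext x
  simp [act]

theorem linearCombination_shift {f : Ω → H.carrier} (hf : ∀ (g : G) x, f (g • x) = H.π g (f x))
    (g : G) (φ : Ω →₀ ℂ) : Finsupp.linearCombination ℂ f (shift g φ) =
      H.π g (Finsupp.linearCombination ℂ f φ) := by
  suffices Finsupp.linearCombination ℂ f ∘ₗ shift g =
      (H.π g).toLinearEquiv.toLinearMap ∘ₗ Finsupp.linearCombination ℂ f from
    LinearMap.congr_fun this φ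
  ext x
  simp [shift_single, hf]

theorem linearCombination_of_mem_fn {f : Ω → H.carrier} (hf : f ∈ D.fn H) (φ : Ω →₀ ℂ) :
    Finsupp.linearCombination ℂ f (D.Ψ 1 φ) = Finsupp.linearCombination ℂ f φ := by
  suffices Finsupp.linearCombination ℂ f ∘ₗ D.Ψ 1 = Finsupp.linearCombination ℂ f from
    LinearMap.congr_fun this φ
  ext x
  simp [hf.2]

theorem act_mem_fn (a : A) {f : Ω → H.carrier} (hf : ∀ (g : G) x, f (g • x) = H.π g (f x)) :
    D.act H a f ∈ D.fn H := by
  refine ⟨fun g x => ?_, fun x => ?_⟩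
  · change Finsupp.linearCombination ℂ f (D.Ψ a (Finsupp.single (g • x) 1)) = _
    rw [← shift_single, D.Ψ_shift, linearCombination_shift hf]
    rfl
  · rw [linearCombination_act, ← D.Ψ_mul_apply, one_mul]
    rfl

theorem act_mul (a b : A) (f : Ω → H.carrier) : D.act H (a * b) f = D.act H a (D.act H b f) := by
  funext x
  change _ = Finsupp.linearCombination ℂ (D.act H b f) (D.Ψ a (Finsupp.single x 1))
  rw [linearCombination_act, ← D.Ψ_mul_apply]
  rfl

theorem act_one {f : Ω → H.carrier} (hf : f ∈ D.fn H) : D.act H 1 f = f :=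
  funext fun x => hf.2 x

theorem act_transport {f : Ω → H.carrier} (hf : f ∈ D.fn H) (y z : Ω) :
    D.act H (D.τ y z) f = D.act H 1
      (fun x => Finsupp.linearCombination ℂ f (transport μ y z (Finsupp.single x 1))) := by
  funext x
  change Finsupp.linearCombination ℂ f (D.Ψ (D.τ y z) (Finsupp.single x 1)) =
    Finsupp.linearCombination ℂ _ (D.Ψ 1 (Finsupp.single x 1))
  rw [D.Ψ_τ, LinearMap.comp_apply, D.linearCombination_of_mem_fn hf, LinearMap.comp_apply]
  generalize D.Ψ 1 (Finsupp.single x 1) = φ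
  suffices Finsupp.linearCombination ℂ f ∘ₗ transport μ y z = Finsupp.linearCombination ℂ
      (fun x => Finsupp.linearCombination ℂ f (transport μ y z (Finsupp.single x 1))) from
    LinearMap.congr_fun this φ
  ext x
  simp

theorem pairing_act [μ.IsMulRightInvariant] (a : A) {f f' : Ω → H.carrier}
    (hf : ∀ (g : G) x, f (g • x) = H.π g (f x)) (hf' : ∀ (g : G) x, f' (g • x) = H.π g (f' x)) :
    R.pairing μ (D.act H a f) f' = R.pairing μ f (D.act H (star a) f') :=
  R.pairing_adjoint μ hf hf' (D.Ψ_shift a) (D.Ψ_star a)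

/-- The elements `τ y z` of `A` recover all the inner products `⟨f y, f' z⟩`. -/
theorem pairing_τ [μ.IsMulRightInvariant] {f f' : Ω → H.carrier} (hf : f ∈ D.fn H)
    (hf' : f' ∈ D.fn H) (y z : Ω) :
    R.pairing μ f (D.act H (D.τ y z) f') = inner ℂ (f y) (f' z) := by
  rw [D.act_transport hf', ← R.pairing_transport μ hf.1 hf'.1 y z]
  have h1 : D.act H (star 1) f = f := by rw [star_one, D.act_one hf]
  conv_rhs => rw [← h1]
  rw [D.pairing_act R (star 1) hf.1, star_star]
  intro g x
  rw [← shift_single, transport_shift, linearCombination_shift hf'.1]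

/-! ### The Hilbert space of equivariant families -/

variable (H)

/-- The value at `x` of the family encoded by its rescaled values at the representatives. The factor
`√μ(stab rₙ)` turns the inner product of the direct sum into `OrbitReps.pairing`. -/
def evalCLM (x : Ω) : PiLp 2 (fun _ : Fin t => H.carrier) →L[ℂ] H.carrier :=
  (Real.sqrt (R.mass μ (R.idx x)) : ℂ) •
    ((H.π (R.elt x)).toContinuousLinearEquiv.toContinuousLinearMap ∘L
      PiLp.proj 2 (fun _ : Fin t => H.carrier) (R.idx x))

theorem evalCLM_apply (x : Ω) (h : PiLp 2 (fun _ : Fin t => H.carrier)) :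
    evalCLM (μ := μ) R H x h =
      (Real.sqrt (R.mass μ (R.idx x)) : ℂ) • H.π (R.elt x) (h (R.idx x)) := rfl

/-- The Hilbert space of families in `fn`, with the inner product `OrbitReps.pairing`, realized as a
closed subspace of a finite direct sum of copies of `H`. -/
def space : Submodule ℂ (PiLp 2 (fun _ : Fin t => H.carrier)) where
  carrier := {h | (fun x => evalCLM (μ := μ) R H x h) ∈ D.fn H}
  add_mem' {h h'} hh hh' := by
    have e : (fun x => evalCLM (μ := μ) R H x (h + h')) =
        (fun x => evalCLM (μ := μ) R H x h) + fun x => evalCLM (μ := μ) R H x h' :=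
      funext fun x => map_add _ _ _
    change (fun x => evalCLM (μ := μ) R H x (h + h')) ∈ D.fn H
    rw [e]
    exact Submodule.add_mem _ hh hh'
  zero_mem' := by
    have e : (fun x => evalCLM (μ := μ) R H x 0) = (0 : Ω → H.carrier) :=
      funext fun x => map_zero _
    change (fun x => evalCLM (μ := μ) R H x 0) ∈ D.fn H
    rw [e]
    exact Submodule.zero_mem _
  smul_mem' c h hh := by
    have e : (fun x => evalCLM (μ := μ) R H x (c • h)) = c • fun x => evalCLM (μ := μ) R H x h :=
      funext fun x => map_smul _ _ _
    change (fun x => evalCLM (μ := μ) R H x (c • h)) ∈ D.fn H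
    rw [e]
    exact Submodule.smul_mem _ c hh

theorem isClosed_space : IsClosed (D.space R H : Set (PiLp 2 (fun _ : Fin t => H.carrier))) := by
  have e : (D.space R H : Set (PiLp 2 (fun _ : Fin t => H.carrier))) =
      (⋂ (g : G) (x : Ω), {h | evalCLM (μ := μ) R H (g • x) h = H.π g (evalCLM (μ := μ) R H x h)}) ∩
      ⋂ x : Ω, {h | (D.Ψ 1 (Finsupp.single x 1)).sum
        (fun y c => c • evalCLM (μ := μ) R H y h) = evalCLM (μ := μ) R H x h} := by
    ext h
    simp only [Set.mem_inter_iff, Set.mem_iInter]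
    exact Iff.rfl
  rw [e]
  refine IsClosed.inter (isClosed_iInter fun g => isClosed_iInter fun x => ?_)
    (isClosed_iInter fun x => ?_)
  · exact isClosed_eq (evalCLM (μ := μ) R H (g • x)).continuous
      ((H.π g).continuous.comp (evalCLM (μ := μ) R H x).continuous)
  · refine isClosed_eq ?_ (evalCLM (μ := μ) R H x).continuous
    exact continuous_finsetSum _ fun y _ => (evalCLM (μ := μ) R H y).continuous.const_smul _

instance : CompleteSpace (D.space R H) :=
  (D.isClosed_space R H).isComplete.completeSpace_coe

/-- The family encoded by an element of `space`. -/
def ev : D.space R H →ₗ[ℂ] (Ω → H.carrier) where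
  toFun h x := evalCLM (μ := μ) R H x h.1
  map_add' _ _ := funext fun _ => map_add _ _ _
  map_smul' _ _ := funext fun _ => map_smul _ _ _

variable {H}

theorem ev_mem_fn (h : D.space R H) : D.ev R H h ∈ D.fn H := h.2

theorem continuous_ev (x : Ω) : Continuous fun h : D.space R H => D.ev R H h x :=
  (evalCLM (μ := μ) R H x).continuous.comp continuous_subtype_val

theorem sqrt_mass_ne_zero (n : Fin t) : (Real.sqrt (R.mass μ n) : ℂ) ≠ 0 := by
  exact_mod_cast (Real.sqrt_pos.2 (R.mass_pos μ n)).ne'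

theorem ev_rep (h : D.space R H) (n : Fin t) :
    D.ev R H h (R.rep n) = (Real.sqrt (R.mass μ n) : ℂ) • h.1 n := by
  have e1 := (D.ev_mem_fn R h).1 (R.elt (R.rep n)) (R.rep (R.idx (R.rep n)))
  rw [R.elt_smul, R.idx_rep] at e1
  have e2 : D.ev R H h (R.rep n) =
      (Real.sqrt (R.mass μ (R.idx (R.rep n))) : ℂ) •
        H.π (R.elt (R.rep n)) (h.1 (R.idx (R.rep n))) := rfl
  rw [R.idx_rep] at e2
  have e3 := e1.symm.trans e2
  rw [← map_smul] at e3
  exact (H.π _).injective e3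

theorem ev_injective : Function.Injective (D.ev R H) := by
  intro h h' e
  refine Subtype.ext (PiLp.ext fun n => ?_)
  have := congrFun e (R.rep n)
  rw [ev_rep, ev_rep] at this
  exact smul_right_injective _ (sqrt_mass_ne_zero R n) this

theorem inner_eq_pairing (h h' : D.space R H) :
    inner ℂ h h' = R.pairing μ (D.ev R H h) (D.ev R H h') := by
  rw [Submodule.coe_inner, PiLp.inner_apply, OrbitReps.pairing]
  refine Finset.sum_congr rfl fun n _ => ?_
  rw [ev_rep, ev_rep, inner_smul_left, inner_smul_right, Complex.conj_ofReal, ← mul_assoc,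
    ← mul_assoc]
  have : (R.mass μ n : ℂ)⁻¹ * (Real.sqrt (R.mass μ n) : ℂ) * (Real.sqrt (R.mass μ n) : ℂ) = 1 := by
    rw [mul_assoc, ← Complex.ofReal_mul, Real.mul_self_sqrt (R.mass_pos μ n).le,
      inv_mul_cancel₀ (R.mass_ne_zero μ n)]
  rw [this, one_mul]

variable (H) in
/-- The element of `space` encoding a family. -/
def ofFamily : D.fn H →ₗ[ℂ] D.space R H where
  toFun f := ⟨WithLp.toLp 2 fun n => (Real.sqrt (R.mass μ n) : ℂ)⁻¹ • f.1 (R.rep n), by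
    change (fun x => evalCLM (μ := μ) R H x _) ∈ D.fn H
    convert f.2 using 1
    funext x
    rw [evalCLM_apply]
    change _ • H.π _ ((Real.sqrt (R.mass μ (R.idx x)) : ℂ)⁻¹ • f.1 (R.rep (R.idx x))) = _
    rw [map_smul, smul_inv_smul₀ (sqrt_mass_ne_zero R _), ← f.2.1, R.elt_smul]⟩
  map_add' f f' := Subtype.ext (PiLp.ext fun n => smul_add _ _ _)
  map_smul' c f := Subtype.ext (PiLp.ext fun n => smul_comm _ _ _)

theorem ev_ofFamily (f : D.fn H) : D.ev R H (D.ofFamily R H f) = f.1 := by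
  funext x
  change evalCLM (μ := μ) R H x _ = _
  rw [evalCLM_apply]
  change _ • H.π _ ((Real.sqrt (R.mass μ (R.idx x)) : ℂ)⁻¹ • f.1 (R.rep (R.idx x))) = _
  rw [map_smul, smul_inv_smul₀ (sqrt_mass_ne_zero R _), ← f.2.1, R.elt_smul]

variable (H) in
/-- The operator `a` on `space`. It is bounded because every value of `a f` is a finite linear
combination of values of `f`. -/
def actCLM (a : A) : D.space R H →L[ℂ] D.space R H where
  toFun h := D.ofFamily R H ⟨D.act H a (D.ev R H h), D.act_mem_fn a (D.ev_mem_fn R h).1⟩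
  map_add' h h' := by
    rw [← map_add]
    congr 1
    exact Subtype.ext (by simp)
  map_smul' c h := by
    rw [RingHom.id_apply, ← map_smul]
    congr 1
    exact Subtype.ext (by simp)
  cont := by
    refine Continuous.subtype_mk ?_ _
    refine (PiLp.continuous_toLp 2 _).comp (continuous_pi fun n => Continuous.const_smul ?_ _)
    exact continuous_finsetSum _ fun y _ => (D.continuous_ev R y).const_smul _

theorem ev_actCLM (a : A) (h : D.space R H) :
    D.ev R H (D.actCLM R H a h) = D.act H a (D.ev R H h) := D.ev_ofFamily R _

variable [StarModule ℂ A] [μ.IsMulRightInvariant]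

theorem inner_actCLM (a : A) (h h' : D.space R H) :
    inner ℂ (D.actCLM R H a h) h' = inner ℂ h (D.actCLM R H (star a) h') := by
  rw [inner_eq_pairing, inner_eq_pairing, ev_actCLM, ev_actCLM]
  exact D.pairing_act R a (D.ev_mem_fn R h).1 (D.ev_mem_fn R h').1

variable (H) in
/-- The unitary representation of `A` on the equivariant families of vectors of `H`. -/
def rep : AlgRep A where
  carrier := D.space R H
  ρ :=
    { toFun := D.actCLM R H
      map_smul' := fun c a => by
        ext1 h
        refine D.ev_injective R ?_
        rw [ev_actCLM]
        change _ = D.ev R H (c • D.actCLM R H a h)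
        rw [map_smul, ev_actCLM]
        funext x
        simp [act]
      map_zero' := by
        ext1 h
        refine D.ev_injective R ?_
        rw [ev_actCLM]
        change _ = D.ev R H 0
        rw [map_zero]
        funext x
        simp [act]
      map_add' := fun a b => by
        ext1 h
        refine D.ev_injective R ?_
        rw [ev_actCLM]
        change _ = D.ev R H (D.actCLM R H a h + D.actCLM R H b h)
        rw [map_add, ev_actCLM, ev_actCLM]
        funext x
        simp [act]
      map_mul' := fun a b => by
        ext1 h
        refine D.ev_injective R ?_
        change _ = D.ev R H (D.actCLM R H a (D.actCLM R H b h))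
        rw [ev_actCLM, ev_actCLM, ev_actCLM, act_mul]
      map_star' := fun a => by
        rw [ContinuousLinearMap.star_eq_adjoint, ContinuousLinearMap.eq_adjoint_iff]
        intro h h'
        rw [inner_actCLM, star_star] }
  dense_smooth := by
    have : Submodule.span ℂ {w : D.space R H | ∃ a v, w = D.actCLM R H a v} = ⊤ := by
      refine Submodule.eq_top_iff'.2 fun h => Submodule.subset_span ⟨1, h, ?_⟩
      refine D.ev_injective R ?_
      rw [ev_actCLM, D.act_one (D.ev_mem_fn R h)]
    change Dense (Submodule.span ℂ {w : D.space R H | ∃ a v, w = D.actCLM R H a v} :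
      Set (D.space R H))
    rw [this]
    exact dense_univ

/-- The family of vectors encoded by an element of `rep`. -/
def family (h : (D.rep R H).carrier) : Ω → H.carrier := D.ev R H h

theorem family_mem (h : (D.rep R H).carrier) : D.family R h ∈ D.fn H := D.ev_mem_fn R h

theorem family_ρ (a : A) (h : (D.rep R H).carrier) :
    D.family R ((D.rep R H).ρ a h) = D.act H a (D.family R h) := D.ev_actCLM R a h

theorem inner_rep (h h' : (D.rep R H).carrier) :
    inner ℂ h h' = R.pairing μ (D.family R h) (D.family R h') := D.inner_eq_pairing R h h'

theorem coef_rep (h : (D.rep R H).carrier) (a : A) :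
    (D.rep R H).coef h a = R.pairing μ (D.family R h) (D.act H a (D.family R h)) := by
  rw [AlgRep.coef, inner_rep, family_ρ]

/-- The inner products of the values of a family are matrix coefficients. -/
theorem inner_ρ_τ (h h' : (D.rep R H).carrier) (y z : Ω) :
    inner ℂ h ((D.rep R H).ρ (D.τ y z) h') = inner ℂ (D.family R h y) (D.family R h' z) := by
  rw [inner_rep, family_ρ, D.pairing_τ R (D.family_mem R h) (D.family_mem R h')]

theorem coef_τ (h : (D.rep R H).carrier) (y z : Ω) :
    (D.rep R H).coef h (D.τ y z) = inner ℂ (D.family R h y) (D.family R h z) :=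
  D.inner_ρ_τ R h h y z

theorem family_injective : Function.Injective (D.family R (H := H)) := D.ev_injective R

theorem exists_family_eq {f : Ω → H.carrier} (hf : f ∈ D.fn H) :
    ∃ h : (D.rep R H).carrier, D.family R h = f := ⟨D.ofFamily R H ⟨f, hf⟩, D.ev_ofFamily R _⟩

theorem continuous_family (x : Ω) : Continuous fun h : (D.rep R H).carrier => D.family R h x :=
  D.continuous_ev R x

end KernelAlgebra

/-! ### Comparing representations of `G` and of the kernel algebra -/

namespace UnitaryRep

variable {G : Type u} [Group G] [TopologicalSpace G]

/-- A nonzero equivariant family in an irreducible representation is total. -/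
theorem IsIrreducible.dense_span {V : UnitaryRep G} (hV : V.IsIrreducible) {Ω : Type*}
    [MulAction G Ω] {f : Ω → V.carrier} (hf : ∀ (g : G) x, f (g • x) = V.π g (f x)) (h0 : f ≠ 0) :
    Dense (Submodule.span ℂ (Set.range f) : Set V.carrier) := by
  set M := (Submodule.span ℂ (Set.range f)).topologicalClosure
  have hinv : ∀ g : G, ∀ x ∈ M, V.π g x ∈ M := by
    intro g x hx
    refine map_mem_closure (V.π g).continuous hx fun y hy => ?_
    refine Submodule.span_induction (p := fun y _ => V.π g y ∈
      Submodule.span ℂ (Set.range f)) ?_ ?_ ?_ ?_ hy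
    · rintro _ ⟨x, rfl⟩
      exact Submodule.subset_span ⟨g • x, hf g x⟩
    · rw [map_zero]
      exact Submodule.zero_mem _
    · intro y z _ _ h1 h2
      rw [map_add]
      exact Submodule.add_mem _ h1 h2
    · intro c y _ h1
      rw [map_smul]
      exact Submodule.smul_mem _ _ h1
  rcases hV.2 M (Submodule.isClosed_topologicalClosure _) hinv with h | h
  · exfalso
    refine h0 (funext fun x => ?_)
    have : f x ∈ M := Submodule.le_topologicalClosure _ (Submodule.subset_span ⟨x, rfl⟩)
    rw [h] at this
    exact (Submodule.mem_bot ℂ).1 this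
  · exact Submodule.dense_iff_topologicalClosure_eq_top.2 h

/-- A total family of vectors whose Gram matrix is invariant under `G` spans a unitary
representation. -/
theorem exists_of_gram [IsTopologicalGroup G] {Ω : Type u} [MulAction G Ω]
    [CompactOpenStabilizers G Ω]
    {E : Type u} [NormedAddCommGroup E] [InnerProductSpace ℂ E] [CompleteSpace E] {f : Ω → E}
    (hf : Dense (Submodule.span ℂ (Set.range f) : Set E))
    (hinv : ∀ (g : G) y z, inner ℂ (f (g • y)) (f (g • z)) = inner ℂ (f y) (f z)) :
    ∃ π : G →* (E ≃ₗᵢ[ℂ] E), (Continuous fun p : G × E => π p.1 p.2) ∧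
      ∀ (g : G) x, f (g • x) = π g (f x) := by
  choose θ hθ using fun g : G => exists_linearIsometry_of_gram (f' := fun x => f (g • x)) hf
    fun y z => (hinv g y z).symm
  have hmul : ∀ g h v, θ (g * h) v = θ g (θ h v) := by
    intro g h v
    have : (θ (g * h)).toContinuousLinearMap =
        (θ g).toContinuousLinearMap ∘L (θ h).toContinuousLinearMap := by
      refine ContinuousLinearMap.ext_on hf ?_
      rintro _ ⟨x, rfl⟩
      change θ (g * h) (f x) = θ g (θ h (f x))
      rw [hθ, hθ, hθ, mul_smul]
    exact DFunLike.congr_fun this v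
  have hone : ∀ v, θ 1 v = v := by
    intro v
    have : (θ 1).toContinuousLinearMap = ContinuousLinearMap.id ℂ E := by
      refine ContinuousLinearMap.ext_on hf ?_
      rintro _ ⟨x, rfl⟩
      change θ 1 (f x) = f x
      rw [hθ, one_smul]
    exact DFunLike.congr_fun this v
  let π : G →* (E ≃ₗᵢ[ℂ] E) :=
    { toFun := fun g =>
        { (θ g).toLinearMap with
          invFun := θ g⁻¹
          left_inv := fun v => (hmul _ _ v).symm.trans (by rw [inv_mul_cancel, hone])
          right_inv := fun v => (hmul _ _ v).symm.trans (by rw [mul_inv_cancel, hone])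
          norm_map' := (θ g).norm_map }
      map_one' := LinearIsometryEquiv.ext hone
      map_mul' := fun g h => LinearIsometryEquiv.ext (hmul g h) }
  have hπ : ∀ g v, π g v = θ g v := fun _ _ => rfl
  -- orbit maps are locally constant at the vectors `f x`, hence continuous on their span, and their
  -- uniform limits are continuous as well
  have hspan : ∀ v ∈ Submodule.span ℂ (Set.range f), Continuous fun g => π g v := by
    intro v hv
    induction hv using Submodule.span_induction with
    | mem x hx =>
      obtain ⟨y, rfl⟩ := hx
      let _ : TopologicalSpace Ω := ⊥
      have : DiscreteTopology Ω := ⟨rfl⟩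
      have hc : Continuous fun g : G => g • y :=
        continuous_discrete_rng.2 fun v => isOpen_setOf_smul_eq G y v
      have : (fun g => π g (f y)) = f ∘ fun g : G => g • y := funext fun g => hθ g y
      rw [this]
      exact continuous_of_discreteTopology.comp hc
    | zero => simpa using continuous_const
    | add x y _ _ hx hy => exact (hx.add hy).congr fun g => (map_add _ _ _).symm
    | smul c x _ hx => exact (hx.const_smul c).congr fun g => (map_smul _ _ _).symm
  have hstrong : ∀ v, Continuous fun g => π g v := by
    intro v
    refine continuous_of_uniform_approx_of_continuous fun s hs => ?_
    obtain ⟨ε, hε, hsub⟩ := Metric.mem_uniformity_dist.1 hs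
    obtain ⟨u, hu, huv⟩ := Metric.dense_iff.1 hf v ε hε
    refine ⟨fun g => π g u, hspan u huv, fun g => hsub ?_⟩
    rw [LinearIsometryEquiv.dist_map, dist_comm]
    exact hu
  refine ⟨π, ?_, fun g x => (hθ g x).symm⟩
  rw [continuous_iff_continuousAt]
  rintro ⟨g₀, v₀⟩
  rw [ContinuousAt, tendsto_iff_dist_tendsto_zero]
  have h1 : Filter.Tendsto (fun p : G × E => dist p.2 v₀ + dist (π p.1 v₀) (π g₀ v₀)) (𝓝 (g₀, v₀))
      (𝓝 0) := by
    have : Continuous fun p : G × E => dist p.2 v₀ + dist (π p.1 v₀) (π g₀ v₀) :=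
      (continuous_snd.dist continuous_const).add
        (((hstrong v₀).comp continuous_fst).dist continuous_const)
    simpa using this.tendsto (g₀, v₀)
  refine squeeze_zero (fun _ => dist_nonneg) (fun p => ?_) h1
  refine (dist_triangle _ (π p.1 v₀) _).trans ?_
  rw [LinearIsometryEquiv.dist_map]

end UnitaryRep

namespace KernelAlgebra

variable {G : Type u} [Group G] [TopologicalSpace G] [IsTopologicalGroup G]
  [MeasurableSpace G] [BorelSpace G] {μ : Measure G} [μ.IsHaarMeasure] [μ.IsMulRightInvariant]
  {A : Type u} [Ring A] [Algebra ℂ A] [StarRing A] [StarModule ℂ A]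
  {Ω : Type u} [MulAction G Ω] [CompactOpenStabilizers G Ω] {t : ℕ}
  (D : KernelAlgebra μ A Ω) (R : OrbitReps G Ω t) {V H : UnitaryRep G}

theorem family_zero : D.family R (0 : (D.rep R V).carrier) = 0 := map_zero (D.ev R V)

theorem family_ne_zero {h : (D.rep R V).carrier} (h0 : h ≠ 0) : D.family R h ≠ 0 :=
  fun e => h0 (D.family_injective R (e.trans (D.family_zero R).symm))

/-- A total family generates the representation of `A`. -/
theorem eq_zero_of_inner_ρ {h h' : (D.rep R V).carrier}
    (hh : Dense (Submodule.span ℂ (Set.range (D.family R h)) : Set V.carrier))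
    (h0 : ∀ a, inner ℂ h' ((D.rep R V).ρ a h) = 0) : h' = 0 := by
  refine D.family_injective R (funext fun y => ?_)
  rw [family_zero]
  refine eq_zero_of_inner_total hh fun z => ?_
  rw [← inner_ρ_τ, h0]

theorem isIrreducible_rep (hV : V.IsIrreducible) [Nontrivial (D.rep R V).carrier] :
    (D.rep R V).IsIrreducible := by
  refine ⟨inferInstance, fun W hW hinv => or_iff_not_imp_left.2 fun hne => ?_⟩
  obtain ⟨h, hh, h0⟩ := Submodule.exists_mem_ne_zero_of_ne_bot hne
  have : CompleteSpace W := hW.isComplete.completeSpace_coe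
  rw [← Submodule.orthogonal_eq_bot_iff, Submodule.eq_bot_iff]
  intro h' hh'
  refine D.eq_zero_of_inner_ρ R (hV.dense_span (D.family_mem R h).1 (D.family_ne_zero R h0))
    fun a => ?_
  exact Submodule.inner_left_of_mem_orthogonal (hinv a h hh) hh'

/-- The sesquilinear form `∑ conj(φ y) ψ z d(τ y z)`. -/
def form (d : A → ℂ) (φ ψ : Ω →₀ ℂ) : ℂ :=
  φ.sum fun y c => ψ.sum fun z b => starRingEnd ℂ c * b * d (D.τ y z)

theorem continuous_form (φ ψ : Ω →₀ ℂ) : Continuous fun d : A → ℂ => D.form d φ ψ :=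
  continuous_finsetSum _ fun _ _ => continuous_finsetSum _ fun _ _ =>
    continuous_const.mul (continuous_apply _)

theorem form_coef (h : (D.rep R V).carrier) (φ ψ : Ω →₀ ℂ) :
    D.form ((D.rep R V).coef h) φ ψ = inner ℂ (Finsupp.linearCombination ℂ (D.family R h) φ)
      (Finsupp.linearCombination ℂ (D.family R h) ψ) := by
  rw [inner_linearCombination]
  simp only [form, coef_τ]

theorem finite_image_shift {C : Set G} (hC : IsCompact C) (φ : Ω →₀ ℂ) :
    ((fun g : G => shift g φ) '' C).Finite := by
  induction φ using Finsupp.induction_linear with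
  | zero =>
    refine (Set.finite_singleton 0).subset ?_
    rintro _ ⟨g, _, rfl⟩
    exact map_zero _
  | add φ ψ h1 h2 =>
    refine (h1.image2 (· + ·) h2).subset ?_
    rintro _ ⟨g, hg, rfl⟩
    exact ⟨_, ⟨g, hg, rfl⟩, _, ⟨g, hg, rfl⟩, (map_add _ _ _).symm⟩
  | single x c =>
    refine ((finite_image_smul hC x).image fun y => Finsupp.single y c).subset ?_
    rintro _ ⟨g, hg, rfl⟩
    exact ⟨_, ⟨g, hg, rfl⟩, (shift_single g x c).symm⟩

/-- Weak containment of modules over the kernel algebra yields weak containment of representations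
of `G`: on a compact set, the coefficient of a combination of the vectors `f x` involves only
finitely many elements of the kernel algebra. -/
theorem isWeaklyContained_of_coef_mem {h : (D.rep R V).carrier}
    (hh : Dense (Submodule.span ℂ (Set.range (D.family R h)) : Set V.carrier))
    (hc : (D.rep R V).coef h ∈ closure (Set.range (D.rep R H).coef)) : V.IsWeaklyContained H := by
  refine UnitaryRep.isWeaklyContained_of_dense (denseRange_linearCombination hh) ?_
  rintro _ ⟨φ, rfl⟩ ε hε C hC
  have hcont : Continuous fun d : A → ℂ => fun ψ : Ω →₀ ℂ => D.form d φ ψ :=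
    continuous_pi fun ψ => D.continuous_form φ ψ
  have hmem := map_mem_closure (t := (fun d : A → ℂ => fun ψ : Ω →₀ ℂ => D.form d φ ψ) ''
    Set.range (D.rep R H).coef) hcont hc fun d hd => ⟨d, hd, rfl⟩
  obtain ⟨_, ⟨_, ⟨h', rfl⟩, rfl⟩, hlt⟩ := mem_closure_fun_iff.1 hmem ε hε
    (finite_image_shift hC φ).toFinset
  refine ⟨Finsupp.linearCombination ℂ (D.family R h') φ, fun g hg => ?_⟩
  have := hlt (shift g φ) ((Set.Finite.mem_toFinset _).2 ⟨g, hg, rfl⟩)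
  simp only [form_coef] at this
  rw [linearCombination_shift (D.family_mem R h).1, linearCombination_shift (D.family_mem R h').1]
    at this
  exact this

/-- The equivariant family supported on the orbit of the `n`-th representative with value `v`
there. -/
def bump (n : Fin t) (v : H.carrier) (x : Ω) : H.carrier :=
  open Classical in if R.idx x = n then H.π (R.elt x) v else 0

theorem bump_smul {n : Fin t} {v : H.carrier}
    (hv : v ∈ H.fixed (MulAction.stabilizer G (R.rep n))) (g : G) (x : Ω) :
    bump R n v (g • x) = H.π g (bump R n v x) := by
  simp only [bump, R.idx_smul]
  split_ifs with h
  · have : (g * R.elt x)⁻¹ * R.elt (g • x) ∈ MulAction.stabilizer G (R.rep n) := by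
      have e1 := R.elt_smul (g • x)
      rw [R.idx_smul, h] at e1
      have e2 := R.elt_smul x
      rw [h] at e2
      rw [MulAction.mem_stabilizer_iff, mul_smul, e1, inv_smul_eq_iff, mul_smul, e2]
    have e : R.elt (g • x) = (g * R.elt x) * ((g * R.elt x)⁻¹ * R.elt (g • x)) := by
      rw [mul_inv_cancel_left]
    rw [e, UnitaryRep.π_mul, hv _ this, UnitaryRep.π_mul]
  · rw [map_zero]

theorem bump_rep {n : Fin t} {v : H.carrier}
    (hv : v ∈ H.fixed (MulAction.stabilizer G (R.rep n))) (k : Fin t) :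
    bump R n v (R.rep k) = if k = n then v else 0 := by
  simp only [bump, R.idx_rep]
  split_ifs with h
  · subst h
    refine hv _ ?_
    have := R.elt_smul (R.rep k)
    rw [R.idx_rep] at this
    exact this
  · rfl

theorem pairing_bump {n : Fin t} {v : H.carrier}
    (hv : v ∈ H.fixed (MulAction.stabilizer G (R.rep n))) (f : Ω → H.carrier) :
    R.pairing μ (bump R n v) f = (R.mass μ n : ℂ)⁻¹ * inner ℂ v (f (R.rep n)) := by
  rw [OrbitReps.pairing, Finset.sum_eq_single n]
  · rw [bump_rep R hv, if_pos rfl]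
  · intro k _ hk
    rw [bump_rep R hv, if_neg hk, inner_zero_left, mul_zero]
  · simp

/-- The coefficients of the element of `D.rep R H` defined by `bump` in terms of those of `v`. -/
def bumpCoef (n : Fin t) (d : G → ℂ) (a : A) : ℂ :=
  (R.mass μ n : ℂ)⁻¹ * (D.Ψ a (Finsupp.single (R.rep n) 1)).sum fun y c =>
    c * (open Classical in if R.idx y = n then d (R.elt y) else 0)

theorem exists_coef_eq_bumpCoef {n : Fin t} {v : H.carrier}
    (hv : v ∈ H.fixed (MulAction.stabilizer G (R.rep n))) :
    ∃ h : (D.rep R H).carrier, D.family R h = D.act H 1 (bump R n v) ∧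
      (D.rep R H).coef h = D.bumpCoef R n (H.coef v) := by
  obtain ⟨h, hh⟩ := D.exists_family_eq R (D.act_mem_fn 1 (bump_smul R hv))
  refine ⟨h, hh, funext fun a => ?_⟩
  rw [coef_rep, hh, D.pairing_act R 1 (bump_smul R hv)
    (D.act_mem_fn a (D.act_mem_fn 1 (bump_smul R hv)).1).1, star_one, ← act_mul, ← act_mul, one_mul,
    mul_one, pairing_bump R hv, bumpCoef]
  congr 1
  change inner ℂ v (Finsupp.linearCombination ℂ _ _) = _
  rw [Finsupp.linearCombination_apply, Finsupp.sum, inner_sum, Finsupp.sum]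
  refine Finset.sum_congr rfl fun y _ => ?_
  rw [inner_smul_right]
  congr 1
  simp only [bump]
  split_ifs
  · rfl
  · rw [inner_zero_right]

theorem continuous_bumpCoef (n : Fin t) : Continuous (D.bumpCoef R n) := by
  refine continuous_pi fun a => continuous_const.mul
    (continuous_finsetSum _ fun y _ => continuous_const.mul ?_)
  split_ifs
  · exact continuous_apply _
  · exact continuous_const

/-- Weak containment of representations of `G` yields weak containment of modules over the kernel
algebra. -/
theorem isWeaklyContained_rep [T2Space G] (hV : V.IsIrreducible) [Nontrivial (D.rep R V).carrier]
    (hVH : V.IsWeaklyContained H) : (D.rep R V).IsWeaklyContained (D.rep R H) := by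
  obtain ⟨h₀, hh₀⟩ := exists_ne (0 : (D.rep R V).carrier)
  have hf := D.family_mem R h₀
  obtain ⟨n, hn⟩ : ∃ n, D.family R h₀ (R.rep n) ≠ 0 := by
    by_contra! hcon
    refine D.family_ne_zero R hh₀ (funext fun x => ?_)
    rw [← R.elt_smul x, hf.1, hcon, map_zero, Pi.zero_apply]
  set v := D.family R h₀ (R.rep n)
  have hv : v ∈ V.fixed (MulAction.stabilizer G (R.rep n)) := fun k hk => by
    rw [← hf.1, MulAction.mem_stabilizer_iff.1 hk]
  obtain ⟨h, hh, hcoef⟩ := D.exists_coef_eq_bumpCoef R hv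
  have h0 : h ≠ 0 := by
    rintro rfl
    have e : inner ℂ (0 : (D.rep R V).carrier) h₀ = (R.mass μ n : ℂ)⁻¹ * inner ℂ v v := by
      rw [inner_rep, hh, D.pairing_act R 1 (bump_smul R hv) hf.1, star_one, D.act_one hf,
        pairing_bump R hv]
    rw [inner_zero_left] at e
    rcases mul_eq_zero.1 e.symm with h1 | h1
    · exact inv_ne_zero (R.mass_ne_zero μ n) h1
    · exact hn (inner_self_eq_zero.1 h1)
  -- the coefficient of `h` is a continuous function of that of the fixed vector `v`
  refine (D.isIrreducible_rep R hV).isWeaklyContained h0 ?_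
  rw [hcoef]
  refine map_mem_closure (D.continuous_bumpCoef R n) (hVH.coef_mem_closure_fixed μ
    (CompactOpenStabilizers.isOpen (R.rep n)) (CompactOpenStabilizers.isCompact (R.rep n)) hv) ?_
  rintro _ ⟨u, ⟨hu, _⟩, rfl⟩
  obtain ⟨h', _, hcoef'⟩ := D.exists_coef_eq_bumpCoef R hu
  exact ⟨h', hcoef'⟩

/-- An irreducible module over the kernel algebra that is weakly contained in the module of a
unitary representation of `G` comes from an irreducible unitary representation of `G`. The Gram
matrix `⟨w, τ y z w⟩` is a limit of Gram matrices of equivariant families, hence defines a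
representation; it is irreducible because the module of `A` it determines is. -/
theorem exists_irreducible_of_coef_mem {W : AlgRep A} (hW : W.IsIrreducible) {w : W.carrier}
    (hw : w ≠ 0) (hc : W.coef w ∈ closure (Set.range (D.rep R H).coef)) :
    ∃ V : UnitaryRep G, V.IsIrreducible ∧ ∃ h : (D.rep R V).carrier,
      Dense (Submodule.span ℂ (Set.range (D.family R h)) : Set V.carrier) ∧
      (D.rep R V).coef h = W.coef w := by
  set d := W.coef w with hd
  -- closed conditions satisfied by the coefficients of the module of `H` pass to the limit `d`
  have hlim : ∀ {Z : Set (A → ℂ)}, IsClosed Z → (∀ h' : (D.rep R H).carrier,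
      (D.rep R H).coef h' ∈ Z) → d ∈ Z := fun hZ hmem =>
    closure_minimal (by rintro _ ⟨h', rfl⟩; exact hmem h') hZ hc
  have hsymm : ∀ y z, starRingEnd ℂ (d (D.τ z y)) = d (D.τ y z) := fun y z =>
    hlim (Z := {d | starRingEnd ℂ (d (D.τ z y)) = d (D.τ y z)})
      (isClosed_eq (Complex.continuous_conj.comp (continuous_apply _)) (continuous_apply _))
      fun h' => by
        change starRingEnd ℂ _ = _
        rw [coef_τ, coef_τ, inner_conj_symm]
  have hpos : ∀ φ : Ω →₀ ℂ, 0 ≤ (D.form d φ φ).re := fun φ =>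
    hlim (Z := {d | 0 ≤ (D.form d φ φ).re})
      (isClosed_le continuous_const (Complex.continuous_re.comp (D.continuous_form φ φ)))
      fun h' => by
        change 0 ≤ (D.form _ φ φ).re
        rw [form_coef]
        exact inner_self_nonneg (𝕜 := ℂ)
  have hinv : ∀ (g : G) y z, d (D.τ (g • y) (g • z)) = d (D.τ y z) := fun g y z =>
    hlim (Z := {d | d (D.τ (g • y) (g • z)) = d (D.τ y z)})
      (isClosed_eq (continuous_apply _) (continuous_apply _)) fun h' => by
        change (D.rep R H).coef h' _ = (D.rep R H).coef h' _
        rw [coef_τ, coef_τ, (D.family_mem R h').1, (D.family_mem R h').1,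
          LinearIsometryEquiv.inner_map_map]
  have hfix : ∀ x y, D.form d (Finsupp.single y 1) (D.Ψ 1 (Finsupp.single x 1)) = d (D.τ y x) :=
    fun x y => hlim
      (Z := {d | D.form d (Finsupp.single y 1) (D.Ψ 1 (Finsupp.single x 1)) = d (D.τ y x)})
      (isClosed_eq (D.continuous_form _ _) (continuous_apply _)) fun h' => by
        change D.form _ _ _ = (D.rep R H).coef h' _
        rw [form_coef, coef_τ, D.linearCombination_of_mem_fn (D.family_mem R h')]
        simp
  -- the Gram matrix `d (τ y z)` determines `d`
  have hrepr : ∀ a, d a = ∑ n, (R.mass μ n : ℂ)⁻¹ *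
      D.form d (Finsupp.single (R.rep n) 1) (D.Ψ a (Finsupp.single (R.rep n) 1)) := fun a =>
    hlim (Z := {d | d a = ∑ n, (R.mass μ n : ℂ)⁻¹ *
      D.form d (Finsupp.single (R.rep n) 1) (D.Ψ a (Finsupp.single (R.rep n) 1))})
      (isClosed_eq (continuous_apply _) (continuous_finsetSum _ fun n _ =>
        continuous_const.mul (D.continuous_form _ _))) fun h' => by
        change (D.rep R H).coef h' a = _
        rw [coef_rep, OrbitReps.pairing]
        refine Finset.sum_congr rfl fun n _ => ?_
        rw [form_coef]
        simp [act]
  obtain ⟨E, _, _, _, f, hgram, htotal⟩ := exists_hilbert_of_kernel (fun y z => d (D.τ y z)) hsymm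
    hpos
  obtain ⟨π, hcont, hπ⟩ := UnitaryRep.exists_of_gram (G := G) htotal fun g y z => by
    rw [hgram, hgram, hinv]
  let V : UnitaryRep G := ⟨E, π, hcont⟩
  have hform : ∀ φ ψ, D.form d φ ψ = inner ℂ (Finsupp.linearCombination ℂ f φ)
      (Finsupp.linearCombination ℂ f ψ) := fun φ ψ => by
    rw [inner_linearCombination]
    simp only [hgram]
    rfl
  have hfn : (f : Ω → V.carrier) ∈ D.fn V := by
    refine ⟨hπ, fun x => ?_⟩
    rw [← sub_eq_zero]
    refine eq_zero_of_inner_total htotal fun y => ?_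
    have := hfix x y
    rw [hform, Finsupp.linearCombination_single, one_smul, ← hgram, ← sub_eq_zero,
      ← inner_sub_right] at this
    rw [← inner_conj_symm]
    exact (congrArg (starRingEnd ℂ) this).trans (map_zero _)
  obtain ⟨h, hh⟩ := D.exists_family_eq R hfn
  have hcoef : (D.rep R V).coef h = d := by
    funext a
    rw [coef_rep, hrepr, hh, OrbitReps.pairing]
    refine Finset.sum_congr rfl fun n _ => ?_
    rw [hform, Finsupp.linearCombination_single, one_smul]
    rfl
  have hh_total : Dense (Submodule.span ℂ (Set.range (D.family R h)) : Set V.carrier) := by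
    rw [hh]; exact htotal
  have h0 : h ≠ 0 := by
    rintro rfl
    have e1 := congrFun hcoef 1
    rw [AlgRep.coef_one, hd, AlgRep.coef_one, norm_zero] at e1
    have e2 : (‖w‖ : ℂ) ^ 2 = 0 := by rw [← e1]; simp
    exact hw (by simpa using e2)
  refine ⟨V, ⟨?_, fun V₁ hV₁ hinv₁ => ?_⟩, h, hh_total, hcoef⟩
  · by_contra hnt
    rw [not_nontrivial_iff_subsingleton] at hnt
    exact D.family_ne_zero R h0 (funext fun x => Subsingleton.elim _ _)
  · -- the cyclic vectors `w` and `h` have the same coefficient, which identifies the two modules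
    obtain ⟨θ, hθ⟩ := exists_linearIsometry_of_gram (f' := fun a => (D.rep R V).ρ a h)
      (hW.dense_orbit hw) (fun a b => by
        rw [AlgRep.inner_ρ_left, ← AlgRep.ρ_mul, AlgRep.inner_ρ_left, ← AlgRep.ρ_mul]
        exact (congrFun hcoef (star a * b)).symm)
    have hθw : θ w = h := by
      have := hθ 1
      rw [AlgRep.ρ_one, AlgRep.ρ_one] at this
      exact this
    have hθρ : ∀ a v, θ (W.ρ a v) = (D.rep R V).ρ a (θ v) := by
      intro a v
      have : θ.toContinuousLinearMap ∘L W.ρ a =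
          (D.rep R V).ρ a ∘L θ.toContinuousLinearMap := by
        refine ContinuousLinearMap.ext_on (hW.dense_orbit hw) ?_
        rintro _ ⟨b, rfl⟩
        change θ (W.ρ a (W.ρ b w)) = (D.rep R V).ρ a (θ (W.ρ b w))
        rw [← AlgRep.ρ_mul, hθ, hθ, AlgRep.ρ_mul]
      exact DFunLike.congr_fun this v
    have hsurj : ∀ h' : (D.rep R V).carrier, ∃ w', θ w' = h' := by
      have hcl : IsClosed (LinearMap.range θ.toLinearMap : Set (D.rep R V).carrier) :=
        θ.isometry.isClosedEmbedding.isClosed_range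
      have : CompleteSpace (LinearMap.range θ.toLinearMap) := hcl.isComplete.completeSpace_coe
      have htop : LinearMap.range θ.toLinearMap = ⊤ := by
        rw [← Submodule.orthogonal_eq_bot_iff, Submodule.eq_bot_iff]
        intro h' hh'
        refine D.eq_zero_of_inner_ρ R hh_total fun a => ?_
        exact Submodule.inner_left_of_mem_orthogonal
          (LinearMap.mem_range.2 ⟨W.ρ a w, hθ a⟩) hh'
      exact fun h' => LinearMap.range_eq_top.1 htop h'
    -- the vectors of `W` whose family takes values in `V₁`
    let N : Submodule ℂ W.carrier :=
      { carrier := {w' | ∀ x, D.family R (θ w') x ∈ V₁}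
        add_mem' := fun {a b} ha hb x => by
          have : D.family R (θ (a + b)) x = D.family R (θ a) x + D.family R (θ b) x := by
            rw [map_add]
            exact congrFun (map_add (D.ev R V) _ _) x
          rw [this]
          exact V₁.add_mem (ha x) (hb x)
        zero_mem' := fun x => by
          rw [map_zero, family_zero]
          exact V₁.zero_mem
        smul_mem' := fun c a ha x => by
          have : D.family R (θ (c • a)) x = c • D.family R (θ a) x := by
            rw [map_smul]
            exact congrFun (map_smul (D.ev R V) _ _) x
          rw [this]
          exact V₁.smul_mem _ (ha x) }
    have hNcl : IsClosed (N : Set W.carrier) := by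
      have : (N : Set W.carrier) = ⋂ x, {w' | D.family R (θ w') x ∈ V₁} := by
        ext w'
        simp only [Set.mem_iInter]
        rfl
      rw [this]
      exact isClosed_iInter fun x => hV₁.preimage ((D.continuous_family R x).comp θ.continuous)
    have hNinv : ∀ a, ∀ w' ∈ N, W.ρ a w' ∈ N := by
      intro a w' hw' x
      rw [hθρ, family_ρ]
      exact V₁.sum_mem fun y _ => V₁.smul_mem _ (hw' y)
    rcases hW.2 N hNcl hNinv with hN | hN
    · -- the projection of `f` to `V₁` is a family in `N`, hence vanishes: `V₁` is orthogonal to `f`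
      left
      have : CompleteSpace V₁ := hV₁.isComplete.completeSpace_coe
      have hP : ∀ (g : G) v, (V₁.starProjection (V.π g v)) = V.π g (V₁.starProjection v) := by
        intro g v
        refine Submodule.eq_starProjection_of_mem_of_inner_eq_zero
          (hinv₁ g _ (V₁.starProjection_apply_mem v)) fun u hu => ?_
        rw [← map_sub, UnitaryRep.inner_π_left]
        exact V₁.starProjection_inner_eq_zero v _ (hinv₁ _ _ hu)
      have hPf : (fun x => V₁.starProjection (f x)) ∈ D.fn V := by
        refine ⟨fun g x => ?_, fun x => ?_⟩
        · change V₁.starProjection (f (g • x)) = V.π g (V₁.starProjection (f x))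
          rw [hfn.1, hP]
        · refine Eq.trans ?_ (congrArg V₁.starProjection (hfn.2 x))
          simp [Finsupp.linearCombination_apply, Finsupp.sum]
      obtain ⟨h₁, hh₁⟩ := D.exists_family_eq R hPf
      obtain ⟨w₁, rfl⟩ := hsurj h₁
      have hw₁ : w₁ ∈ N := fun x => by
        rw [hh₁]
        exact V₁.starProjection_apply_mem _
      rw [hN, Submodule.mem_bot] at hw₁
      rw [hw₁, map_zero, family_zero] at hh₁
      rw [Submodule.eq_bot_iff]
      intro v hv
      refine eq_zero_of_inner_total htotal fun x => ?_
      have h1 := V₁.starProjection_inner_eq_zero (f x) v hv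
      have h2 : V₁.starProjection (f x) = 0 := (congrFun hh₁ x).symm
      rw [h2, sub_zero] at h1
      rw [← inner_conj_symm, h1, map_zero]
    · -- the total family `f` takes values in `V₁`
      right
      have hw' : w ∈ N := hN ▸ Submodule.mem_top
      have hsub : Submodule.span ℂ (Set.range f) ≤ V₁ := by
        rw [Submodule.span_le]
        rintro _ ⟨x, rfl⟩
        have := hw' x
        rwa [hθw, hh] at this
      refine Submodule.eq_top_iff'.2 fun v => ?_
      exact closure_minimal hsub hV₁ (htotal v)

end KernelAlgebra

/-! ### The algebra of a direct summand of an elementary functor -/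

section Finsupp

variable {Y : Type u}

/-- The inner product of finitely supported functions. -/
def finInner (φ ψ : Y →₀ ℂ) : ℂ := φ.sum fun y c => starRingEnd ℂ c * ψ y

theorem finInner_single_left (y : Y) (ψ : Y →₀ ℂ) : finInner (Finsupp.single y 1) ψ = ψ y := by
  rw [finInner, Finsupp.sum_single_index] <;> simp

theorem finInner_add_left (φ φ' ψ : Y →₀ ℂ) :
    finInner (φ + φ') ψ = finInner φ ψ + finInner φ' ψ :=
  Finsupp.sum_add_index' (by simp) (by simp [add_mul])

theorem finInner_smul_left (c : ℂ) (φ ψ : Y →₀ ℂ) :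
    finInner (c • φ) ψ = starRingEnd ℂ c * finInner φ ψ := by
  rw [finInner, Finsupp.sum_smul_index (by simp), finInner, Finsupp.mul_sum]
  simp [mul_assoc]

theorem finInner_add_right (φ ψ ψ' : Y →₀ ℂ) :
    finInner φ (ψ + ψ') = finInner φ ψ + finInner φ ψ' := by
  simp [finInner, mul_add, Finsupp.sum_add]

theorem finInner_smul_right (c : ℂ) (φ ψ : Y →₀ ℂ) :
    finInner φ (c • ψ) = c * finInner φ ψ := by
  simp only [finInner, Finsupp.mul_sum, Finsupp.smul_apply, smul_eq_mul]
  exact Finsupp.sum_congr fun _ _ => by ring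

theorem finInner_single_right (φ : Y →₀ ℂ) (y : Y) :
    finInner φ (Finsupp.single y 1) = starRingEnd ℂ (φ y) := by
  induction φ using Finsupp.induction_linear with
  | zero => simp [finInner]
  | add φ ψ h1 h2 => rw [finInner_add_left, h1, h2, Finsupp.add_apply, map_add]
  | single x c =>
    have : Finsupp.single x c = c • Finsupp.single x (1 : ℂ) := by simp
    rw [this, finInner_smul_left, finInner_single_left, Finsupp.smul_apply, smul_eq_mul, map_mul]
    congr 1
    classical
    rw [Finsupp.single_apply, Finsupp.single_apply]
    simp only [eq_comm (a := x)]
    split_ifs <;> simp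

/-- Adjointness of operators on finitely supported functions can be tested on matrix entries. -/
theorem finInner_eq_of_single {L L' : (Y →₀ ℂ) →ₗ[ℂ] (Y →₀ ℂ)}
    (h : ∀ x y, L' (Finsupp.single x 1) y = starRingEnd ℂ (L (Finsupp.single y 1) x))
    (φ ψ : Y →₀ ℂ) : finInner (L φ) ψ = finInner φ (L' ψ) := by
  induction φ using Finsupp.induction_linear with
  | zero => simp [finInner]
  | add φ φ' h1 h2 => rw [map_add, finInner_add_left, finInner_add_left, h1, h2]
  | single x c =>
    have : Finsupp.single x c = c • Finsupp.single x (1 : ℂ) := by simp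
    rw [this, map_smul, finInner_smul_left, finInner_smul_left]
    congr 1
    induction ψ using Finsupp.induction_linear with
    | zero => simp [finInner]
    | add φ φ' h1 h2 => rw [map_add, finInner_add_right, finInner_add_right, h1, h2]
    | single y b =>
      have : Finsupp.single y b = b • Finsupp.single y (1 : ℂ) := by simp
      rw [this, map_smul, finInner_smul_right, finInner_smul_right, finInner_single_right,
        finInner_single_left, h]

/-- The complex conjugate of a finitely supported function. -/
def conjF (φ : Y →₀ ℂ) : Y →₀ ℂ := φ.mapRange (starRingEnd ℂ) (map_zero _)

theorem conjF_apply (φ : Y →₀ ℂ) (y : Y) : conjF φ y = starRingEnd ℂ (φ y) := rfl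

theorem conjF_conjF (φ : Y →₀ ℂ) : conjF (conjF φ) = φ := by
  ext y; simp [conjF_apply]

theorem conjF_add (φ ψ : Y →₀ ℂ) : conjF (φ + ψ) = conjF φ + conjF ψ := by
  ext y; simp [conjF_apply]

theorem conjF_smul (c : ℂ) (φ : Y →₀ ℂ) : conjF (c • φ) = starRingEnd ℂ c • conjF φ := by
  ext y; simp [conjF_apply]

theorem conjF_single (y : Y) : conjF (Finsupp.single y 1) = Finsupp.single y (1 : ℂ) := by
  simp [conjF]

theorem conjF_shift {G : Type u} [Group G] [MulAction G Y] (g : G) (φ : Y →₀ ℂ) :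
    conjF (shift g φ) = shift g (conjF φ) := by
  ext y
  rw [conjF_apply, shift_apply', shift_apply', conjF_apply]

/-- The operator with complex conjugate matrix. -/
def conjOp (L : (Y →₀ ℂ) →ₗ[ℂ] (Y →₀ ℂ)) : (Y →₀ ℂ) →ₗ[ℂ] (Y →₀ ℂ) where
  toFun φ := conjF (L (conjF φ))
  map_add' φ ψ := by rw [conjF_add, map_add, conjF_add]
  map_smul' c φ := by rw [conjF_smul, map_smul, conjF_smul, Complex.conj_conj, RingHom.id_apply]

theorem conjOp_apply (L : (Y →₀ ℂ) →ₗ[ℂ] (Y →₀ ℂ)) (φ : Y →₀ ℂ) :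
    conjOp L φ = conjF (L (conjF φ)) := rfl

end Finsupp

variable {G : Type u} {V : Type v} [Group G] [TopologicalSpace G] [MulAction G V]
  {X : GComplex G V}

open GComplex GComplex.QuotCat

/-- A functor `F` that is a direct summand of `ℓ̃² ∘ S`: a natural isometric embedding `ι`, with
natural adjoint `p`. -/
structure Summand (S : X.QuotCat ⥤ Type u) (F : X.QuotCat ⥤ PHil.{u}) where
  ι : ∀ A : X.QuotCat, (F.obj A).carrier →ₗ[ℂ] (S.obj A →₀ ℂ)
  p : ∀ A : X.QuotCat, (S.obj A →₀ ℂ) →ₗ[ℂ] (F.obj A).carrier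
  ι_natural : ∀ {A B : X.QuotCat} (f : A ⟶ B) (v : (F.obj A).carrier),
    ι B (PHil.lin (F.map f) v) = Finsupp.lmapDomain ℂ ℂ (fun y => S.map f y) (ι A v)
  p_natural : ∀ {A B : X.QuotCat} (f : A ⟶ B) (φ : S.obj A →₀ ℂ),
    p B (Finsupp.lmapDomain ℂ ℂ (fun y => S.map f y) φ) = PHil.lin (F.map f) (p A φ)
  inner_p : ∀ (A : X.QuotCat) (v : (F.obj A).carrier) (φ : S.obj A →₀ ℂ),
    inner ℂ (p A φ) v = finInner φ (ι A v)
  p_ι : ∀ (A : X.QuotCat) (v : (F.obj A).carrier), p A (ι A v) = v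

/-- The conditions on a functor `S` to sets that make `ℓ̃² ∘ S` elementary, apart from the
topological conditions on stabilizers and the finiteness of the number of orbits. -/
structure IsOrbitFunctor (S : X.QuotCat ⥤ Type u) : Prop where
  stabilizer_le : ∀ x : Fiber S, ∃ c : X.Cell,
    MulAction.stabilizer G x ≤ MulAction.stabilizer G c
  proj_surjective : ∀ A : X.QuotCat, Function.Surjective fun x : Fiber S => S.map (proj A) x
  proj_eq_iff : ∀ (A : X.QuotCat) (x y : Fiber S),
    S.map (proj A) x = S.map (proj A) y ↔ ∃ γ ∈ A.Γ, γ • x = y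

section Category

theorem act_comp_proj (A : X.QuotCat) (g : G) : act X g ≫ proj A = projMul A g := by
  refine Subtype.ext (funext fun q => ?_)
  obtain ⟨v, rfl⟩ := mkVertex_surjective _ q
  change mkVertex V A.Γ ((1 : G) • g • v) = mkVertex V A.Γ (g • v)
  rw [one_smul]

/-- Every morphism lifts to an automorphism of `X`. -/
theorem exists_proj_comp {A B : X.QuotCat} (f : A ⟶ B) :
    ∃ g : G, proj A ≫ f = act X g ≫ proj B := by
  rcases f.2 with ⟨hAB, h⟩ | ⟨hA, g, h⟩
  · refine ⟨1, ?_⟩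
    rw [act_comp_proj]
    refine Subtype.ext (funext fun q => ?_)
    obtain ⟨v, rfl⟩ := mkVertex_surjective _ q
    change f.1 (mkVertex V A.Γ ((1 : G) • v)) = mkVertex V B.Γ ((1 : G) • v)
    rw [h]
  · refine ⟨g, ?_⟩
    rw [act_comp_proj]
    refine Subtype.ext (funext fun q => ?_)
    obtain ⟨v, rfl⟩ := mkVertex_surjective _ q
    change f.1 (mkVertex V A.Γ ((1 : G) • v)) = mkVertex V B.Γ (g • v)
    rw [h, one_smul]

theorem act_comp_proj_of_mem {A : X.QuotCat} {γ : G} (hγ : γ ∈ A.Γ) :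
    act X γ ≫ proj A = proj A := by
  rw [act_comp_proj]
  refine Subtype.ext (funext fun q => ?_)
  obtain ⟨v, rfl⟩ := mkVertex_surjective _ q
  change mkVertex V A.Γ (γ • v) = mkVertex V A.Γ ((1 : G) • v)
  rw [one_smul]
  exact mkVertex_eq.2 ⟨γ, hγ, rfl⟩

end Category

namespace IsOrbitFunctor

variable {S : X.QuotCat ⥤ Type u} (hS : IsOrbitFunctor S)

/-- Push-forward of finitely supported functions along `S(X) → S(Γ \ X)`. -/
def push (S : X.QuotCat ⥤ Type u) (A : X.QuotCat) : (Fiber S →₀ ℂ) →ₗ[ℂ] (S.obj A →₀ ℂ) :=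
  Finsupp.lmapDomain ℂ ℂ fun x : Fiber S => S.map (proj A) x

theorem push_single (A : X.QuotCat) (x : Fiber S) (c : ℂ) :
    push S A (Finsupp.single x c) = Finsupp.single (S.map (proj A) x) c :=
  Finsupp.mapDomain_single

theorem map_proj_smul (A : X.QuotCat) (g : G) (x : Fiber S) :
    S.map (proj A) (g • x) = S.map (projMul A g) x := by
  rw [← act_comp_proj, S.map_comp]
  rfl

theorem map_proj_smul_of_mem {A : X.QuotCat} {γ : G} (hγ : γ ∈ A.Γ) (x : Fiber S) :
    S.map (proj A) (γ • x) = S.map (proj A) x := by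
  rw [map_proj_smul, ← act_comp_proj, act_comp_proj_of_mem hγ]

theorem push_shift_of_mem {A : X.QuotCat} {γ : G} (hγ : γ ∈ A.Γ) (φ : Fiber S →₀ ℂ) :
    push S A (shift γ φ) = push S A φ := by
  suffices push S A ∘ₗ shift γ = push S A from LinearMap.congr_fun this φ
  refine Finsupp.lhom_ext' fun x => LinearMap.ext_ring ?_
  simp only [LinearMap.comp_apply, Finsupp.lsingle_apply]
  rw [shift_single, push_single, push_single, map_proj_smul_of_mem hγ]

/-- A morphism acts on push-forwards through an automorphism of `X`. -/
theorem exists_map_push {A B : X.QuotCat} (f : A ⟶ B) : ∃ g : G, ∀ φ : Fiber S →₀ ℂ,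
    Finsupp.lmapDomain ℂ ℂ (fun y => S.map f y) (push S A φ) = push S B (shift g φ) := by
  obtain ⟨g, hg⟩ := exists_proj_comp f
  refine ⟨g, fun φ => ?_⟩
  suffices Finsupp.lmapDomain ℂ ℂ (fun y => S.map f y) ∘ₗ push S A = push S B ∘ₗ shift g from
    LinearMap.congr_fun this φ
  refine Finsupp.lhom_ext' fun x => LinearMap.ext_ring ?_
  simp only [LinearMap.comp_apply, Finsupp.lsingle_apply]
  rw [shift_single, push_single, push_single, map_proj_smul, ← act_comp_proj, ← hg, S.map_comp]
  exact Finsupp.mapDomain_single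

end IsOrbitFunctor

/-! ### Operators induced on the quotients -/

section Descend

variable {G : Type u} {V : Type v} [Group G] [TopologicalSpace G] [MulAction G V]
  {X : GComplex G V}

open GComplex GComplex.QuotCat

namespace IsOrbitFunctor

variable {S : X.QuotCat ⥤ Type u}

theorem proj_base : proj (base X) = 𝟙 (base X) := act_one

theorem push_base (φ : Fiber S →₀ ℂ) : push S (base X) φ = φ := by
  suffices push S (base X) = LinearMap.id from LinearMap.congr_fun this φ
  refine Finsupp.lhom_ext' fun x => LinearMap.ext_ring ?_
  simp only [LinearMap.comp_apply, Finsupp.lsingle_apply]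
  rw [push_single, proj_base, S.map_id]
  rfl

/-- `Γ` acts freely on `S(X)`, because point stabilizers fix cells. -/
theorem eq_one (hS : IsOrbitFunctor S) {A : X.QuotCat} {γ : G} (hγ : γ ∈ A.Γ) {x : Fiber S}
    (hx : γ • x = x) : γ = 1 := by
  obtain ⟨c, hc⟩ := hS.stabilizer_le x
  have hγc : cellSMul γ c.1 = c.1 := congrArg Subtype.val (hc hx)
  obtain ⟨v, hv⟩ := (X.isRelLowerSet_faces c.2).1
  have hγv : γ • v ∈ c.1 := by
    rw [← hγc]
    exact mem_cellSMul.2 ⟨v, hv, rfl⟩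
  exact A.isQuotient.eq_one hγ
    (A.isQuotient.isCoverMap.injOn c.1 c.2 hγv hv (mkVertex_eq.2 ⟨γ, hγ, rfl⟩))

theorem smul_injective (hS : IsOrbitFunctor S) (A : X.QuotCat) (y : Fiber S) :
    Function.Injective fun γ : A.Γ => (γ : G) • y := by
  intro γ δ h
  have h' : ((δ⁻¹ * γ : A.Γ) : G) • y = y := by
    change ((δ : G)⁻¹ * γ) • y = y
    rw [mul_smul, inv_smul_eq_iff]
    exact h
  have := hS.eq_one (δ⁻¹ * γ : A.Γ).2 h'
  have h2 : (δ⁻¹ * γ : A.Γ) = 1 := Subtype.ext this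
  exact (inv_mul_eq_one.1 h2).symm

theorem finite_support (hS : IsOrbitFunctor S) (A : X.QuotCat) (φ : Fiber S →₀ ℂ) (y : Fiber S) :
    (Function.support fun γ : A.Γ => φ ((γ : G) • y)).Finite :=
  (φ.hasFiniteSupport.preimage (hS.smul_injective A y).injOn)

/-- The push-forward to `S(Γ \ X)` sums over the fibers, which are the `Γ`-orbits. -/
theorem push_apply (hS : IsOrbitFunctor S) (A : X.QuotCat) (φ : Fiber S →₀ ℂ) (y : Fiber S) :
    push S A φ (S.map (proj A) y) = ∑ᶠ γ : A.Γ, φ ((γ : G) • y) := by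
  classical
  induction φ using Finsupp.induction_linear with
  | zero => simp
  | add φ ψ h1 h2 =>
    rw [map_add, Finsupp.add_apply, h1, h2]
    exact (finsum_add_distrib (hS.finite_support A φ y) (hS.finite_support A ψ y)).symm
  | single x c =>
    rw [push_single, Finsupp.single_apply]
    split_ifs with h
    · obtain ⟨γ, hγ, hγy⟩ := (hS.proj_eq_iff A y x).1 h.symm
      rw [finsum_eq_single _ (⟨γ, hγ⟩ : A.Γ)]
      · simp [hγy]
      · intro δ hδ
        rw [Finsupp.single_apply, if_neg]
        intro e
        exact hδ (hS.smul_injective A y (e.symm.trans hγy.symm))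
    · rw [← finsum_zero (α := A.Γ) (M := ℂ)]
      refine finsum_congr fun γ => ?_
      rw [Finsupp.single_apply, if_neg]
      intro e
      refine h ?_
      rw [e, map_proj_smul_of_mem γ.2]

theorem push_surjective (hS : IsOrbitFunctor S) (A : X.QuotCat) :
    Function.Surjective (push S A) :=
  Finsupp.mapDomain_surjective (hS.proj_surjective A)

/-- The operator on the finitely supported functions on `S(Γ \ X)` induced by an operator on those
on `S(X)` that commutes with `G`. -/
def descend (hS : IsOrbitFunctor S) (L : (Fiber S →₀ ℂ) →ₗ[ℂ] (Fiber S →₀ ℂ)) (A : X.QuotCat) :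
    (S.obj A →₀ ℂ) →ₗ[ℂ] (S.obj A →₀ ℂ) :=
  Finsupp.linearCombination ℂ fun s =>
    push S A (L (Finsupp.single (hS.proj_surjective A s).choose 1))

variable {L L' : (Fiber S →₀ ℂ) →ₗ[ℂ] (Fiber S →₀ ℂ)}

theorem descend_push (hS : IsOrbitFunctor S) (hL : ∀ (g : G) φ, L (shift g φ) = shift g (L φ))
    (A : X.QuotCat) (φ : Fiber S →₀ ℂ) : hS.descend L A (push S A φ) = push S A (L φ) := by
  suffices hS.descend L A ∘ₗ push S A = push S A ∘ₗ L from LinearMap.congr_fun this φ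
  refine Finsupp.lhom_ext' fun x => LinearMap.ext_ring ?_
  simp only [LinearMap.comp_apply, Finsupp.lsingle_apply]
  rw [push_single, descend, Finsupp.linearCombination_single, one_smul]
  obtain ⟨γ, hγ, h⟩ := (hS.proj_eq_iff A x _).1
    (hS.proj_surjective A (S.map (proj A) x)).choose_spec.symm
  rw [← h, ← shift_single, hL, push_shift_of_mem hγ]

theorem descend_base (hS : IsOrbitFunctor S) (hL : ∀ (g : G) φ, L (shift g φ) = shift g (L φ))
    (φ : Fiber S →₀ ℂ) : hS.descend L (base X) φ = L φ := by
  have := hS.descend_push hL (base X) φ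
  rwa [push_base, push_base] at this

theorem descend_natural (hS : IsOrbitFunctor S) (hL : ∀ (g : G) φ, L (shift g φ) = shift g (L φ))
    {A B : X.QuotCat} (f : A ⟶ B) (φ : S.obj A →₀ ℂ) :
    hS.descend L B (Finsupp.lmapDomain ℂ ℂ (fun y => S.map f y) φ) =
      Finsupp.lmapDomain ℂ ℂ (fun y => S.map f y) (hS.descend L A φ) := by
  obtain ⟨φ, rfl⟩ := hS.push_surjective A φ
  obtain ⟨g, hg⟩ := exists_map_push (S := S) f
  rw [hg, hS.descend_push hL, hS.descend_push hL, hL, hg]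

theorem finInner_descend (hS : IsOrbitFunctor S) (hL : ∀ (g : G) φ, L (shift g φ) = shift g (L φ))
    (hL' : ∀ (g : G) φ, L' (shift g φ) = shift g (L' φ))
    (h : ∀ x y, L' (Finsupp.single x 1) y = starRingEnd ℂ (L (Finsupp.single y 1) x))
    (A : X.QuotCat) (φ ψ : S.obj A →₀ ℂ) :
    finInner (hS.descend L A φ) ψ = finInner φ (hS.descend L' A ψ) := by
  refine finInner_eq_of_single (fun s r => ?_) φ ψ
  obtain ⟨x, rfl⟩ := hS.proj_surjective A s
  obtain ⟨y, rfl⟩ := hS.proj_surjective A r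
  change hS.descend L' A (Finsupp.single (S.map (proj A) x) 1) (S.map (proj A) y) =
    starRingEnd ℂ (hS.descend L A (Finsupp.single (S.map (proj A) y) 1) (S.map (proj A) x))
  rw [← push_single, ← push_single, hS.descend_push hL, hS.descend_push hL', hS.push_apply,
    hS.push_apply]
  have e := (starRingEnd ℂ).toAddMonoidHom.map_finsum
    (hS.finite_support A (L (Finsupp.single y 1)) x)
  refine Eq.trans ?_ e.symm
  rw [← finsum_comp_equiv (Equiv.inv A.Γ)]
  refine finsum_congr fun γ => ?_
  change L' (Finsupp.single x 1) (((γ⁻¹ : A.Γ) : G) • y) =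
    starRingEnd ℂ (L (Finsupp.single y 1) ((γ : G) • x))
  rw [h, ← shift_apply (γ : G)⁻¹ (L (Finsupp.single y 1)), ← hL, shift_single, inv_smul_smul]
  rfl

end IsOrbitFunctor

end Descend

/-! ### The algebra of `F` as an algebra of invariant kernels -/

namespace Summand

open GComplex GComplex.QuotCat

section

variable {G : Type u} {V : Type v} [Group G] [TopologicalSpace G] [MulAction G V]
  {X : GComplex G V} {S : X.QuotCat ⥤ Type u} {F : X.QuotCat ⥤ PHil.{u}} (M : Summand S F)

theorem inner_ι (A : X.QuotCat) (v : (F.obj A).carrier) (φ : S.obj A →₀ ℂ) :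
    inner ℂ v (M.p A φ) = starRingEnd ℂ (finInner φ (M.ι A v)) := by
  rw [← inner_conj_symm, M.inner_p]

theorem conj_finInner {Y : Type u} (φ ψ : Y →₀ ℂ) :
    starRingEnd ℂ (finInner φ ψ) = finInner ψ φ := by
  induction φ using Finsupp.induction_linear with
  | zero => simp [finInner]
  | add φ φ' h1 h2 => rw [finInner_add_left, finInner_add_right, map_add, h1, h2]
  | single y c =>
    have : Finsupp.single y c = c • Finsupp.single y (1 : ℂ) := by simp
    rw [this, finInner_smul_left, finInner_smul_right, finInner_single_left,
      finInner_single_right, map_mul, Complex.conj_conj]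

theorem inner_eq (A : X.QuotCat) (v w : (F.obj A).carrier) :
    inner ℂ v w = finInner (M.ι A v) (M.ι A w) := by
  rw [← M.inner_p, M.p_ι]

/-- The embedding `ι` at the object `X`. -/
def ιX : (F.obj (base X)).carrier →ₗ[ℂ] (Fiber S →₀ ℂ) := M.ι (base X)

/-- The projection `p` at the object `X`. -/
def pX : (Fiber S →₀ ℂ) →ₗ[ℂ] (F.obj (base X)).carrier := M.p (base X)

theorem pX_ιX (v : (F.obj (base X)).carrier) : M.pX (M.ιX v) = v := M.p_ι _ v

theorem inner_pX (v : (F.obj (base X)).carrier) (φ : Fiber S →₀ ℂ) :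
    inner ℂ (M.pX φ) v = finInner φ (M.ιX v) := M.inner_p _ v φ

theorem inner_ιX (v : (F.obj (base X)).carrier) (φ : Fiber S →₀ ℂ) :
    inner ℂ v (M.pX φ) = finInner (M.ιX v) φ := by
  rw [← inner_conj_symm, inner_pX, conj_finInner]

/-- The operator on the finitely supported functions on `S(X)` by which an element of the algebra
acts. -/
def op (a : opAlgebra F) : (Fiber S →₀ ℂ) →ₗ[ℂ] (Fiber S →₀ ℂ) :=
  M.ιX ∘ₗ a.1 (base X) ∘ₗ M.pX

theorem op_apply (a : opAlgebra F) (φ : Fiber S →₀ ℂ) :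
    M.op a φ = M.ιX (a.1 (base X) (M.pX φ)) := rfl

theorem op_one (φ : Fiber S →₀ ℂ) : M.op 1 φ = M.ιX (M.pX φ) := rfl

theorem op_mul (a b : opAlgebra F) : M.op (a * b) = M.op a ∘ₗ M.op b := by
  refine LinearMap.ext fun φ => ?_
  rw [LinearMap.comp_apply, op_apply, op_apply, op_apply, pX_ιX]
  rfl

theorem op_add (a b : opAlgebra F) : M.op (a + b) = M.op a + M.op b := by
  refine LinearMap.ext fun φ => ?_
  rw [LinearMap.add_apply, op_apply, op_apply, op_apply, ← map_add]
  rfl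

theorem op_smul (c : ℂ) (a : opAlgebra F) : M.op (c • a) = c • M.op a := by
  refine LinearMap.ext fun φ => ?_
  rw [LinearMap.smul_apply, op_apply, op_apply, ← map_smul]
  rfl

theorem ιX_shift (g : G) (v : (F.obj (base X)).carrier) :
    M.ιX (PHil.lin (F.map (act X g)) v) = shift g (M.ιX v) :=
  M.ι_natural _ v

theorem pX_shift (g : G) (φ : Fiber S →₀ ℂ) :
    M.pX (shift g φ) = PHil.lin (F.map (act X g)) (M.pX φ) :=
  M.p_natural _ φ

theorem op_shift (a : opAlgebra F) (g : G) (φ : Fiber S →₀ ℂ) :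
    M.op a (shift g φ) = shift g (M.op a φ) := by
  rw [op_apply, pX_shift, a.2.1 (act X g), ιX_shift, op_apply]

theorem finInner_op (a : opAlgebra F) (φ ψ : Fiber S →₀ ℂ) :
    finInner (M.op a φ) ψ = finInner φ (M.op (star a) ψ) := by
  have h1 := inner_star a (base X) (M.pX φ) (M.pX ψ)
  rw [inner_pX, inner_ιX] at h1
  exact h1

theorem op_star (a : opAlgebra F) (x y : Fiber S) :
    M.op (star a) (Finsupp.single x 1) y = starRingEnd ℂ (M.op a (Finsupp.single y 1) x) := by
  rw [← finInner_single_left, ← finInner_op, finInner_single_right]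

variable {L L' : (Fiber S →₀ ℂ) →ₗ[ℂ] (Fiber S →₀ ℂ)}

/-- The element of the algebra given by a `G`-equivariant operator `L` with adjoint `L'` on the
finitely supported functions on `S(X)`. -/
def ofOp (hS : IsOrbitFunctor S) (hL : ∀ (g : G) φ, L (shift g φ) = shift g (L φ))
    (hL' : ∀ (g : G) φ, L' (shift g φ) = shift g (L' φ))
    (h : ∀ x y, L' (Finsupp.single x 1) y = starRingEnd ℂ (L (Finsupp.single y 1) x)) :
    opAlgebra F :=
  ⟨fun A => M.p A ∘ₗ hS.descend L A ∘ₗ M.ι A, fun A B f v => by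
      change M.p B (hS.descend L B (M.ι B _)) =
        PHil.lin (F.map f) (M.p A (hS.descend L A (M.ι A v)))
      rw [M.ι_natural, hS.descend_natural hL, M.p_natural],
    fun A => M.p A ∘ₗ hS.descend L' A ∘ₗ M.ι A, fun A B f v => by
      change M.p B (hS.descend L' B (M.ι B _)) =
        PHil.lin (F.map f) (M.p A (hS.descend L' A (M.ι A v)))
      rw [M.ι_natural, hS.descend_natural hL', M.p_natural],
    fun A v w => by
      change inner ℂ (M.p A (hS.descend L A (M.ι A v))) w =
        inner ℂ v (M.p A (hS.descend L' A (M.ι A w)))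
      rw [M.inner_p, M.inner_ι, conj_finInner, hS.finInner_descend hL hL' h]⟩

theorem op_ofOp (hS : IsOrbitFunctor S) (hL : ∀ (g : G) φ, L (shift g φ) = shift g (L φ))
    (hL' : ∀ (g : G) φ, L' (shift g φ) = shift g (L' φ))
    (h : ∀ x y, L' (Finsupp.single x 1) y = starRingEnd ℂ (L (Finsupp.single y 1) x)) :
    M.op (M.ofOp hS hL hL' h) = M.op 1 ∘ₗ L ∘ₗ M.op 1 := by
  refine LinearMap.ext fun φ => ?_
  exact congrArg (fun ψ => M.ιX (M.pX ψ)) (hS.descend_base hL (M.ιX (M.pX φ)))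

theorem star_ofOp (hS : IsOrbitFunctor S) (hL : ∀ (g : G) φ, L (shift g φ) = shift g (L φ))
    (hL' : ∀ (g : G) φ, L' (shift g φ) = shift g (L' φ))
    (h : ∀ x y, L' (Finsupp.single x 1) y = starRingEnd ℂ (L (Finsupp.single y 1) x))
    (h' : ∀ x y, L (Finsupp.single x 1) y = starRingEnd ℂ (L' (Finsupp.single y 1) x)) :
    star (M.ofOp hS hL hL' h) = M.ofOp hS hL' hL h' :=
  eq_opDual fun A v w => by
    change inner ℂ (M.p A (hS.descend L A (M.ι A v))) w =
      inner ℂ v (M.p A (hS.descend L' A (M.ι A w)))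
    rw [M.inner_p, M.inner_ι, conj_finInner, hS.finInner_descend hL hL' h]

end

section

variable {G : Type u} {V : Type v} [Group G] [TopologicalSpace G] [IsTopologicalGroup G]
  [MeasurableSpace G] [BorelSpace G] (μ : Measure G) [μ.IsHaarMeasure] [MulAction G V]
  {X : GComplex G V} {S : X.QuotCat ⥤ Type u} {F : X.QuotCat ⥤ PHil.{u}} (M : Summand S F)
  [CompactOpenStabilizers G (Fiber S)]

theorem conj_transport (y z : Fiber S) (x w : Fiber S) : transport μ z y (Finsupp.single x 1) w =
    starRingEnd ℂ (transport μ y z (Finsupp.single w 1) x) := by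
  rw [transport_symm, transport_single, transportRow_apply, Complex.conj_ofReal]

theorem conjOp_transport (y z : Fiber S) : conjOp (transport μ y z) = transport μ y z := by
  refine Finsupp.lhom_ext' fun u => LinearMap.ext_ring ?_
  simp only [LinearMap.comp_apply, Finsupp.lsingle_apply]
  ext v
  rw [conjOp_apply, conjF_single, conjF_apply, transport_single, transportRow_apply,
    Complex.conj_ofReal]

theorem conjOp_comp {Y : Type u} (L L' : (Y →₀ ℂ) →ₗ[ℂ] (Y →₀ ℂ)) :
    conjOp (L ∘ₗ L') = conjOp L ∘ₗ conjOp L' :=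
  LinearMap.ext fun φ => by
    simp only [conjOp_apply, LinearMap.comp_apply, conjF_conjF]

theorem conjOp_add {Y : Type u} (L L' : (Y →₀ ℂ) →ₗ[ℂ] (Y →₀ ℂ)) :
    conjOp (L + L') = conjOp L + conjOp L' :=
  LinearMap.ext fun φ => by
    simp only [conjOp_apply, LinearMap.add_apply, conjF_add]

theorem conjOp_smul {Y : Type u} (c : ℂ) (L : (Y →₀ ℂ) →ₗ[ℂ] (Y →₀ ℂ)) :
    conjOp (c • L) = starRingEnd ℂ c • conjOp L :=
  LinearMap.ext fun φ => by
    simp only [conjOp_apply, LinearMap.smul_apply, conjF_smul]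

theorem conjOp_shift (L : (Fiber S →₀ ℂ) →ₗ[ℂ] (Fiber S →₀ ℂ))
    (hL : ∀ (g : G) φ, L (shift g φ) = shift g (L φ)) (g : G) (φ : Fiber S →₀ ℂ) :
    conjOp L (shift g φ) = shift g (conjOp L φ) := by
  rw [conjOp_apply, conjF_shift, hL, conjF_shift, conjOp_apply]

theorem conjOp_single_apply {Y : Type u} (L : (Y →₀ ℂ) →ₗ[ℂ] (Y →₀ ℂ)) (x y : Y) :
    conjOp L (Finsupp.single x 1) y = starRingEnd ℂ (L (Finsupp.single x 1) y) := by
  rw [conjOp_apply, conjF_single, conjF_apply]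

/-- The element of the algebra given by the kernel `transport μ z y`. -/
def transportOp (hS : IsOrbitFunctor S) (y z : Fiber S) : opAlgebra F :=
  M.ofOp hS (transport_shift μ z y) (transport_shift μ y z) (conj_transport μ z y)

theorem op_star_transportOp (hS : IsOrbitFunctor S) (y z : Fiber S) :
    M.op (star (M.transportOp μ hS y z)) = M.op 1 ∘ₗ transport μ y z ∘ₗ M.op 1 := by
  rw [transportOp, star_ofOp _ _ _ _ _ (conj_transport μ y z), op_ofOp]

/-- The action of the algebra of `F` by invariant kernels on `S(X)`. Since this is to be an action
from the right, the kernels are transposed: the transpose of `M.op a` is the complex conjugate of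
its adjoint `M.op (star a)`. -/
def kernelAlgebra (hS : IsOrbitFunctor S) : KernelAlgebra μ (opAlgebra F) (Fiber S) where
  Ψ :=
    { toFun := fun a => conjOp (M.op (star a))
      map_add' := fun a b => by rw [star_add, op_add, conjOp_add]
      map_smul' := fun c a => by
        rw [star_smul, op_smul, conjOp_smul, RingHom.id_apply, starRingEnd_apply, star_star] }
  Ψ_mul a b := by
    change conjOp (M.op (star (a * b))) = conjOp (M.op (star b)) ∘ₗ conjOp (M.op (star a))
    rw [star_mul, op_mul, conjOp_comp]
  Ψ_shift a g φ := conjOp_shift _ (M.op_shift (star a)) g φ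
  Ψ_star a x y := by
    change conjOp (M.op (star (star a))) _ _ = starRingEnd ℂ (conjOp (M.op (star a)) _ _)
    rw [conjOp_single_apply, conjOp_single_apply, op_star]
  τ y z := M.transportOp μ hS y z
  Ψ_τ y z := by
    change conjOp (M.op (star (M.transportOp μ hS y z))) = conjOp (M.op (star 1)) ∘ₗ _ ∘ₗ
      conjOp (M.op (star 1))
    rw [op_star_transportOp, conjOp_comp, conjOp_comp, star_one, conjOp_transport]

theorem Ψ_kernelAlgebra (hS : IsOrbitFunctor S) (a : opAlgebra F) :
    (M.kernelAlgebra μ hS).Ψ a = conjOp (M.op (star a)) := rfl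

end

end Summand

/-! ### Elementary functors and their summands -/

section Existence

open GComplex GComplex.QuotCat

variable {G : Type u} {V : Type v} [Group G] [TopologicalSpace G] [MulAction G V]
  {X : GComplex G V} {S : X.QuotCat ⥤ Type u} {F F' : X.QuotCat ⥤ PHil.{u}}

theorem ElementaryBy.isOrbitFunctor (h : ElementaryBy S F) : IsOrbitFunctor S :=
  ⟨h.stabilizer_le, h.proj_surjective, h.proj_eq_iff⟩

theorem ElementaryBy.compactOpenStabilizers (h : ElementaryBy S F) :
    CompactOpenStabilizers G (Fiber S) :=
  ⟨h.isOpen_stabilizer, h.isCompact_stabilizer⟩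

theorem ElementaryBy.exists_summand (h : ElementaryBy S F) :
    ∃ M : Summand S F, ∀ A φ, M.ι A (M.p A φ) = φ := by
  obtain ⟨η, hη⟩ := h.exists_iso
  have h1 : ∀ A (φ : FinL2 (S.obj A)), PHil.lin (η.inv.app A) (PHil.lin (η.hom.app A) φ) = φ :=
    fun A φ => congrArg (fun f => PHil.lin f φ) (Iso.hom_inv_id_app η A)
  have h2 : ∀ A (v : (F.obj A).carrier), PHil.lin (η.hom.app A) (PHil.lin (η.inv.app A) v) = v :=
    fun A v => congrArg (fun f => PHil.lin f v) (Iso.inv_hom_id_app η A)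
  refine ⟨⟨fun A => PHil.lin (η.inv.app A), fun A => PHil.lin (η.hom.app A), fun {A B} f v => ?_,
    fun {A B} f φ => ?_, fun A v φ => ?_, h2⟩, h1⟩
  · exact congrArg (fun f => PHil.lin f v) (η.inv.naturality f)
  · exact congrArg (fun f => PHil.lin f φ) (η.hom.naturality f)
  · conv_lhs => rw [← h2 A v]
    exact hη A φ _

/-- A direct summand of a direct summand. -/
def Summand.fst (M : Summand S (directSum F F')) : Summand S F where
  ι A := M.ι A ∘ₗ (WithLp.linearEquiv 2 ℂ ((F.obj A).carrier × (F'.obj A).carrier)).symm.toLinearMap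
    ∘ₗ LinearMap.inl ℂ _ _
  p A := LinearMap.fst ℂ _ _ ∘ₗ
    (WithLp.linearEquiv 2 ℂ ((F.obj A).carrier × (F'.obj A).carrier)).toLinearMap ∘ₗ M.p A
  ι_natural {A B} f v := by
    refine Eq.trans ?_ (M.ι_natural f (WithLp.toLp 2 (v, 0)))
    refine congrArg (M.ι B) ?_
    change WithLp.toLp 2 (PHil.lin (F.map f) v, (0 : (F'.obj B).carrier)) =
      WithLp.toLp 2 (PHil.lin (F.map f) v, PHil.lin (F'.map f) 0)
    rw [map_zero]
  p_natural {A B} f φ := by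
    change (M.p B _).fst = PHil.lin (F.map f) (M.p A φ).fst
    rw [M.p_natural]
    rfl
  inner_p A v φ := by
    refine Eq.trans ?_ (M.inner_p A (WithLp.toLp 2 (v, 0)) φ)
    refine Eq.trans ?_ (WithLp.prod_inner_apply (𝕜 := ℂ) (M.p A φ) (WithLp.toLp 2 (v, 0))).symm
    simp
    rfl
  p_ι A v := congrArg WithLp.fst (M.p_ι A (WithLp.toLp 2 (v, 0)))

theorem exists_orbitReps {Ω : Type u} [MulAction G Ω]
    (h : Finite (MulAction.orbitRel.Quotient G Ω)) : ∃ t, Nonempty (OrbitReps G Ω t) := by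
  obtain ⟨t, ⟨e⟩⟩ := Finite.exists_equiv_fin (MulAction.orbitRel.Quotient G Ω)
  refine ⟨t, ⟨⟨fun n => (e.symm n).out, fun y => ⟨e (Quotient.mk'' y), ?_, fun n hn => ?_⟩⟩⟩⟩
  · change y ∈ MulAction.orbit G (Quotient.out _)
    rw [e.symm_apply_apply, ← MulAction.orbitRel_apply]
    exact Setoid.symm' _ (Quotient.mk_out (s := MulAction.orbitRel G Ω) y)
  · rw [← e.symm_apply_eq, ← Quotient.out_eq (e.symm n)]
    exact Quotient.sound' (Setoid.symm' _ hn)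

end Existence

namespace Summand

open GComplex GComplex.QuotCat

variable {G : Type u} {V : Type v} [Group G] [TopologicalSpace G] [MulAction G V]
  {X : GComplex G V} {S : X.QuotCat ⥤ Type u} {F : X.QuotCat ⥤ PHil.{u}} (M : Summand S F)

/-- The operator on the finitely supported functions on `S(Γ \ X)` by which an element of the
algebra acts. -/
def opAt (A : X.QuotCat) (a : opAlgebra F) : (S.obj A →₀ ℂ) →ₗ[ℂ] (S.obj A →₀ ℂ) :=
  M.ι A ∘ₗ a.1 A ∘ₗ M.p A

theorem opAt_apply (A : X.QuotCat) (a : opAlgebra F) (φ : S.obj A →₀ ℂ) :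
    M.opAt A a φ = M.ι A (a.1 A (M.p A φ)) := rfl

theorem opAt_push (A : X.QuotCat) (a : opAlgebra F) (φ : Fiber S →₀ ℂ) :
    M.opAt A a (IsOrbitFunctor.push S A φ) = IsOrbitFunctor.push S A (M.op a φ) := by
  have h1 : M.p A (IsOrbitFunctor.push S A φ) = PHil.lin (F.map (proj A)) (M.pX φ) :=
    M.p_natural (proj A) φ
  have h2 : M.ι A (PHil.lin (F.map (proj A)) (a.1 (base X) (M.pX φ))) =
      IsOrbitFunctor.push S A (M.op a φ) := M.ι_natural (proj A) _
  rw [opAt_apply, h1, a.2.1 (proj A), h2]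

theorem finInner_opAt (A : X.QuotCat) (a : opAlgebra F) (φ ψ : S.obj A →₀ ℂ) :
    finInner (M.opAt A a φ) ψ = finInner φ (M.opAt A (star a) ψ) := by
  have h1 := inner_star a A (M.p A φ) (M.p A ψ)
  rw [M.inner_p, M.inner_ι, conj_finInner] at h1
  exact h1

theorem opAt_ι (A : X.QuotCat) (a : opAlgebra F) (v : (F.obj A).carrier) :
    M.opAt A a (M.ι A v) = M.ι A (a.1 A v) := by
  rw [opAt_apply, M.p_ι]

end Summand

/-! ### Fixed vectors of `L²(Γ \ G)` -/

namespace RightCosets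

variable {G : Type u} [Group G] [TopologicalSpace G] [IsTopologicalGroup G]
  [SecondCountableTopology G] [MeasurableSpace G] [BorelSpace G]
  {Γ : Subgroup G}

theorem continuous_of_invariant {Y : Type*} [TopologicalSpace Y] {K : Subgroup G}
    (hK : IsOpen (K : Set G)) {f : RightCosets Γ → Y}
    (hf : ∀ k ∈ K, ∀ q, f (mulRight Γ k q) = f q) : Continuous f := by
  rw [← (isOpenQuotientMap_mk Γ).continuous_comp_iff, continuous_iff_continuousAt]
  intro x
  have hx : (fun y => x⁻¹ * y) ⁻¹' (K : Set G) ∈ 𝓝 x :=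
    (hK.preimage (continuous_const_mul x⁻¹)).mem_nhds (by simp [K.one_mem])
  refine continuousAt_const.congr (f := fun _ => f (mk Γ x)) ?_
  filter_upwards [hx] with y hy
  have := hf _ hy (mk Γ x)
  rw [mulRight_mk, mul_inv_cancel_left] at this
  exact this.symm

variable [T2Space G] [LocallyCompactSpace G] [DiscreteTopology Γ] (μ : Measure G) [μ.IsHaarMeasure]
  [μ.IsMulRightInvariant]

/-- A function representing a vector of `L²(Γ \ G)`. -/
def toFn (φ : (UnitaryRep.L2RightCosets Γ μ).carrier) : RightCosets Γ → ℂ :=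
  let φ' : Lp ℂ 2 (measure Γ μ) := φ
  φ'

theorem coeFn_π (g : G) (φ : (UnitaryRep.L2RightCosets Γ μ).carrier) :
    toFn μ ((UnitaryRep.L2RightCosets Γ μ).π g φ) =ᵐ[measure Γ μ] toFn μ φ ∘ mulRight Γ g :=
  let φ' : Lp ℂ 2 (measure Γ μ) := φ
  Lp.coeFn_compMeasurePreserving φ' (measurePreserving_mulRight Γ μ g)

/-- A vector of `L²(Γ \ G)` fixed by a compact open subgroup `K` has a representative that is
invariant under `K` everywhere: average an arbitrary representative over the `K`-orbits. -/
theorem exists_invariant {K : Subgroup G} (hK : IsOpen (K : Set G)) (hKc : IsCompact (K : Set G))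
    {φ : (UnitaryRep.L2RightCosets Γ μ).carrier} (hφ : φ ∈ (UnitaryRep.L2RightCosets Γ μ).fixed K) :
    ∃ f : RightCosets Γ → ℂ, (∀ k ∈ K, ∀ q, f (mulRight Γ k q) = f q) ∧
      toFn μ φ =ᵐ[measure Γ μ] f := by
  set ν := measure Γ μ
  set f₀ : RightCosets Γ → ℂ := toFn μ φ
  have hsm : StronglyMeasurable f₀ :=
    let φ' : Lp ℂ 2 ν := φ
    Lp.stronglyMeasurable φ'
  have hcont : Continuous fun p : RightCosets Γ × G => mulRight Γ p.2 p.1 :=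
    (continuous_mulRight Γ).comp continuous_swap
  have hmeas : MeasurableSet
      {p : RightCosets Γ × G | p.2 ∈ K → f₀ (mulRight Γ p.2 p.1) = f₀ p.1} := by
    have h1 : MeasurableSet {p : RightCosets Γ × G | p.2 ∈ K} :=
      measurable_snd hK.measurableSet
    have h2 : MeasurableSet {p : RightCosets Γ × G | f₀ (mulRight Γ p.2 p.1) = f₀ p.1} :=
      measurableSet_eq_fun (hsm.measurable.comp hcont.measurable)
        (hsm.measurable.comp measurable_fst)
    have e : {p : RightCosets Γ × G | p.2 ∈ K → f₀ (mulRight Γ p.2 p.1) = f₀ p.1} =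
        {p | p.2 ∈ K}ᶜ ∪ {p | f₀ (mulRight Γ p.2 p.1) = f₀ p.1} := by
      ext p
      exact imp_iff_not_or
    rw [e]
    exact h1.compl.union h2
  -- Fubini: almost every `q` satisfies `f₀ (q k) = f₀ q` for almost all `k` in `K`
  have hae : ∀ᵐ q ∂ν, ∀ᵐ k ∂μ, k ∈ K → f₀ (mulRight Γ k q) = f₀ q := by
    rw [Measure.ae_ae_comm hmeas]
    refine Filter.Eventually.of_forall fun k => ?_
    by_cases hk : k ∈ K
    · have h := coeFn_π μ k φ
      rw [hφ k hk] at h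
      filter_upwards [h] with q hq _
      exact hq.symm
    · exact Filter.Eventually.of_forall fun q h => absurd h hk
  have hpos : μ.real (K : Set G) ≠ 0 := by
    rw [Measure.real, ENNReal.toReal_ne_zero]
    exact ⟨(hK.measure_pos μ ⟨1, K.one_mem⟩).ne', hKc.measure_lt_top.ne⟩
  refine ⟨fun q => ((μ.real (K : Set G))⁻¹ : ℝ) • ∫ k in (K : Set G), f₀ (mulRight Γ k q) ∂μ,
    fun k hk q => ?_, ?_⟩
  · refine congrArg _ ?_
    rw [← integral_indicator hK.measurableSet, ← integral_indicator hK.measurableSet]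
    rw [← integral_mul_left_eq_self ((K : Set G).indicator fun k => f₀ (mulRight Γ k q)) k]
    refine integral_congr_ae (Filter.Eventually.of_forall fun h => ?_)
    by_cases hh : h ∈ K
    · change (K : Set G).indicator (fun j => f₀ (mulRight Γ j (mulRight Γ k q))) h =
        (K : Set G).indicator (fun j => f₀ (mulRight Γ j q)) (k * h)
      rw [Set.indicator_of_mem (show h ∈ (K : Set G) from hh),
        Set.indicator_of_mem (show k * h ∈ (K : Set G) from K.mul_mem hk hh)]
      obtain ⟨x, rfl⟩ := mk_surjective Γ q
      rw [mulRight_mk, mulRight_mk, mulRight_mk, mul_assoc]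
    · change (K : Set G).indicator (fun j => f₀ (mulRight Γ j (mulRight Γ k q))) h =
        (K : Set G).indicator (fun j => f₀ (mulRight Γ j q)) (k * h)
      rw [Set.indicator_of_notMem (show h ∉ (K : Set G) from hh),
        Set.indicator_of_notMem (show k * h ∉ (K : Set G) from
          fun h' => hh ((K.mul_mem_cancel_left hk).1 h'))]
  · filter_upwards [hae] with q hq
    have : ∫ k in (K : Set G), f₀ (mulRight Γ k q) ∂μ = ∫ k in (K : Set G), f₀ q ∂μ :=
      setIntegral_congr_ae hK.measurableSet hq
    change f₀ q = _
    rw [this, setIntegral_const, inv_smul_smul₀ hpos]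

/-- If the translates `γ B` of an open set `B` are disjoint, then the image of `B` in `Γ \ G` has
the measure of `B`. -/
theorem measure_image {B : Set G} (hB : IsOpen B)
    (hd : ∀ γ ∈ Γ, ∀ g ∈ B, γ * g ∈ B → γ = 1) :
    measure Γ μ (mk Γ '' B) = μ B := by
  have hm : MeasurableSet (mk Γ '' B) := ((isOpenQuotientMap_mk Γ).isOpenMap B hB).measurableSet
  have h := lintegral_measure Γ μ (B.indicator 1) ((mk Γ '' B).indicator 1)
    (measurable_one.indicator hm) (fun x => ?_) (measurable_one.indicator hB.measurableSet)
  · rwa [lintegral_indicator_one hm, lintegral_indicator_one hB.measurableSet] at h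
  · by_cases hx : mk Γ x ∈ mk Γ '' B
    · obtain ⟨b, hb, hbx⟩ := hx
      have hγ : b * x⁻¹ ∈ Γ := mk_eq_mk.1 hbx.symm
      rw [Set.indicator_of_mem (show mk Γ x ∈ mk Γ '' B from ⟨b, hb, hbx⟩),
        tsum_eq_single (⟨b * x⁻¹, hγ⟩ : Γ)]
      · rw [Set.indicator_of_mem]
        · rfl
        · simpa using hb
      · intro δ hδ
        refine Set.indicator_of_notMem (fun hδx => hδ ?_) _
        have := hd ((δ : G) * (b * x⁻¹)⁻¹) (Γ.mul_mem δ.2 (Γ.inv_mem hγ)) b hb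
          (by simpa [mul_assoc] using hδx)
        exact Subtype.ext (mul_inv_eq_one.1 this)
    · rw [Set.indicator_of_notMem hx]
      refine (ENNReal.tsum_eq_zero.2 fun γ => ?_).symm
      refine Set.indicator_of_notMem (fun h => hx ⟨_, h, ?_⟩) _
      rw [mk_eq_mk]
      simp

end RightCosets

/-! ### Comparison of `F(Γ \ X)` with `L²(Γ \ G)` -/

namespace IsOrbitFunctor

open GComplex GComplex.QuotCat

section

variable {G : Type u} {V : Type v} [Group G] [TopologicalSpace G] [MulAction G V]
  {X : GComplex G V} {S : X.QuotCat ⥤ Type u}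

/-- The map `Γ g ↦ Γ g x` from `Γ \ G` to `S(Γ \ X)`. -/
def evalAt (A : X.QuotCat) (x : Fiber S) : RightCosets A.Γ → S.obj A :=
  Quotient.lift (fun g : G => S.map (proj A) (g • x)) fun a b h => by
    have hγ : b * a⁻¹ ∈ A.Γ := QuotientGroup.rightRel_apply.1 h
    change S.map (proj A) (a • x) = S.map (proj A) (b • x)
    rw [← map_proj_smul_of_mem hγ (a • x), ← mul_smul, inv_mul_cancel_right]

theorem evalAt_mk (A : X.QuotCat) (x : Fiber S) (g : G) :
    evalAt A x (RightCosets.mk A.Γ g) = S.map (proj A) (g • x) := rfl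

theorem evalAt_smul (A : X.QuotCat) (x : Fiber S) (g : G) (q : RightCosets A.Γ) :
    evalAt A (g • x) q = evalAt A x (RightCosets.mulRight A.Γ g q) := by
  obtain ⟨h, rfl⟩ := RightCosets.mk_surjective A.Γ q
  rw [RightCosets.mulRight_mk, evalAt_mk, evalAt_mk, mul_smul]

theorem evalAt_preimage (hS : IsOrbitFunctor S) (A : X.QuotCat) (x : Fiber S) (h : G) :
    evalAt A x ⁻¹' {S.map (proj A) (h • x)} = RightCosets.mk A.Γ '' {g | g • x = h • x} := by
  ext q
  obtain ⟨g, rfl⟩ := RightCosets.mk_surjective A.Γ q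
  simp only [Set.mem_preimage, Set.mem_singleton_iff, evalAt_mk, Set.mem_image, Set.mem_ofPred_eq,
    RightCosets.mk_eq_mk]
  rw [hS.proj_eq_iff]
  constructor
  · rintro ⟨γ, hγ, e⟩
    refine ⟨γ * g, by rw [mul_smul, e], ?_⟩
    have := A.Γ.inv_mem hγ
    simpa using this
  · rintro ⟨g', e, hγ⟩
    refine ⟨g' * g⁻¹, ?_, by rw [← e, ← mul_smul, inv_mul_cancel_right]⟩
    simpa using A.Γ.inv_mem hγ

end

variable {G : Type u} {V : Type v} [Group G] [TopologicalSpace G] [IsTopologicalGroup G]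
  [LocallyCompactSpace G] [T2Space G] [SecondCountableTopology G] [MeasurableSpace G]
  [BorelSpace G] (μ : Measure G) [μ.IsHaarMeasure] [μ.IsMulRightInvariant] [MulAction G V]
  {X : GComplex G V} {S : X.QuotCat ⥤ Type u} {F : X.QuotCat ⥤ PHil.{u}}
  [CompactOpenStabilizers G (Fiber S)]
  (A : X.QuotCat) [DiscreteTopology A.Γ]

theorem measure_evalAt_preimage (hS : IsOrbitFunctor S) (x : Fiber S) (h : G) :
    RightCosets.measure A.Γ μ (evalAt A x ⁻¹' {S.map (proj A) (h • x)}) =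
      μ (MulAction.stabilizer G x : Set G) := by
  rw [hS.evalAt_preimage, RightCosets.measure_image μ (isOpen_setOf_smul_eq G x _)]
  · rw [setOf_smul_eq_smul, measure_preimage_mul]
  · intro γ hγ g hg hγg
    change (γ * g) • x = h • x at hγg
    change g • x = h • x at hg
    rw [mul_smul, hg] at hγg
    exact hS.eq_one hγ hγg

theorem isOpen_evalAt_preimage (hS : IsOrbitFunctor S) (x : Fiber S) (s : S.obj A) :
    IsOpen (evalAt A x ⁻¹' {s}) := by
  by_cases hs : ∃ h : G, S.map (proj A) (h • x) = s
  · obtain ⟨h, rfl⟩ := hs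
    rw [hS.evalAt_preimage]
    exact (RightCosets.isOpenQuotientMap_mk A.Γ).isOpenMap _ (isOpen_setOf_smul_eq G x _)
  · convert isOpen_empty
    ext q
    obtain ⟨g, rfl⟩ := RightCosets.mk_surjective A.Γ q
    exact iff_of_false (fun h => hs ⟨g, h⟩) id

theorem measure_evalAt_preimage_ne_top (hS : IsOrbitFunctor S) (x : Fiber S) (s : S.obj A) :
    RightCosets.measure A.Γ μ (evalAt A x ⁻¹' {s}) ≠ ⊤ := by
  by_cases hs : ∃ h : G, S.map (proj A) (h • x) = s
  · obtain ⟨h, rfl⟩ := hs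
    rw [measure_evalAt_preimage μ A hS]
    exact (CompactOpenStabilizers.isCompact x).measure_lt_top.ne
  · have : evalAt A x ⁻¹' {s} = ∅ := by
      ext q
      obtain ⟨g, rfl⟩ := RightCosets.mk_surjective A.Γ q
      exact iff_of_false (fun h => hs ⟨g, h⟩) id
    rw [this, measure_empty]
    exact ENNReal.zero_ne_top

theorem single_comp_evalAt (x : Fiber S) (s : S.obj A) (c : ℂ) :
    (fun q => Finsupp.single s c (evalAt A x q)) =
      (evalAt A x ⁻¹' {s}).indicator fun _ => c := by
  classical
  funext q
  rw [Finsupp.single_apply]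
  split_ifs with h
  · rw [Set.indicator_of_mem]
    exact h.symm
  · rw [Set.indicator_of_notMem]
    exact fun h' => h h'.symm

theorem memLp_comp_evalAt (hS : IsOrbitFunctor S) (x : Fiber S) (ψ : S.obj A →₀ ℂ) :
    MemLp (fun q => ψ (evalAt A x q)) 2 (RightCosets.measure A.Γ μ) := by
  induction ψ using Finsupp.induction_linear with
  | zero => exact MemLp.zero
  | add φ ψ h1 h2 => exact h1.add h2
  | single s c =>
    rw [single_comp_evalAt]
    exact memLp_indicator_const 2 (hS.isOpen_evalAt_preimage A x s).measurableSet c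
      (Or.inr (hS.measure_evalAt_preimage_ne_top μ A x s))

/-- The family of functions `Γ g ↦ ψ(Γ g x)` in `L²(Γ \ G)` given by a finitely supported
function `ψ` on `S(Γ \ X)`. -/
def pull (hS : IsOrbitFunctor S) (x : Fiber S) :
    (S.obj A →₀ ℂ) →ₗ[ℂ] (UnitaryRep.L2RightCosets A.Γ μ).carrier where
  toFun ψ := (hS.memLp_comp_evalAt μ A x ψ).toLp _
  map_add' _ _ := rfl
  map_smul' _ _ := rfl

theorem toFn_pull (hS : IsOrbitFunctor S) (x : Fiber S) (ψ : S.obj A →₀ ℂ) :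
    RightCosets.toFn μ (hS.pull μ A x ψ) =ᵐ[RightCosets.measure A.Γ μ]
      fun q => ψ (evalAt A x q) :=
  (hS.memLp_comp_evalAt μ A x ψ).coeFn_toLp

theorem pull_smul (hS : IsOrbitFunctor S) (g : G) (x : Fiber S) (ψ : S.obj A →₀ ℂ) :
    hS.pull μ A (g • x) ψ = (UnitaryRep.L2RightCosets A.Γ μ).π g (hS.pull μ A x ψ) := by
  refine MemLp.toLp_congr (hS.memLp_comp_evalAt μ A (g • x) ψ)
    ((hS.memLp_comp_evalAt μ A x ψ).comp_measurePreserving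
    (RightCosets.measurePreserving_mulRight A.Γ μ g)) (Filter.Eventually.of_forall fun q => ?_)
  change ψ (evalAt A (g • x) q) = ψ (evalAt A x _)
  rw [evalAt_smul]

/-- The inner product with the characteristic function of a fiber of `Γ g ↦ Γ g x` is the integral
over the fiber. -/
theorem inner_pull_single (hS : IsOrbitFunctor S) (x : Fiber S) (s : S.obj A)
    (φ : (UnitaryRep.L2RightCosets A.Γ μ).carrier) {f : RightCosets A.Γ → ℂ} {c : ℂ}
    (hf : RightCosets.toFn μ φ =ᵐ[RightCosets.measure A.Γ μ] f)
    (hc : ∀ q, evalAt A x q = s → f q = c) :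
    inner ℂ (hS.pull μ A x (Finsupp.single s 1)) φ =
      ((RightCosets.measure A.Γ μ).real (evalAt A x ⁻¹' {s}) : ℂ) * c := by
  have hm := (hS.isOpen_evalAt_preimage A x s).measurableSet
  have e : hS.pull μ A x (Finsupp.single s 1) =
      indicatorConstLp 2 hm (hS.measure_evalAt_preimage_ne_top μ A x s) (1 : ℂ) := by
    refine MemLp.toLp_congr (hS.memLp_comp_evalAt μ A x _) _ ?_
    rw [single_comp_evalAt]
  rw [e]
  refine (L2.inner_indicatorConstLp_one hm (hS.measure_evalAt_preimage_ne_top μ A x s) _).trans ?_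
  have h1 : ∫ q in evalAt A x ⁻¹' {s}, RightCosets.toFn μ φ q ∂(RightCosets.measure A.Γ μ) =
      ∫ q in evalAt A x ⁻¹' {s}, c ∂(RightCosets.measure A.Γ μ) := by
    refine setIntegral_congr_ae hm ?_
    filter_upwards [hf] with q hq hqs
    rw [hq, hc q hqs]
  refine h1.trans ?_
  rw [setIntegral_const, Complex.real_smul]

/-- `pull` is isometric: the fiber of `Γ g ↦ Γ g rₙ` over `s` is empty unless `s` lies over the
orbit of `rₙ`, and then its measure is that of the stabilizer of `rₙ`. -/
theorem pairing_pull (hS : IsOrbitFunctor S) {t : ℕ} (R : OrbitReps G (Fiber S) t)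
    (φ ψ : S.obj A →₀ ℂ) :
    R.pairing μ (fun x => hS.pull μ A x φ) (fun x => hS.pull μ A x ψ) = finInner φ ψ := by
  induction φ using Finsupp.induction_linear with
  | zero => simp [OrbitReps.pairing, finInner]
  | add φ φ' h1 h2 =>
    rw [finInner_add_left, ← h1, ← h2]
    simp only [OrbitReps.pairing, map_add, inner_add_left, mul_add, Finset.sum_add_distrib]
  | single s c =>
    have hs : Finsupp.single s c = c • Finsupp.single s (1 : ℂ) := by simp
    have h1 : R.pairing μ (fun x => hS.pull μ A x (Finsupp.single s c))
        (fun x => hS.pull μ A x ψ) = starRingEnd ℂ c *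
        R.pairing μ (fun x => hS.pull μ A x (Finsupp.single s 1)) (fun x => hS.pull μ A x ψ) := by
      rw [hs]
      simp only [OrbitReps.pairing, map_smul, inner_smul_left, Finset.mul_sum]
      exact Finset.sum_congr rfl fun n _ => by ring
    rw [h1, hs, finInner_smul_left, finInner_single_left]
    congr 1
    obtain ⟨y, hy⟩ := hS.proj_surjective A s
    have hterm : ∀ n, inner ℂ (hS.pull μ A (R.rep n) (Finsupp.single s 1))
        (hS.pull μ A (R.rep n) ψ) =
        ((RightCosets.measure A.Γ μ).real (evalAt A (R.rep n) ⁻¹' {s}) : ℂ) * ψ s := fun n =>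
      hS.inner_pull_single μ A (R.rep n) s _ (hS.toFn_pull μ A (R.rep n) ψ) fun q hq => by rw [hq]
    rw [OrbitReps.pairing, Finset.sum_eq_single (R.idx y)]
    · rw [hterm]
      have : (RightCosets.measure A.Γ μ).real (evalAt A (R.rep (R.idx y)) ⁻¹' {s}) =
          R.mass μ (R.idx y) := by
        have hy' : S.map (proj A) (R.elt y • R.rep (R.idx y)) = s := by
          rw [R.elt_smul]
          exact hy
        rw [Measure.real, ← hy', measure_evalAt_preimage μ A hS]
        rfl
      rw [this, inv_mul_cancel_left₀ (R.mass_ne_zero μ _)]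
    · intro n _ hn
      rw [hterm]
      have : evalAt A (R.rep n) ⁻¹' {s} = ∅ := by
        ext q
        obtain ⟨g, rfl⟩ := RightCosets.mk_surjective A.Γ q
        refine iff_of_false (fun h => hn ?_) id
        change S.map (proj A) (g • R.rep n) = s at h
        obtain ⟨γ, -, e⟩ := (hS.proj_eq_iff A _ _).1 (h.trans hy.symm)
        rw [← mul_smul] at e
        exact (R.idx_eq e).symm
      simp [this]
    · simp

/-- An equivariant family `f` of vectors of `L²(Γ \ G)` that is orthogonal to `pull` vanishes: its
value at `rₙ` is represented by a function that is constant on the fibers of `Γ g ↦ Γ g rₙ`, and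
the pairings with `pull` are multiples of the values of this function. -/
theorem eq_zero_of_pairing_pull (hS : IsOrbitFunctor S) {t : ℕ} (R : OrbitReps G (Fiber S) t)
    {f : Fiber S → (UnitaryRep.L2RightCosets A.Γ μ).carrier}
    (hf : ∀ (g : G) x, f (g • x) = (UnitaryRep.L2RightCosets A.Γ μ).π g (f x))
    (h0 : ∀ ψ, R.pairing μ (fun x => hS.pull μ A x ψ) f = 0) : f = 0 := by
  have hrep : ∀ n, f (R.rep n) = 0 := by
    intro n
    have hfix : f (R.rep n) ∈
        (UnitaryRep.L2RightCosets A.Γ μ).fixed (MulAction.stabilizer G (R.rep n)) := fun k hk => by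
      rw [← hf, MulAction.mem_stabilizer_iff.1 hk]
    obtain ⟨f₀, hf₀, hae⟩ := RightCosets.exists_invariant μ
      (CompactOpenStabilizers.isOpen (R.rep n)) (CompactOpenStabilizers.isCompact (R.rep n)) hfix
    suffices f₀ = 0 by
      rw [this] at hae
      exact Lp.ext (hae.trans (Lp.coeFn_zero ℂ 2 _).symm)
    funext q
    obtain ⟨h, rfl⟩ := RightCosets.mk_surjective A.Γ q
    have hc : ∀ q, evalAt A (R.rep n) q = S.map (proj A) (h • R.rep n) →
        f₀ q = f₀ (RightCosets.mk A.Γ h) := by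
      intro q hq
      have : q ∈ evalAt A (R.rep n) ⁻¹' {S.map (proj A) (h • R.rep n)} := hq
      rw [hS.evalAt_preimage] at this
      obtain ⟨g, hg, rfl⟩ := this
      have hg' : h⁻¹ * g ∈ MulAction.stabilizer G (R.rep n) := by
        rw [MulAction.mem_stabilizer_iff, mul_smul, inv_smul_eq_iff]
        exact hg
      have e := hf₀ _ hg' (RightCosets.mk A.Γ h)
      rwa [RightCosets.mulRight_mk, mul_inv_cancel_left] at e
    have h1 := h0 (Finsupp.single (S.map (proj A) (h • R.rep n)) 1)
    rw [OrbitReps.pairing, Finset.sum_eq_single n] at h1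
    · rw [hS.inner_pull_single μ A (R.rep n) _ _ hae hc, Measure.real,
        measure_evalAt_preimage μ A hS] at h1
      change _ * ((R.mass μ n : ℂ) * _) = 0 at h1
      rwa [inv_mul_cancel_left₀ (R.mass_ne_zero μ n)] at h1
    · intro k _ hk
      have : evalAt A (R.rep k) ⁻¹' {S.map (proj A) (h • R.rep n)} = ∅ := by
        ext q
        obtain ⟨g, rfl⟩ := RightCosets.mk_surjective A.Γ q
        refine iff_of_false (fun hg => hk ?_) id
        change S.map (proj A) (g • R.rep k) = _ at hg
        obtain ⟨γ, -, e⟩ := (hS.proj_eq_iff A _ _).1 hg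
        have e2 : (h⁻¹ * (γ * g)) • R.rep k = R.rep n := by
          rw [mul_smul, mul_smul, e, inv_smul_smul]
        rw [← R.idx_rep n, R.idx_eq e2]
      have e0 : hS.pull μ A (R.rep k) (Finsupp.single (S.map (proj A) (h • R.rep n)) 1) = 0 := by
        refine Lp.ext ((hS.toFn_pull μ A _ _).trans ?_)
        rw [single_comp_evalAt, this, Set.indicator_empty]
        exact (Lp.coeFn_zero ℂ 2 _).symm
      rw [e0, inner_zero_left, mul_zero]
    · simp
  funext x
  have := hf (R.elt x) (R.rep (R.idx x))
  rw [R.elt_smul, hrep, map_zero] at this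
  exact this

end IsOrbitFunctor

namespace Summand

open GComplex GComplex.QuotCat IsOrbitFunctor

variable {G : Type u} {V : Type v} [Group G] [TopologicalSpace G] [IsTopologicalGroup G]
  [LocallyCompactSpace G] [T2Space G] [MeasurableSpace G]
  [BorelSpace G] (μ : Measure G) [μ.IsHaarMeasure] [μ.IsMulRightInvariant] [MulAction G V]
  {X : GComplex G V} {S : X.QuotCat ⥤ Type u} {F : X.QuotCat ⥤ PHil.{u}} (M : Summand S F)
  [CompactOpenStabilizers G (Fiber S)]

theorem linearCombination_conjF (A : X.QuotCat) (g : G) (ψ : S.obj A →₀ ℂ) (χ : Fiber S →₀ ℂ) :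
    Finsupp.linearCombination ℂ (fun y => ψ (evalAt A y (RightCosets.mk A.Γ g))) (conjF χ) =
      finInner (push S A (shift g χ)) ψ := by
  induction χ using Finsupp.induction_linear with
  | zero => simp [finInner, conjF]
  | add φ φ' h1 h2 => rw [conjF_add, map_add, h1, h2, map_add, map_add, finInner_add_left]
  | single y c =>
    have hs : Finsupp.single y c = c • Finsupp.single y (1 : ℂ) := by simp
    rw [hs, conjF_smul, conjF_single, map_smul, map_smul, map_smul, shift_single, push_single,
      finInner_smul_left, finInner_single_left, Finsupp.linearCombination_single, one_smul,
      evalAt_mk, smul_eq_mul]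

/-- The action of the algebra at `Γ \ X`, computed by kernels on `S(X)`. -/
theorem linearCombination_Ψ (hS : IsOrbitFunctor S) (A : X.QuotCat) (a : opAlgebra F) (x : Fiber S)
    (ψ : S.obj A →₀ ℂ) (q : RightCosets A.Γ) :
    Finsupp.linearCombination ℂ (fun y => ψ (evalAt A y q))
      ((M.kernelAlgebra μ hS).Ψ a (Finsupp.single x 1)) = M.opAt A a ψ (evalAt A x q) := by
  obtain ⟨g, rfl⟩ := RightCosets.mk_surjective A.Γ q
  rw [Ψ_kernelAlgebra, conjOp_apply, conjF_single, linearCombination_conjF, ← op_shift,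
    ← opAt_push, shift_single, push_single, finInner_opAt, star_star, finInner_single_left,
    evalAt_mk]

section

variable [SecondCountableTopology G] (A : X.QuotCat) [DiscreteTopology A.Γ]

theorem toFn_linearCombination (hS : IsOrbitFunctor S) (ψ : S.obj A →₀ ℂ) (φ : Fiber S →₀ ℂ) :
    RightCosets.toFn μ (Finsupp.linearCombination ℂ (fun y => hS.pull μ A y ψ) φ)
      =ᵐ[RightCosets.measure A.Γ μ]
        fun q => Finsupp.linearCombination ℂ (fun y => ψ (evalAt A y q)) φ := by
  induction φ using Finsupp.induction_linear with
  | zero =>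
    simp only [map_zero]
    exact Lp.coeFn_zero ℂ 2 _
  | add φ φ' h1 h2 =>
    simp only [map_add]
    filter_upwards [h1, h2, Lp.coeFn_add (E := ℂ) (p := 2) (μ := RightCosets.measure A.Γ μ)
      (Finsupp.linearCombination ℂ (fun y => hS.pull μ A y ψ) φ)
      (Finsupp.linearCombination ℂ (fun y => hS.pull μ A y ψ) φ')] with q h1 h2 h3
    rw [← h1, ← h2]
    exact h3
  | single y c =>
    simp only [Finsupp.linearCombination_single]
    filter_upwards [hS.toFn_pull μ A y ψ, Lp.coeFn_smul (E := ℂ) (p := 2)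
      (μ := RightCosets.measure A.Γ μ) c (hS.pull μ A y ψ)] with q h1 h2
    rw [← h1]
    exact h2

theorem act_pull (hS : IsOrbitFunctor S) (a : opAlgebra F) (ψ : S.obj A →₀ ℂ) :
    (M.kernelAlgebra μ hS).act (UnitaryRep.L2RightCosets A.Γ μ) a (fun x => hS.pull μ A x ψ) =
      fun x => hS.pull μ A x (M.opAt A a ψ) := by
  funext x
  refine Lp.ext ((toFn_linearCombination μ A hS ψ _).trans ?_)
  refine Filter.EventuallyEq.trans ?_ (hS.toFn_pull μ A x (M.opAt A a ψ)).symm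
  exact Filter.Eventually.of_forall fun q => M.linearCombination_Ψ μ hS A a x ψ q

/-- The embedding of `F(Γ \ X)` into the representation of its algebra on the equivariant families
of vectors of `L²(Γ \ G)`. -/
def embed (hS : IsOrbitFunctor S) : (F.obj A).carrier →ₗ[ℂ]
    (M.kernelAlgebra μ hS).fn (UnitaryRep.L2RightCosets A.Γ μ) where
  toFun v := ⟨fun x => hS.pull μ A x (M.ι A v), fun g x => hS.pull_smul μ A g x _, fun x => by
    refine (congrFun (M.act_pull μ A hS 1 (M.ι A v)) x).trans ?_
    rw [opAt_ι]
    rfl⟩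
  map_add' v w := Subtype.ext (funext fun x => by
    change hS.pull μ A x (M.ι A (v + w)) = hS.pull μ A x (M.ι A v) + hS.pull μ A x (M.ι A w)
    rw [map_add, map_add])
  map_smul' c v := Subtype.ext (funext fun x => by
    change hS.pull μ A x (M.ι A (c • v)) = c • hS.pull μ A x (M.ι A v)
    rw [map_smul, map_smul])

/-- The form of `isCompletionAt_rep` in which the topological properties of `G` and `Γ` that follow
from their action on `X` are instances. -/
theorem isCompletionAt_rep_aux (hS : IsOrbitFunctor S) {t : ℕ} (R : OrbitReps G (Fiber S) t) :
    IsCompletionAt F A ((M.kernelAlgebra μ hS).rep R (UnitaryRep.L2RightCosets A.Γ μ)) := by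
  set D := M.kernelAlgebra μ hS
  set H := UnitaryRep.L2RightCosets A.Γ μ
  let j : (F.obj A).carrier →ₗ[ℂ] (D.rep R H).carrier := D.ofFamily R H ∘ₗ M.embed μ A hS
  have hj : ∀ v, D.family R (j v) = fun x => hS.pull μ A x (M.ι A v) := fun v =>
    D.ev_ofFamily R _
  have hinner : ∀ v w, inner ℂ (j v) (j w) = inner ℂ v w := fun v w => by
    rw [D.inner_rep, hj, hj, hS.pairing_pull μ A, M.inner_eq]
  refine ⟨j.isometryOfInner hinner, ?_, fun a v => ?_⟩
  -- the range is dense, since a family orthogonal to it is orthogonal to `pull`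
  · have : (LinearMap.range j)ᗮ = ⊥ := by
      rw [Submodule.eq_bot_iff]
      intro h hh
      refine D.family_injective R ?_
      rw [D.family_zero]
      refine hS.eq_zero_of_pairing_pull μ A R (D.family_mem R h).1 fun ψ => ?_
      have h1 : D.act H (star 1) (D.family R h) = D.family R h := by
        rw [star_one, D.act_one (D.family_mem R h)]
      rw [← h1, ← D.pairing_act R 1 (fun g x => hS.pull_smul μ A g x ψ) (D.family_mem R h).1,
        M.act_pull μ A hS]
      have h2 := (Submodule.mem_orthogonal _ _).1 hh _ ⟨M.p A ψ, rfl⟩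
      rw [D.inner_rep, hj] at h2
      exact h2
    rw [← Submodule.topologicalClosure_eq_top_iff] at this
    change Dense (Set.range j)
    rw [← LinearMap.coe_range, Submodule.dense_iff_topologicalClosure_eq_top]
    exact this
  · refine D.family_injective R ?_
    rw [D.family_ρ]
    change D.family R (j (a.1 A v)) = D.act H a (D.family R (j v))
    rw [hj, hj, M.act_pull μ A hS, M.opAt_ι]

end

theorem isCompletionAt_rep (hS : IsOrbitFunctor S) {t : ℕ} (R : OrbitReps G (Fiber S) t)
    (A : X.QuotCat) :
    IsCompletionAt F A ((M.kernelAlgebra μ hS).rep R (X.L2Quotient A.isQuotient μ)) := by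
  have := X.secondCountableTopology
  have := A.isQuotient.discreteTopology
  exact M.isCompletionAt_rep_aux μ A hS R

/-- Any two completions of `F(Γ \ X)` have the same matrix coefficients, up to closure. -/
theorem coef_completion {A : X.QuotCat} {U U' : AlgRep (opAlgebra F)} (hU : IsCompletionAt F A U)
    (hU' : IsCompletionAt F A U') :
    closure (Set.range U.coef) ⊆ closure (Set.range U'.coef) := by
  obtain ⟨j, hj, hja⟩ := hU
  obtain ⟨j', -, hja'⟩ := hU'
  refine closure_minimal ?_ isClosed_closure
  rintro _ ⟨w, rfl⟩
  refine hj.induction_on (p := fun w => U.coef w ∈ closure (Set.range U'.coef)) w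
    (isClosed_closure.preimage U.continuous_coef) fun v => subset_closure ⟨j' v, ?_⟩
  funext a
  rw [AlgRep.coef, AlgRep.coef, ← hja, ← hja', j.inner_map_map, j'.inner_map_map]

theorem inSpectrum_iff (hS : IsOrbitFunctor S) {t : ℕ} (R : OrbitReps G (Fiber S) t)
    {A : X.QuotCat} {W : AlgRep (opAlgebra F)} :
    InSpectrum F A W ↔ W.IsWeaklyContained
      ((M.kernelAlgebra μ hS).rep R (X.L2Quotient A.isQuotient μ)) := by
  refine ⟨fun ⟨U, hU, hW⟩ => AlgRep.isWeaklyContained_of_coef_mem fun w =>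
    coef_completion hU (M.isCompletionAt_rep μ hS R A) (hW.coef_mem w),
    fun h => ⟨_, M.isCompletionAt_rep μ hS R A, h⟩⟩

end Summand

/-! ### Representations with finite action -/

namespace UnitaryRep

variable {G : Type u} [Group G] [TopologicalSpace G]

/-- An equivariant map out of a finite-dimensional irreducible representation is a multiple of an
isometry (Schur's lemma). -/
theorem IsIrreducible.isContained_of_intertwiner {V H : UnitaryRep G} (hV : V.IsIrreducible)
    [FiniteDimensional ℂ V.carrier] (L : V.carrier →ₗ[ℂ] H.carrier)
    (hL : ∀ g v, L (V.π g v) = H.π g (L v)) (h0 : L ≠ 0) : V.IsContained H := by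
  have := hV.1
  let T : V.carrier →L[ℂ] H.carrier := LinearMap.toContinuousLinearMap L
  have hT : ∀ g v, T (V.π g v) = H.π g (T v) := hL
  -- the equivariant operator `B` describes the inner product pulled back along `T`, and is a scalar
  let B : V.carrier →L[ℂ] V.carrier := (ContinuousLinearMap.adjoint T) ∘L T
  have hB : ∀ v w, inner ℂ v (B w) = inner ℂ (T v) (T w) := fun v w =>
    ContinuousLinearMap.adjoint_inner_right T v (T w)
  have hBπ : ∀ g w, B (V.π g w) = V.π g (B w) := by
    intro g w
    refine ext_inner_left ℂ fun v => ?_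
    have e : V.π g (V.π g⁻¹ v) = v := V.π_apply_inv g v
    rw [hB, hT, ← e, LinearIsometryEquiv.inner_map_map, hB, hT, LinearIsometryEquiv.inner_map_map]
  obtain ⟨c, hc⟩ := Module.End.exists_eigenvalue (B : V.carrier →ₗ[ℂ] V.carrier)
  have htop : Module.End.eigenspace (B : V.carrier →ₗ[ℂ] V.carrier) c = ⊤ := by
    refine (hV.2 _ (Submodule.closed_of_finiteDimensional _) fun g w hw => ?_).resolve_left hc
    rw [Module.End.mem_eigenspace_iff] at hw ⊢
    change B (V.π g w) = c • V.π g w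
    change B w = c • w at hw
    rw [hBπ, hw, map_smul]
  have hBc : ∀ w, B w = c • w := fun w =>
    Module.End.mem_eigenspace_iff.1 (htop ▸ Submodule.mem_top : w ∈ Module.End.eigenspace _ c)
  have hinner : ∀ v w, inner ℂ (T v) (T w) = c * inner ℂ v w := fun v w => by
    rw [← hB, hBc, inner_smul_right]
  obtain ⟨v, hv⟩ : ∃ v, T v ≠ 0 := by
    by_contra! h
    exact h0 (LinearMap.ext h)
  have hv0 : v ≠ 0 := fun h => hv (by rw [h, map_zero])
  -- the scalar `c` is positive
  obtain ⟨r, hr, rfl⟩ : ∃ r : ℝ, 0 < r ∧ c = (r : ℂ) := by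
    have h1 := hinner v v
    rw [inner_self_eq_norm_sq_to_K, inner_self_eq_norm_sq_to_K] at h1
    refine ⟨‖T v‖ ^ 2 / ‖v‖ ^ 2, by positivity, ?_⟩
    have : (‖v‖ : ℂ) ≠ 0 := by exact_mod_cast norm_ne_zero_iff.2 hv0
    push_cast
    rw [eq_div_iff (pow_ne_zero 2 this)]
    exact h1.symm
  have hs : ((Real.sqrt r : ℂ)⁻¹ * (Real.sqrt r : ℂ)⁻¹) * r = 1 := by
    rw [← mul_inv, ← Complex.ofReal_mul, Real.mul_self_sqrt hr.le]
    exact inv_mul_cancel₀ (by exact_mod_cast hr.ne')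
  refine ⟨LinearMap.isometryOfInner (((Real.sqrt r : ℂ)⁻¹) • L) fun v w => ?_, fun g w => ?_⟩
  · change inner ℂ ((Real.sqrt r : ℂ)⁻¹ • T v) ((Real.sqrt r : ℂ)⁻¹ • T w) = _
    rw [inner_smul_left, inner_smul_right, hinner, map_inv₀, Complex.conj_ofReal, ← mul_assoc,
      ← mul_assoc, hs, one_mul]
  · change (Real.sqrt r : ℂ)⁻¹ • L (V.π g w) = H.π g ((Real.sqrt r : ℂ)⁻¹ • L w)
    rw [hL, map_smul]

/-- The orbit of a nonzero vector is finite, and spans. -/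
theorem IsIrreducible.finiteDimensional {V : UnitaryRep G} (hV : V.IsIrreducible)
    (hfin : V.HasFiniteAction) : FiniteDimensional ℂ V.carrier := by
  have := hV.1
  obtain ⟨v, hv⟩ := exists_ne (0 : V.carrier)
  have hr : (Set.range fun g => V.π g v).Finite := by
    have : (Set.range fun g => V.π g v) =
        (fun T : V.carrier ≃ₗᵢ[ℂ] V.carrier => T v) '' Set.range V.π := by
      rw [← Set.range_comp]
      rfl
    rw [this]
    exact hfin.image _
  have := FiniteDimensional.span_of_finite ℂ hr
  have htop : Submodule.span ℂ (Set.range fun g => V.π g v) = ⊤ := by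
    refine (hV.2 _ (Submodule.closed_of_finiteDimensional _) fun g w hw => ?_).resolve_left ?_
    · induction hw using Submodule.span_induction with
      | mem x hx =>
        obtain ⟨h, rfl⟩ := hx
        exact Submodule.subset_span ⟨g * h, V.π_mul g h v⟩
      | zero => rw [map_zero]; exact Submodule.zero_mem _
      | add x y _ _ hx hy => rw [map_add]; exact Submodule.add_mem _ hx hy
      | smul c x _ hx => rw [map_smul]; exact Submodule.smul_mem _ _ hx
    · intro h
      have : v ∈ Submodule.span ℂ (Set.range fun g => V.π g v) :=
        Submodule.subset_span ⟨1, V.π_one v⟩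
      rw [h] at this
      exact hv this
  exact Module.finite_def.2 (htop ▸ (Module.Finite.iff_fg.1 this))

/-- Each of the finitely many operators `T ≠ 1` in the image moves some vector, and the elements `g`
for which `g` and `T` differ on this vector form an open set. -/
theorem isOpen_ker {V : UnitaryRep G} (hfin : V.HasFiniteAction) :
    IsOpen ((MonoidHom.ker V.π : Subgroup G) : Set G) := by
  have h : ∀ T : V.carrier ≃ₗᵢ[ℂ] V.carrier, T ≠ 1 → ∃ v, T v ≠ v := fun T hT => by
    by_contra! h
    exact hT (LinearIsometryEquiv.ext h)
  choose! w hw using h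
  have e : ((MonoidHom.ker V.π : Subgroup G) : Set G) =
      ⋂ T ∈ Set.range V.π \ {1}, {g | V.π g (w T) ≠ T (w T)} := by
    ext g
    simp only [Set.mem_iInter, Set.mem_ofPred_eq, SetLike.mem_coe, MonoidHom.mem_ker]
    constructor
    · intro hg T hT
      rw [hg]
      exact (hw T hT.2).symm
    · intro hg
      by_contra hne
      exact hg (V.π g) ⟨⟨g, rfl⟩, hne⟩ rfl
  rw [e]
  refine (hfin.subset Set.sdiff_subset).isOpen_biInter fun T _ => ?_
  exact isOpen_ne_fun (V.continuous_π_apply _) continuous_const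

theorem finiteIndex_ker {V : UnitaryRep G} (hfin : V.HasFiniteAction) :
    (MonoidHom.ker V.π).FiniteIndex := by
  have : Finite V.π.range := hfin
  exact Subgroup.finiteIndex_ker V.π

theorem hasFiniteAction_of_le_ker {V : UnitaryRep G} {N : Subgroup G} [N.FiniteIndex]
    (h : ∀ n ∈ N, V.π n = 1) : V.HasFiniteAction := by
  have hle : N ≤ MonoidHom.ker V.π := fun n hn => MonoidHom.mem_ker.2 (h n hn)
  have : (MonoidHom.ker V.π).FiniteIndex := Subgroup.finiteIndex_of_le hle
  have : Finite (G ⧸ MonoidHom.ker V.π) := inferInstance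
  exact Finite.of_equiv _ (QuotientGroup.quotientKerEquivRange V.π).toEquiv

section Quotient

variable [IsTopologicalGroup G] (N : Subgroup G) [N.Normal] [N.FiniteIndex]
  (hN : IsOpen (N : Set G))

/-- The regular representation `(g φ)(q) = φ(q g)` of `G` on functions on the finite group `G ⧸ N`,
for an open normal subgroup `N` of finite index. -/
def regular : UnitaryRep G :=
  let _ : Fintype (G ⧸ N) := Fintype.ofFinite _
  { carrier := EuclideanSpace ℂ (G ⧸ N)
    π :=
      { toFun := fun g => LinearIsometryEquiv.piLpCongrLeft 2 ℂ ℂ (Equiv.mulRight (g : G ⧸ N)⁻¹)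
        map_one' := by
          ext φ q
          change φ (q * ((1 : G) : G ⧸ N)⁻¹⁻¹) = φ q
          simp
        map_mul' := fun g h => by
          ext φ q
          change φ (q * ((g * h : G) : G ⧸ N)⁻¹⁻¹) = φ (q * (g : G ⧸ N)⁻¹⁻¹ * (h : G ⧸ N)⁻¹⁻¹)
          simp [mul_assoc] }
    continuous_action := by
      rw [continuous_iff_continuousAt]
      rintro ⟨g, φ⟩
      refine ContinuousAt.congr (f := fun p : G × EuclideanSpace ℂ (G ⧸ N) =>
        LinearIsometryEquiv.piLpCongrLeft 2 ℂ ℂ (Equiv.mulRight (g : G ⧸ N)⁻¹) p.2)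
        (LinearIsometryEquiv.continuous _ |>.comp continuous_snd).continuousAt ?_
      have hg : (fun h => g⁻¹ * h) ⁻¹' (N : Set G) ∈ 𝓝 g :=
        (hN.preimage (continuous_const_mul g⁻¹)).mem_nhds (by simp [N.one_mem])
      filter_upwards [continuous_fst.continuousAt.preimage_mem_nhds hg] with p hp
      have : ((p.1 : G) : G ⧸ N) = (g : G ⧸ N) := (QuotientGroup.eq.2 hp).symm
      change LinearIsometryEquiv.piLpCongrLeft 2 ℂ ℂ (Equiv.mulRight (g : G ⧸ N)⁻¹) p.2 =
        LinearIsometryEquiv.piLpCongrLeft 2 ℂ ℂ (Equiv.mulRight (p.1 : G ⧸ N)⁻¹) p.2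
      rw [this] }

/-- The coordinate at `q` of a vector of the regular representation. -/
def regularCoord (q : G ⧸ N) : (regular N hN).carrier →ₗ[ℂ] ℂ :=
  let _ : Fintype (G ⧸ N) := Fintype.ofFinite _
  { toFun := fun φ : EuclideanSpace ℂ (G ⧸ N) => φ q
    map_add' := fun _ _ => rfl
    map_smul' := fun _ _ => rfl }

theorem regular_ext {φ ψ : (regular N hN).carrier}
    (h : ∀ q, regularCoord N hN q φ = regularCoord N hN q ψ) : φ = ψ :=
  let _ : Fintype (G ⧸ N) := Fintype.ofFinite _
  PiLp.ext h

theorem regularCoord_π (q : G ⧸ N) (g : G) (φ : (regular N hN).carrier) :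
    regularCoord N hN q ((regular N hN).π g φ) = regularCoord N hN (q * g) φ := by
  let _ : Fintype (G ⧸ N) := Fintype.ofFinite _
  change (show EuclideanSpace ℂ (G ⧸ N) from φ) (q * (g : G ⧸ N)⁻¹⁻¹) = _
  rw [inv_inv]
  rfl

theorem regular_π_of_mem {n : G} (hn : n ∈ N) (φ : (regular N hN).carrier) :
    (regular N hN).π n φ = φ := by
  refine regular_ext N hN fun q => ?_
  rw [regularCoord_π, (QuotientGroup.eq_one_iff n).2 hn, mul_one]

/-- The vector of the regular representation with given coordinates. -/
def regularMk : ((G ⧸ N) → ℂ) →ₗ[ℂ] (regular N hN).carrier :=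
  let _ : Fintype (G ⧸ N) := Fintype.ofFinite _
  (WithLp.linearEquiv 2 ℂ ((G ⧸ N) → ℂ)).symm.toLinearMap

theorem regularCoord_mk (q : G ⧸ N) (c : (G ⧸ N) → ℂ) :
    regularCoord N hN q (regularMk N hN c) = c q := rfl

theorem inner_regular (φ ψ : (regular N hN).carrier) : inner ℂ φ ψ =
    ∑ᶠ q, starRingEnd ℂ (regularCoord N hN q φ) * regularCoord N hN q ψ := by
  let _ : Fintype (G ⧸ N) := Fintype.ofFinite _
  rw [finsum_eq_sum_of_fintype]
  refine (PiLp.inner_apply (𝕜 := ℂ) (f := fun _ : G ⧸ N => ℂ) φ ψ).trans ?_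
  refine Finset.sum_congr rfl fun q _ => ?_
  exact mul_comm _ _

instance : FiniteDimensional ℂ (regular N hN).carrier :=
  let _ : Fintype (G ⧸ N) := Fintype.ofFinite _
  inferInstanceAs (FiniteDimensional ℂ (EuclideanSpace ℂ (G ⧸ N)))

end Quotient

/-- An irreducible representation with finite action is contained in the regular representation of
its image. -/
theorem IsIrreducible.isContained_regular [IsTopologicalGroup G] {V : UnitaryRep G}
    (hV : V.IsIrreducible) (hfin : V.HasFiniteAction) [(MonoidHom.ker V.π).FiniteIndex] :
    V.IsContained (regular (MonoidHom.ker V.π) (isOpen_ker hfin)) := by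
  have := hV.1
  have := hV.finiteDimensional hfin
  obtain ⟨v₀, hv₀⟩ := exists_ne (0 : V.carrier)
  -- matrix coefficients against `v₀` embed `V` into the functions on the quotient
  let c : V.carrier →ₗ[ℂ] ((G ⧸ MonoidHom.ker V.π) → ℂ) :=
    { toFun := fun v => Quotient.lift (fun g => inner ℂ v₀ (V.π g v)) fun g h hgh => by
        have : V.π g = V.π h := by
          have h1 : g⁻¹ * h ∈ MonoidHom.ker V.π := QuotientGroup.leftRel_apply.1 hgh
          rw [MonoidHom.mem_ker, map_mul, map_inv, inv_mul_eq_one] at h1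
          exact h1
        simp only [this]
      map_add' := fun v w => funext fun q => by
        obtain ⟨g, rfl⟩ := QuotientGroup.mk_surjective q
        change inner ℂ v₀ (V.π g (v + w)) = inner ℂ v₀ (V.π g v) + inner ℂ v₀ (V.π g w)
        rw [map_add, inner_add_right]
      map_smul' := fun r v => funext fun q => by
        obtain ⟨g, rfl⟩ := QuotientGroup.mk_surjective q
        change inner ℂ v₀ (V.π g (r • v)) = r * inner ℂ v₀ (V.π g v)
        rw [map_smul, inner_smul_right] }
  refine hV.isContained_of_intertwiner (regularMk _ _ ∘ₗ c) (fun g v => ?_) fun h => ?_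
  · refine regular_ext _ _ fun q => ?_
    rw [regularCoord_π, LinearMap.comp_apply, LinearMap.comp_apply, regularCoord_mk,
      regularCoord_mk]
    obtain ⟨k, rfl⟩ := QuotientGroup.mk_surjective q
    change inner ℂ v₀ (V.π k (V.π g v)) = inner ℂ v₀ (V.π (k * g) v)
    rw [π_mul]
  · have h1 := congrArg (regularCoord _ (isOpen_ker hfin) (1 : G)) (LinearMap.congr_fun h v₀)
    rw [LinearMap.comp_apply, regularCoord_mk] at h1
    change inner ℂ v₀ (V.π 1 v₀) = _ at h1
    rw [π_one, LinearMap.zero_apply, map_zero, inner_self_eq_zero] at h1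
    exact hv₀ h1

end UnitaryRep

/-! ### Coinvariants and the trivial spectrum -/

section Integrals

variable {G : Type u} [Group G] [TopologicalSpace G] [IsTopologicalGroup G]
  [MeasurableSpace G] [BorelSpace G] (μ : Measure G) [μ.IsHaarMeasure]
  {Ω : Type u} [MulAction G Ω] [CompactOpenStabilizers G Ω]

theorem integrable_comp_smul (φ : Ω →₀ ℂ) (x : Ω) : Integrable (fun g : G => φ (g • x)) μ := by
  classical
  induction φ using Finsupp.induction_linear with
  | zero => exact integrable_zero _ _ _
  | add φ ψ h1 h2 => exact h1.add h2
  | single y c =>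
    have e : (fun g : G => Finsupp.single y c (g • x)) =
        {g : G | g • x = y}.indicator fun _ => c := by
      funext g
      by_cases h : g • x = y
      · rw [Set.indicator_of_mem (show g ∈ {g : G | g • x = y} from h), h, Finsupp.single_eq_same]
      · rw [Set.indicator_of_notMem (show g ∉ {g : G | g • x = y} from h),
          Finsupp.single_eq_of_ne h]
    rw [e, integrable_indicator_iff (isOpen_setOf_smul_eq G x y).measurableSet]
    exact integrableOn_const (isCompact_setOf_smul_eq G x y).measure_lt_top.ne

/-- The integral of `g ↦ φ (g x)` over a subset of `G`. -/
def orbitIntegral (B : Set G) (x : Ω) : (Ω →₀ ℂ) →ₗ[ℂ] ℂ where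
  toFun φ := ∫ g in B, φ (g • x) ∂μ
  map_add' φ ψ := integral_add (integrable_comp_smul μ φ x).integrableOn
    (integrable_comp_smul μ ψ x).integrableOn
  map_smul' c _ := integral_const_mul c _

theorem orbitIntegral_apply (B : Set G) (x : Ω) (φ : Ω →₀ ℂ) :
    orbitIntegral μ B x φ = ∫ g in B, φ (g • x) ∂μ := rfl

theorem orbitIntegral_shift (B : Set G) (hB : MeasurableSet B) (x : Ω) (n : G)
    (hn : ∀ g, n * g ∈ B ↔ g ∈ B) (φ : Ω →₀ ℂ) :
    orbitIntegral μ B x (shift n φ) = orbitIntegral μ B x φ := by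
  rw [orbitIntegral_apply, orbitIntegral_apply, ← integral_indicator hB, ← integral_indicator hB,
    ← integral_mul_left_eq_self _ n]
  congr 1
  funext g
  by_cases h : g ∈ B
  · rw [Set.indicator_of_mem h, Set.indicator_of_mem ((hn g).2 h), mul_smul, shift_apply]
  · rw [Set.indicator_of_notMem h, Set.indicator_of_notMem fun h' => h ((hn g).1 h')]

theorem orbitIntegral_smul [μ.IsMulRightInvariant] (B B' : Set G) (hB : MeasurableSet B)
    (hB' : MeasurableSet B') (x : Ω) (h : G) (hh : ∀ g, g * h ∈ B' ↔ g ∈ B) (φ : Ω →₀ ℂ) :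
    orbitIntegral μ B (h • x) φ = orbitIntegral μ B' x φ := by
  rw [orbitIntegral_apply, orbitIntegral_apply, ← integral_indicator hB, ← integral_indicator hB',
    ← integral_mul_right_eq_self (B'.indicator fun g => φ (g • x)) h]
  congr 1
  funext g
  by_cases hg : g ∈ B
  · rw [Set.indicator_of_mem hg, Set.indicator_of_mem ((hh g).2 hg), mul_smul]
  · rw [Set.indicator_of_notMem hg, Set.indicator_of_notMem fun h' => hg ((hh g).1 h')]

theorem linearCombination_orbitIntegral (B : Set G) (φ : Ω →₀ ℂ) (χ : Ω →₀ ℂ) :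
    Finsupp.linearCombination ℂ (fun z => orbitIntegral μ B z φ) χ =
      ∫ g in B, Finsupp.linearCombination ℂ (fun z => φ (g • z)) χ ∂μ := by
  simp only [Finsupp.linearCombination_apply, Finsupp.sum]
  rw [integral_finsetSum]
  · exact Finset.sum_congr rfl fun z _ => (integral_smul _ _).symm
  · exact fun z _ => ((integrable_comp_smul μ φ z).smul (χ z)).integrableOn

end Integrals

namespace Summand

open GComplex GComplex.QuotCat IsOrbitFunctor UnitaryRep

variable {G : Type u} {V : Type v} [Group G] [TopologicalSpace G] [IsTopologicalGroup G]
  [LocallyCompactSpace G] [T2Space G] [MeasurableSpace G]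
  [BorelSpace G] (μ : Measure G) [μ.IsHaarMeasure] [μ.IsMulRightInvariant] [MulAction G V]
  {X : GComplex G V} {S : X.QuotCat ⥤ Type u} {F : X.QuotCat ⥤ PHil.{u}} (M : Summand S F)
  [CompactOpenStabilizers G (Fiber S)]

theorem linearCombination_Ψ_base (hS : IsOrbitFunctor S) (a : opAlgebra F) (x : Fiber S)
    (ψ : Fiber S →₀ ℂ) (g : G) :
    Finsupp.linearCombination ℂ (fun y : Fiber S => ψ (g • y))
      ((M.kernelAlgebra μ hS).Ψ a (Finsupp.single x 1)) = M.op a ψ (g • x) := by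
  have h1 : ∀ y : Fiber S, evalAt (base X) y (RightCosets.mk (base X).Γ g) = g • y := fun y => by
    rw [evalAt_mk, proj_base, S.map_id]
    rfl
  have h := M.linearCombination_Ψ μ hS (base X) a x ψ (RightCosets.mk _ g)
  simp only [h1] at h
  exact h

section

variable (N : Subgroup G) [N.Normal] [N.FiniteIndex] (hN : IsOpen (N : Set G))

/-- The set of elements of a coset of `N`. -/
def cosetSet (q : G ⧸ N) : Set G := {g | (g : G ⧸ N) = q}

theorem isOpen_cosetSet {N : Subgroup G} (hN : IsOpen (N : Set G)) (q : G ⧸ N) :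
    IsOpen (cosetSet N q) := by
  have := QuotientGroup.discreteTopology hN
  exact (isOpen_discrete {q}).preimage QuotientGroup.continuous_mk

/-- The family of functions on `G ⧸ N` given by integrating `g ↦ φ (g x)` over the cosets. -/
def fold (x : Fiber S) : (Fiber S →₀ ℂ) →ₗ[ℂ] (regular N hN).carrier :=
  regularMk N hN ∘ₗ LinearMap.pi fun q => orbitIntegral μ (cosetSet N q) x

theorem regularCoord_fold (x : Fiber S) (φ : Fiber S →₀ ℂ) (q : G ⧸ N) :
    regularCoord N hN q (fold μ N hN x φ) = orbitIntegral μ (cosetSet N q) x φ := rfl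

theorem fold_smul (g : G) (x : Fiber S) (φ : Fiber S →₀ ℂ) :
    fold μ N hN (g • x) φ = (regular N hN).π g (fold μ N hN x φ) := by
  refine regular_ext N hN fun q => ?_
  rw [regularCoord_π, regularCoord_fold, regularCoord_fold]
  refine orbitIntegral_smul μ _ _ (isOpen_cosetSet hN _).measurableSet
    (isOpen_cosetSet hN _).measurableSet x g (fun h => ?_) φ
  change ((h * g : G) : G ⧸ N) = q * g ↔ (h : G ⧸ N) = q
  rw [QuotientGroup.mk_mul, mul_left_inj]

theorem fold_shift {n : G} (hn : n ∈ N) (x : Fiber S) (φ : Fiber S →₀ ℂ) :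
    fold μ N hN x (shift n φ) = fold μ N hN x φ := by
  refine regular_ext N hN fun q => ?_
  rw [regularCoord_fold, regularCoord_fold]
  refine orbitIntegral_shift μ _ (isOpen_cosetSet hN _).measurableSet x n (fun h => ?_) φ
  change ((n * h : G) : G ⧸ N) = q ↔ (h : G ⧸ N) = q
  rw [QuotientGroup.mk_mul, (QuotientGroup.eq_one_iff n).2 hn, one_mul]

theorem act_fold (hS : IsOrbitFunctor S) (a : opAlgebra F) (φ : Fiber S →₀ ℂ) :
    (M.kernelAlgebra μ hS).act (regular N hN) a (fun x => fold μ N hN x φ) =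
      fun x => fold μ N hN x (M.op a φ) := by
  funext x
  refine regular_ext N hN fun q => ?_
  rw [regularCoord_fold, orbitIntegral_apply]
  simp_rw [← M.linearCombination_Ψ_base μ hS a x φ]
  rw [← linearCombination_orbitIntegral]
  exact Finsupp.apply_linearCombination ℂ (regularCoord N hN q) _ _

/-- The map from `F(X)` to the equivariant families of functions on `G ⧸ N` that realizes these as
the coinvariants of `N`. -/
def foldMap (hS : IsOrbitFunctor S) : (F.obj (base X)).carrier →ₗ[ℂ]
    (M.kernelAlgebra μ hS).fn (regular N hN) where
  toFun v := ⟨fun x => fold μ N hN x (M.ιX v), fun g x => fold_smul μ N hN g x _, fun x => by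
    refine (congrFun (M.act_fold μ N hN hS 1 (M.ιX v)) x).trans ?_
    rw [op_one, pX_ιX]⟩
  map_add' v w := Subtype.ext (funext fun x => by
    change fold μ N hN x (M.ιX (v + w)) = fold μ N hN x (M.ιX v) + fold μ N hN x (M.ιX w)
    rw [map_add, map_add])
  map_smul' c v := Subtype.ext (funext fun x => by
    change fold μ N hN x (M.ιX (c • v)) = c • fold μ N hN x (M.ιX v)
    rw [map_smul, map_smul])

/-- A function all of whose integrals over `N`-orbits vanish is a combination of differences
`φ - n φ`. -/
theorem mem_span_of_fold_eq_zero {φ : Fiber S →₀ ℂ} (h : ∀ x, fold μ N hN x φ = 0) :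
    φ ∈ Submodule.span ℂ {ψ : Fiber S →₀ ℂ | ∃ φ : Fiber S →₀ ℂ, ∃ n ∈ N, ψ = φ - shift n φ} := by
  set C := Submodule.span ℂ {ψ : Fiber S →₀ ℂ | ∃ φ : Fiber S →₀ ℂ, ∃ n ∈ N, ψ = φ - shift n φ}
  -- move the mass of `φ` to representatives of the `N`-orbits
  let r : Fiber S → Fiber S := fun y =>
    (Quotient.mk'' y : MulAction.orbitRel.Quotient N (Fiber S)).out
  have hr : ∀ y, ∃ n ∈ N, n • r y = y := fun y => by
    have h1 : (MulAction.orbitRel N (Fiber S)) (r y) y := Quotient.mk_out y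
    obtain ⟨n, hn⟩ := MulAction.orbitRel_apply.1 (Setoid.symm' _ h1)
    exact ⟨n, n.2, hn⟩
  have hrn : ∀ n ∈ N, ∀ y, r (n • y) = r y := fun n hn y => by
    have : (Quotient.mk'' (n • y) : MulAction.orbitRel.Quotient N (Fiber S)) = Quotient.mk'' y :=
      Quotient.sound' ⟨⟨n, hn⟩, rfl⟩
    simp only [r, this]
  let φ' : Fiber S →₀ ℂ := Finsupp.lmapDomain ℂ ℂ r φ
  have hdiff : ∀ φ : Fiber S →₀ ℂ, φ - Finsupp.lmapDomain ℂ ℂ r φ ∈ C := by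
    intro φ
    induction φ using Finsupp.induction_linear with
    | zero => simp
    | add φ ψ h1 h2 =>
      rw [map_add, add_sub_add_comm]
      exact Submodule.add_mem _ h1 h2
    | single y c =>
      obtain ⟨n, hn, e⟩ := hr y
      refine Submodule.subset_span ⟨Finsupp.single y c, n⁻¹, N.inv_mem hn, ?_⟩
      have : n⁻¹ • y = r y := by rw [inv_smul_eq_iff, e]
      rw [shift_single, this]
      exact congrArg _ Finsupp.mapDomain_single
  have hC : ∀ ψ ∈ C, ∀ x, fold μ N hN x ψ = 0 := by
    intro ψ hψ x
    induction hψ using Submodule.span_induction with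
    | mem ψ hψ =>
      obtain ⟨χ, n, hn, rfl⟩ := hψ
      rw [map_sub, fold_shift μ N hN hn, sub_self]
    | zero => exact map_zero _
    | add _ _ _ _ h1 h2 => rw [map_add, h1, h2, add_zero]
    | smul c _ _ h1 => rw [map_smul, h1, smul_zero]
  have h' : ∀ x, fold μ N hN x φ' = 0 := fun x => by
    have := hC _ (hdiff φ) x
    rwa [map_sub, h, zero_sub, neg_eq_zero] at this
  have hsupp : ∀ y, φ' y ≠ 0 → r y = y := by
    classical
    intro y hy
    have := Finsupp.mapDomain_support (Finsupp.mem_support_iff.2 hy)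
    obtain ⟨z, -, rfl⟩ := Finset.mem_image.1 this
    obtain ⟨n, hn, e⟩ := hr z
    exact (hrn n hn (r z)).symm.trans (congrArg r e)
  -- an orbit integral of `φ'` at `y` only sees the value of `φ'` at the representative `y`
  have hφ' : φ' = 0 := by
    ext y
    by_contra hy
    have hy1 := hsupp y hy
    have h1 := congrArg (regularCoord N hN 1) (h' y)
    rw [regularCoord_fold, map_zero, orbitIntegral_apply] at h1
    have hm := (isOpen_cosetSet hN (1 : G ⧸ N)).measurableSet
    have h2 : ∫ g in cosetSet N 1, φ' (g • y) ∂μ =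
        ∫ g in cosetSet N 1 ∩ {g | g • y = y}, φ' y ∂μ := by
      rw [← integral_indicator hm, ← integral_indicator
        (hm.inter (isOpen_setOf_smul_eq G y y).measurableSet)]
      congr 1
      funext g
      by_cases hg : g ∈ cosetSet N 1
      · rw [Set.indicator_of_mem hg]
        by_cases hgy : g • y = y
        · rw [Set.indicator_of_mem (show g ∈ cosetSet N 1 ∩ {g | g • y = y} from ⟨hg, hgy⟩), hgy]
        · rw [Set.indicator_of_notMem fun h => hgy h.2]
          by_contra hne
          refine hgy ?_
          rw [← hsupp _ hne, hrn g ((QuotientGroup.eq_one_iff g).1 hg), hy1]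
      · rw [Set.indicator_of_notMem hg, Set.indicator_of_notMem fun h => hg h.1]
    rw [h2, setIntegral_const] at h1
    rcases smul_eq_zero.1 h1 with h3 | h3
    · have ho : IsOpen (cosetSet N 1 ∩ {g | g • y = y}) :=
        (isOpen_cosetSet hN _).inter (isOpen_setOf_smul_eq G y y)
      have hpos := ho.measure_pos μ ⟨1, rfl, one_smul G y⟩
      rw [Measure.real, ENNReal.toReal_eq_zero_iff] at h3
      rcases h3 with h3 | h3
      · exact hpos.ne' h3
      · exact (lt_of_le_of_lt (measure_mono Set.inter_subset_right)
          (isCompact_setOf_smul_eq G y y).measure_lt_top).ne h3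
    · exact hy h3
  have := hdiff φ
  change φ - φ' ∈ C at this
  rwa [hφ', sub_zero] at this

theorem orbitIntegral_single (B : Set G) (hB : MeasurableSet B) (x y : Fiber S) :
    orbitIntegral μ B x (Finsupp.single y 1) = (μ.real (B ∩ {g | g • x = y}) : ℂ) := by
  have hy := (isOpen_setOf_smul_eq G x y).measurableSet
  have e : B.indicator (fun g => Finsupp.single y (1 : ℂ) (g • x)) =
      (B ∩ {g | g • x = y}).indicator fun _ => 1 := by
    classical
    funext g
    by_cases hg : g ∈ B
    · by_cases hgy : g • x = y
      · rw [Set.indicator_of_mem hg,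
          Set.indicator_of_mem (show g ∈ B ∩ {g | g • x = y} from ⟨hg, hgy⟩), hgy,
          Finsupp.single_eq_same]
      · rw [Set.indicator_of_mem hg, Set.indicator_of_notMem fun h => hgy h.2,
          Finsupp.single_eq_of_ne hgy]
    · rw [Set.indicator_of_notMem hg, Set.indicator_of_notMem fun h => hg h.1]
  rw [orbitIntegral_apply, ← integral_indicator hB, e, integral_indicator (hB.inter hy),
    setIntegral_const, Complex.real_smul, mul_one]

/-- An equivariant family `f` of functions on `G ⧸ N` that is orthogonal to `fold` vanishes: the
pairing with the image of the point mass at `y` is a positive multiple of the coordinate at `1`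
of `f y`. -/
theorem eq_zero_of_pairing_fold {t : ℕ} (R : OrbitReps G (Fiber S) t)
    {f : Fiber S → (regular N hN).carrier} (hf : ∀ (g : G) x, f (g • x) = (regular N hN).π g (f x))
    (h0 : ∀ φ, R.pairing μ (fun x => fold μ N hN x φ) f = 0) : f = 0 := by
  have := Fintype.ofFinite (G ⧸ N)
  have hcoord : ∀ (g : G) x, regularCoord N hN g (f x) = regularCoord N hN 1 (f (g • x)) := by
    intro g x
    rw [hf, regularCoord_π, one_mul]
  suffices h : ∀ y, regularCoord N hN 1 (f y) = 0 by
    funext x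
    refine regular_ext N hN fun q => ?_
    obtain ⟨g, rfl⟩ := QuotientGroup.mk_surjective q
    rw [hcoord, h]
    exact (map_zero _).symm
  intro y
  have hm := fun q => (isOpen_cosetSet hN q).measurableSet
  have hterm : ∀ n, inner ℂ (fold μ N hN (R.rep n) (Finsupp.single y 1)) (f (R.rep n)) =
      ((∑ q, μ.real (cosetSet N q ∩ {g | g • R.rep n = y}) : ℝ) : ℂ) *
        regularCoord N hN 1 (f y) := by
    intro n
    rw [inner_regular, finsum_eq_sum_of_fintype, Complex.ofReal_sum, Finset.sum_mul]
    refine Finset.sum_congr rfl fun q _ => ?_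
    rw [regularCoord_fold, orbitIntegral_single μ _ (hm q), Complex.conj_ofReal]
    rcases Set.eq_empty_or_nonempty (cosetSet N q ∩ {g | g • R.rep n = y}) with h | ⟨g, hg, hgy⟩
    · rw [h]
      simp
    · change (g : G ⧸ N) = q at hg
      change g • R.rep n = y at hgy
      rw [← hgy, ← hcoord, hg]
  have h1 := h0 (Finsupp.single y 1)
  rw [OrbitReps.pairing, Finset.sum_eq_single (R.idx y)] at h1
  · rw [hterm] at h1
    refine (mul_eq_zero.1 ((mul_eq_zero.1 h1).resolve_left
      (inv_ne_zero (R.mass_ne_zero μ _)))).resolve_left fun h2 => ?_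
    rw [Complex.ofReal_eq_zero, Finset.sum_eq_zero_iff_of_nonneg fun q _ => measureReal_nonneg]
      at h2
    have h3 := h2 (R.elt y : G ⧸ N) (Finset.mem_univ _)
    have ho : IsOpen (cosetSet N (R.elt y) ∩ {g | g • R.rep (R.idx y) = y}) :=
      (isOpen_cosetSet hN _).inter (isOpen_setOf_smul_eq G _ y)
    rw [Measure.real, ENNReal.toReal_eq_zero_iff] at h3
    rcases h3 with h3 | h3
    · exact (ho.measure_pos μ ⟨R.elt y, rfl, R.elt_smul y⟩).ne' h3
    · exact (lt_of_le_of_lt (measure_mono Set.inter_subset_right)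
        (isCompact_setOf_smul_eq G _ y).measure_lt_top).ne h3
  · intro n _ hn
    have h2 : ∀ q, cosetSet N q ∩ {g | g • R.rep n = y} = ∅ := fun q => by
      ext g
      exact iff_of_false (fun h => hn (R.idx_eq h.2).symm) id
    rw [hterm]
    simp [h2]
  · simp

/-- The coinvariants `F(X)_N` are the equivariant families of functions on `G ⧸ N`. -/
theorem isCoinvariants_rep (hS : IsOrbitFunctor S) {t : ℕ} (R : OrbitReps G (Fiber S) t) :
    IsCoinvariants F N ((M.kernelAlgebra μ hS).rep R (regular N hN)) := by
  set D := M.kernelAlgebra μ hS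
  set H := regular N hN
  let j : (F.obj (base X)).carrier →ₗ[ℂ] (D.rep R H).carrier :=
    D.ofFamily R H ∘ₗ M.foldMap μ N hN hS
  have hj : ∀ v, D.family R (j v) = fun x => fold μ N hN x (M.ιX v) := fun v =>
    D.ev_ofFamily R _
  have hker : LinearMap.ker j = coinvKer F N := by
    refine le_antisymm (fun v hv => ?_) (Submodule.span_le.2 ?_)
    · have h1 : ∀ x, fold μ N hN x (M.ιX v) = 0 := fun x => by
        have := hj v
        rw [LinearMap.mem_ker.1 hv, D.family_zero] at this
        exact (congrFun this x).symm
      have h2 := Submodule.mem_map_of_mem (f := M.pX) (mem_span_of_fold_eq_zero μ N hN h1)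
      rw [pX_ιX, Submodule.map_span] at h2
      refine Submodule.span_mono ?_ h2
      rintro _ ⟨_, ⟨φ, n, hn, rfl⟩, rfl⟩
      exact ⟨M.pX φ, n, hn, by rw [map_sub, pX_shift]⟩
    · rintro _ ⟨φ, g, hg, rfl⟩
      refine LinearMap.mem_ker.2 (D.family_injective R ?_)
      rw [hj, D.family_zero]
      funext x
      rw [map_sub, ιX_shift, map_sub, fold_shift μ N hN hg, sub_self]
      rfl
  -- in finite dimension, surjectivity is triviality of the orthogonal complement of the range
  have hrange : LinearMap.range j = ⊤ := by
    have : FiniteDimensional ℂ (D.rep R H).carrier :=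
      inferInstanceAs (FiniteDimensional ℂ (D.space R H))
    rw [← Submodule.orthogonal_eq_bot_iff, Submodule.eq_bot_iff]
    intro h hh
    refine D.family_injective R ?_
    rw [D.family_zero]
    refine eq_zero_of_pairing_fold μ N hN R (D.family_mem R h).1 fun ψ => ?_
    have h1 : D.act H (star 1) (D.family R h) = D.family R h := by
      rw [star_one, D.act_one (D.family_mem R h)]
    rw [← h1, ← D.pairing_act R 1 (fun g x => fold_smul μ N hN g x ψ) (D.family_mem R h).1,
      M.act_fold μ N hN hS]
    have h2 := (Submodule.mem_orthogonal _ _).1 hh _ ⟨M.pX ψ, rfl⟩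
    rw [D.inner_rep, hj] at h2
    exact h2
  refine ⟨(Submodule.quotEquivOfEq _ _ hker.symm).trans
    (j.quotKerEquivOfSurjective (LinearMap.range_eq_top.1 hrange)), fun a φ => ?_⟩
  change j (a.1 (base X) φ) = (D.rep R H).ρ a (j φ)
  refine D.family_injective R ?_
  rw [D.family_ρ, hj, hj, M.act_fold μ N hN hS, op_apply, pX_ιX]

end

end Summand

/-! ### Finite action and the trivial spectrum -/

namespace KernelAlgebra

variable {G : Type u} [Group G] [TopologicalSpace G] [IsTopologicalGroup G]
  [MeasurableSpace G] [BorelSpace G] {μ : Measure G} [μ.IsHaarMeasure] [μ.IsMulRightInvariant]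
  {A : Type u} [Ring A] [Algebra ℂ A] [StarRing A] [StarModule ℂ A]
  {Ω : Type u} [MulAction G Ω] [CompactOpenStabilizers G Ω] {t : ℕ}
  (D : KernelAlgebra μ A Ω) (R : OrbitReps G Ω t)

/-- Some element of the algebra detects the differences `f z' - f z` of the values of a family. -/
theorem exists_inner_ρ_eq_sub (y z z' : Ω) : ∃ c : A, ∀ (H : UnitaryRep G)
    (h h' : (D.rep R H).carrier), inner ℂ h ((D.rep R H).ρ c h') =
      inner ℂ (D.family R h y) (D.family R h' z' - D.family R h' z) := by
  refine ⟨D.τ y z' - D.τ y z, fun H h h' => ?_⟩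
  rw [map_sub, sub_apply, inner_sub_right, D.inner_ρ_τ, D.inner_ρ_τ, inner_sub_right]

/-- If a normal subgroup `N` fixes the values of a family up to vectors orthogonal to all values,
it acts trivially. -/
theorem π_eq_one_of_inner {W : UnitaryRep G} {f : Ω → W.carrier}
    (hf : ∀ (g : G) x, f (g • x) = W.π g (f x))
    (hd : Dense (Submodule.span ℂ (Set.range f) : Set W.carrier)) {n : G}
    (h : ∀ y z, inner ℂ (f y) (f (n • z) - f z) = 0) : W.π n = 1 := by
  have hfix : ∀ z, W.π n (f z) = f z := fun z => by
    rw [← hf, ← sub_eq_zero]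
    exact eq_zero_of_inner_total hd fun y => inner_eq_zero_symm.1 (h y z)
  refine LinearIsometryEquiv.ext fun v => ?_
  refine hd.induction (P := fun v => W.π n v = (1 : W.carrier ≃ₗᵢ[ℂ] W.carrier) v)
    (fun v hv => ?_) (isClosed_eq (W.π n).continuous continuous_id) v
  induction hv using Submodule.span_induction with
  | mem x hx =>
    obtain ⟨z, rfl⟩ := hx
    exact hfix z
  | zero => exact map_zero _
  | add x y _ _ hx hy => rw [map_add, hx, hy, map_add]
  | smul c x _ hx =>
    rw [map_smul, hx]
    rfl

end KernelAlgebra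

namespace Summand

open GComplex GComplex.QuotCat IsOrbitFunctor UnitaryRep

variable {G : Type u} {V : Type v} [Group G] [TopologicalSpace G] [IsTopologicalGroup G]
  [LocallyCompactSpace G] [T2Space G] [MeasurableSpace G]
  [BorelSpace G] (μ : Measure G) [μ.IsHaarMeasure] [μ.IsMulRightInvariant] [MulAction G V]
  {X : GComplex G V} {S : X.QuotCat ⥤ Type u} {F : X.QuotCat ⥤ PHil.{u}} (M : Summand S F)
  [CompactOpenStabilizers G (Fiber S)]

/-- A representation with finite action is contained in the regular representation modulo its
kernel, whose equivariant families are coinvariants. -/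
theorem inTrivialSpectrum_rep (hS : IsOrbitFunctor S) {t : ℕ} (R : OrbitReps G (Fiber S) t)
    {W : UnitaryRep G} (hW : W.IsIrreducible)
    [Nontrivial ((M.kernelAlgebra μ hS).rep R W).carrier] (hfin : W.HasFiniteAction) :
    InTrivialSpectrum F ((M.kernelAlgebra μ hS).rep R W) := by
  have := finiteIndex_ker hfin
  exact ⟨MonoidHom.ker W.π, isOpen_ker hfin, this, _,
    M.isCoinvariants_rep μ _ (isOpen_ker hfin) hS R,
    (M.kernelAlgebra μ hS).isWeaklyContained_rep R hW
      (isWeaklyContained_of_isContained (hW.isContained_regular hfin))⟩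

/-- The operators `transport` for the pairs `(y, n z)` and `(y, z)`, with `n` in a normal subgroup
of finite index, have the same effect on coinvariants. This forces the subgroup to act trivially. -/
theorem hasFiniteAction_of_inTrivialSpectrum (hS : IsOrbitFunctor S) {t : ℕ}
    (R : OrbitReps G (Fiber S) t) {W : UnitaryRep G} (hW : W.IsIrreducible)
    [Nontrivial ((M.kernelAlgebra μ hS).rep R W).carrier]
    (h : InTrivialSpectrum F ((M.kernelAlgebra μ hS).rep R W)) : W.HasFiniteAction := by
  obtain ⟨N, hN, hfin, U, ⟨e, he⟩, hWU⟩ := h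
  set D := M.kernelAlgebra μ hS
  have hN₀c : IsClosed (N.normalCore : Set G) :=
    N.normalCore_isClosed (Subgroup.isClosed_of_isOpen N hN)
  have hN₀ : IsOpen (N.normalCore : Set G) := N.normalCore.isOpen_of_isClosed_of_finiteIndex hN₀c
  obtain ⟨e₀, he₀⟩ := M.isCoinvariants_rep μ N.normalCore hN₀ hS R
  obtain ⟨w, hw⟩ := exists_ne (0 : (D.rep R W).carrier)
  refine hasFiniteAction_of_le_ker (N := N.normalCore) fun n hn =>
    KernelAlgebra.π_eq_one_of_inner (D.family_mem R w).1
      (hW.dense_span (D.family_mem R w).1 (D.family_ne_zero R hw)) fun y z => ?_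
  obtain ⟨c, hc⟩ := D.exists_inner_ρ_eq_sub R y z (n • z)
  -- `c` kills the coinvariants of the normal core, hence the smaller space of coinvariants of `N`,
  -- and by weak containment its matrix coefficients on the representation of `W` vanish
  have h1 : ∀ u, (D.rep R (regular N.normalCore hN₀)).ρ c u = 0 := by
    intro u
    refine ext_inner_left ℂ fun u' => ?_
    have hu := (D.family_mem R u).1 n z
    rw [regular_π_of_mem _ _ hn] at hu
    rw [hc, hu, sub_self, inner_zero_right, inner_zero_right]
  have h2 : ∀ φ, c.1 (base X) φ ∈ coinvKer F N := by
    intro φ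
    have h3 := he₀ c φ
    rw [h1] at h3
    have h4 := e₀.injective (h3.trans (map_zero e₀).symm)
    rw [← LinearMap.mem_ker, Submodule.ker_mkQ] at h4
    refine Submodule.span_mono ?_ h4
    rintro _ ⟨ψ, g, hg, rfl⟩
    exact ⟨ψ, g, N.normalCore_le hg, rfl⟩
  have h3 : ∀ u, U.ρ c u = 0 := by
    intro u
    obtain ⟨q, rfl⟩ := e.surjective u
    obtain ⟨φ, rfl⟩ := Submodule.mkQ_surjective _ q
    rw [← he, LinearMap.mem_ker.1 (by rw [Submodule.ker_mkQ]; exact h2 φ), map_zero]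
  have h4 : (D.rep R W).coef w c = 0 := by
    have hcl : IsClosed {d : opAlgebra F → ℂ | d c = 0} :=
      isClosed_eq (continuous_apply c) continuous_const
    refine closure_minimal ?_ hcl (hWU.coef_mem w)
    rintro _ ⟨u, rfl⟩
    change inner ℂ u (U.ρ c u) = 0
    rw [h3, inner_zero_right]
  exact (hc W w w).symm.trans h4

/-- The Ramanujan property, in terms of the irreducible representations of `G` that have nonzero
equivariant families of vectors. -/
theorem fRamanujan_iff (hS : IsOrbitFunctor S) {t : ℕ} (R : OrbitReps G (Fiber S) t)
    (A : X.QuotCat) : FRamanujan F A ↔ ∀ W : UnitaryRep G, W.IsIrreducible →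
      W.IsWeaklyContained (X.L2Quotient A.isQuotient μ) →
      Nontrivial ((M.kernelAlgebra μ hS).rep R W).carrier →
      X.IsTempered μ W ∨ W.HasFiniteAction := by
  set D := M.kernelAlgebra μ hS
  constructor
  · intro hA W hW hWA hnt
    rcases hA _ (D.isIrreducible_rep R hW)
      ((M.inSpectrum_iff μ hS R).2 (D.isWeaklyContained_rep R hW hWA)) with h | h
    · left
      rw [M.inSpectrum_iff μ hS R] at h
      obtain ⟨w, hw⟩ := exists_ne (0 : (D.rep R W).carrier)
      exact D.isWeaklyContained_of_coef_mem R
        (hW.dense_span (D.family_mem R w).1 (D.family_ne_zero R hw)) (h.coef_mem w)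
    · right
      exact M.hasFiniteAction_of_inTrivialSpectrum μ hS R hW h
  · intro h W hW hWA
    have := hW.1
    obtain ⟨w, hw⟩ := exists_ne (0 : W.carrier)
    have hc := ((M.inSpectrum_iff μ hS R).1 hWA).coef_mem w
    obtain ⟨Z, hZ, f, hf, hfw⟩ := D.exists_irreducible_of_coef_mem R hW hw hc
    have hf0 : f ≠ 0 := by
      rintro rfl
      have h1 := congrFun hfw 1
      rw [AlgRep.coef_one, AlgRep.coef_one, norm_zero] at h1
      have h2 : (‖w‖ : ℂ) ^ 2 = 0 := by rw [← h1]; simp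
      exact hw (norm_eq_zero.1 (by exact_mod_cast pow_eq_zero_iff two_ne_zero |>.1 h2))
    have hnt : Nontrivial (D.rep R Z).carrier := ⟨f, 0, hf0⟩
    have hZA : Z.IsWeaklyContained (X.L2Quotient A.isQuotient μ) :=
      D.isWeaklyContained_of_coef_mem R hf (hfw ▸ hc)
    have htransfer : ∀ U : AlgRep (opAlgebra F), (D.rep R Z).IsWeaklyContained U →
        W.IsWeaklyContained U := fun U hU =>
      hW.isWeaklyContained hw (hfw ▸ hU.coef_mem f)
    rcases h Z hZ hZA hnt with h1 | h1
    · left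
      rw [M.inSpectrum_iff μ hS R]
      exact htransfer _ (D.isWeaklyContained_rep R hZ h1)
    · right
      obtain ⟨N, hN, hNf, U, hU, hZU⟩ := M.inTrivialSpectrum_rep μ hS R hZ h1
      exact ⟨N, hN, hNf, U, hU, htransfer U hZU⟩

/-- If `ι` is onto, the families are all the equivariant ones: their values at the representatives
are arbitrary vectors fixed by the stabilizers. -/
theorem nontrivial_rep_iff (hS : IsOrbitFunctor S) {t : ℕ} (R : OrbitReps G (Fiber S) t)
    (hM : ∀ φ, M.ιX (M.pX φ) = φ) (W : UnitaryRep G) :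
    Nontrivial ((M.kernelAlgebra μ hS).rep R W).carrier ↔
      (⨆ n : Fin t, W.fixed (MulAction.stabilizer G (R.rep n))) ≠ ⊥ := by
  set D := M.kernelAlgebra μ hS
  have hΨ : ∀ φ, D.Ψ 1 φ = φ := fun φ => by
    rw [Ψ_kernelAlgebra, star_one, conjOp_apply, op_one, hM, conjF_conjF]
  rw [Ne, iSup_eq_bot, not_forall]
  constructor
  · rintro ⟨h, h', hne⟩
    have h0 : D.family R (h - h') ≠ 0 := D.family_ne_zero R (sub_ne_zero.2 hne)
    have hf := D.family_mem R (h - h')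
    by_contra! hcon
    refine h0 (funext fun x => ?_)
    have hx := hf.1 (R.elt x) (R.rep (R.idx x))
    rw [R.elt_smul] at hx
    have hfix : D.family R (h - h') (R.rep (R.idx x)) ∈
        W.fixed (MulAction.stabilizer G (R.rep (R.idx x))) := fun k hk => by
      rw [← hf.1, MulAction.mem_stabilizer_iff.1 hk]
    rw [hcon, Submodule.mem_bot] at hfix
    rw [hx, hfix, map_zero]
    rfl
  · rintro ⟨n, hn⟩
    obtain ⟨v, hv, hv0⟩ := Submodule.exists_mem_ne_zero_of_ne_bot hn
    obtain ⟨h, hh, -⟩ := D.exists_coef_eq_bumpCoef R hv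
    refine ⟨h, 0, fun h0 => hv0 ?_⟩
    have h1 := congrFun hh (R.rep n)
    rw [h0, D.family_zero] at h1
    have h2 : D.act W 1 (KernelAlgebra.bump R n v) (R.rep n) =
        Finsupp.linearCombination ℂ (KernelAlgebra.bump R n v)
          (D.Ψ 1 (Finsupp.single (R.rep n) 1)) := rfl
    rw [h2, hΨ, Finsupp.linearCombination_single, one_smul, KernelAlgebra.bump_rep R hv,
      if_pos rfl] at h1
    exact h1.symm

end Summand

/-! ### The elementary functor of a small compact open subgroup -/

section CosetFunctor

open GComplex GComplex.QuotCat

variable {G : Type u} {V : Type v} [Group G] [TopologicalSpace G] [MulAction G V]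
  {X : GComplex G V}

/-- If `h` induces the identity on `Γ \ X` and fixes a vertex, then `h = 1`, since covering maps
have unique lifts. -/
theorem eq_one_of_mkVertex {Γ : Subgroup G} (hΓ : X.IsQuotient Γ) {h : G}
    (hmk : ∀ v, mkVertex V Γ (h • v) = mkVertex V Γ v) {x : V} (hx : h • x = x) : h = 1 := by
  refine X.faithful h fun y => ?_
  induction X.connected x y with
  | refl => exact hx
  | @tail b c _ hbc ih =>
    obtain ⟨s, hs, hb, hc⟩ := hbc
    have hs' : cellSMul h s = s :=
      (hΓ.isCoverMap.bijOn_star b).injOn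
        ⟨X.smul_mem h s hs, mem_cellSMul.2 ⟨b, hb, ih⟩⟩ ⟨hs, hb⟩
        (cellImage_cellSMul _ h hmk s)
    have hhc : h • c ∈ s := by
      rw [← hs']
      exact mem_cellSMul.2 ⟨c, hc, rfl⟩
    exact hΓ.isCoverMap.injOn s hs hhc hc (hmk c)

theorem mul_inv_mem_of_mkVertex {Γ : Subgroup G} (hΓ : X.IsQuotient Γ) {g g' : G}
    (h : ∀ v, mkVertex V Γ (g • v) = mkVertex V Γ (g' • v)) : g' * g⁻¹ ∈ Γ := by
  rcases isEmpty_or_nonempty V with hV | ⟨⟨x⟩⟩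
  · have := X.subsingleton_of_isEmpty
    rw [Subsingleton.elim (g' * g⁻¹) 1]
    exact Γ.one_mem
  · obtain ⟨γ, hγ, e⟩ := mkVertex_eq.1 (h (g⁻¹ • x))
    rw [smul_inv_smul] at e
    have h1 : γ * (g' * g⁻¹) = 1 := by
      refine eq_one_of_mkVertex hΓ (fun v => ?_) (x := x) ?_
      · rw [mul_smul]
        refine (mkVertex_eq.2 ⟨γ, hγ, rfl⟩).trans ?_
        rw [mul_smul, ← h, smul_inv_smul]
      · rw [mul_smul, mul_smul, e]
    rw [eq_inv_of_mul_eq_one_right h1]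
    exact Γ.inv_mem hγ

theorem exists_lift {A B : X.QuotCat} (f : A ⟶ B) :
    ∃ g : G, ∀ v, f.1 (mkVertex V A.Γ v) = mkVertex V B.Γ (g • v) := by
  rcases f.2 with ⟨-, h⟩ | ⟨-, g, h⟩
  · exact ⟨1, fun v => by rw [h, one_smul]⟩
  · exact ⟨g, h⟩

/-- A group element inducing a morphism. -/
def lift {A B : X.QuotCat} (f : A ⟶ B) : G := (exists_lift f).choose

theorem lift_spec {A B : X.QuotCat} (f : A ⟶ B) (v : V) :
    f.1 (mkVertex V A.Γ v) = mkVertex V B.Γ (lift f • v) := (exists_lift f).choose_spec v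

theorem mul_lift_inv_mem {A B : X.QuotCat} (f : A ⟶ B) {g : G}
    (h : ∀ v, f.1 (mkVertex V A.Γ v) = mkVertex V B.Γ (g • v)) : g * (lift f)⁻¹ ∈ B.Γ :=
  mul_inv_mem_of_mkVertex B.isQuotient fun v => by rw [← lift_spec, h]

variable (K : Subgroup G)

theorem mkVertex_smul_of_mul_inv_mem {Γ : Subgroup G} {Y : Type*} [MulAction G Y] {g g' : G}
    (h : g' * g⁻¹ ∈ Γ) (y : Y) : mkVertex Y Γ (g' • y) = mkVertex Y Γ (g • y) :=
  mkVertex_eq.2 ⟨_, h, by rw [← mul_smul, inv_mul_cancel_right]⟩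

/-- The map `Γ h K ↦ Γ' g h K` induced by a morphism `Γ \ X → Γ' \ X` with lift `g`. -/
def cosetMap {A B : X.QuotCat} (f : A ⟶ B) :
    MulAction.orbitRel.Quotient A.Γ (G ⧸ K) → MulAction.orbitRel.Quotient B.Γ (G ⧸ K) :=
  Quotient.lift (fun c : G ⧸ K => mkVertex (G ⧸ K) B.Γ (lift f • c)) fun a b hab => by
    obtain ⟨γ, rfl⟩ := MulAction.orbitRel_apply.1 hab
    have h := mul_lift_inv_mem f (g := lift f * γ) fun v => by
      rw [mul_smul, ← lift_spec]
      exact congrArg f.1 (mkVertex_eq.2 ⟨(γ : G)⁻¹, A.Γ.inv_mem γ.2, inv_smul_smul _ _⟩)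
    have e : lift f • γ • b = (lift f * (γ : G)) • b := (mul_smul _ _ _).symm
    change mkVertex (G ⧸ K) B.Γ (lift f • γ • b) = _
    rw [e]
    exact mkVertex_smul_of_mul_inv_mem h b

theorem cosetMap_mk {A B : X.QuotCat} (f : A ⟶ B) {g : G}
    (h : ∀ v, f.1 (mkVertex V A.Γ v) = mkVertex V B.Γ (g • v)) (c : G ⧸ K) :
    cosetMap K f (mkVertex (G ⧸ K) A.Γ c) = mkVertex (G ⧸ K) B.Γ (g • c) :=
  (mkVertex_smul_of_mul_inv_mem (mul_lift_inv_mem f h) c).symm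

/-- The functor `Γ \ X ↦ Γ \ G / K`. -/
def cosetFunctor (X : GComplex G V) (K : Subgroup G) : X.QuotCat ⥤ Type u where
  obj A := MulAction.orbitRel.Quotient A.Γ (G ⧸ K)
  map f := TypeCat.ofHom (cosetMap K f)
  map_id A := by
    ext q
    obtain ⟨c, rfl⟩ := mkVertex_surjective _ q
    refine (cosetMap_mk K (𝟙 A) (g := 1) (fun v => ?_) c).trans ?_
    · rw [one_smul]
      rfl
    · rw [one_smul]
      rfl
  map_comp {A B C} f f' := by
    ext q
    obtain ⟨c, rfl⟩ := mkVertex_surjective _ q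
    change cosetMap K (f ≫ f') (mkVertex (G ⧸ K) A.Γ c) =
      cosetMap K f' (cosetMap K f (mkVertex (G ⧸ K) A.Γ c))
    rw [cosetMap_mk K f (lift_spec f), cosetMap_mk K f' (lift_spec f'), ← mul_smul]
    refine cosetMap_mk K (f ≫ f') (fun v => ?_) c
    change f'.1 (f.1 _) = _
    rw [lift_spec f, lift_spec f', mul_smul]

/-- The coset `g K` as a point of `S(X)`. -/
def cosetPoint (X : GComplex G V) (K : Subgroup G) (c : G ⧸ K) : Fiber (cosetFunctor X K) :=
  mkVertex (G ⧸ K) (⊥ : Subgroup G) c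

theorem cosetPoint_surjective : Function.Surjective (cosetPoint X K) := mkVertex_surjective _

theorem cosetPoint_injective : Function.Injective (cosetPoint X K) := fun a b h => by
  obtain ⟨γ, hγ, e⟩ := mkVertex_eq.1 h
  rw [Subgroup.mem_bot.1 hγ, one_smul] at e
  exact e.symm

theorem projMul_mk (A : X.QuotCat) (g : G) (v : V) :
    (projMul A g).1 (mkVertex V (⊥ : Subgroup G) v) = mkVertex V A.Γ (g • v) := rfl

theorem map_projMul_cosetPoint (A : X.QuotCat) (g : G) (c : G ⧸ K) :
    (cosetFunctor X K).map (projMul A g) (cosetPoint X K c) = mkVertex (G ⧸ K) A.Γ (g • c) :=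
  cosetMap_mk K (projMul A g) (projMul_mk A g) c

theorem smul_cosetPoint (g : G) (c : G ⧸ K) : g • cosetPoint X K c = cosetPoint X K (g • c) :=
  map_projMul_cosetPoint K (base X) g c

theorem map_proj_cosetPoint (A : X.QuotCat) (c : G ⧸ K) :
    (cosetFunctor X K).map (proj A) (cosetPoint X K c) = mkVertex (G ⧸ K) A.Γ c := by
  rw [proj, map_projMul_cosetPoint, one_smul]

theorem stabilizer_cosetPoint (g : G) :
    (MulAction.stabilizer G (cosetPoint X K (g : G ⧸ K)) : Set G) =
      (fun h => g⁻¹ * h * g) ⁻¹' (K : Set G) := by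
  ext h
  rw [SetLike.mem_coe, MulAction.mem_stabilizer_iff, smul_cosetPoint,
    (cosetPoint_injective K).eq_iff]
  change ((h * g : G) : G ⧸ K) = g ↔ _
  rw [eq_comm, QuotientGroup.eq, Set.mem_preimage, SetLike.mem_coe, mul_assoc]

/-- Points of `S(X)` are cosets `g K`, whose stabilizers `g K g⁻¹` fix the vertex `g x`; all of them
form one `G`-orbit. -/
theorem elementaryBy_cosetFunctor [IsTopologicalGroup G] (hK : IsOpen (K : Set G))
    (hKc : IsCompact (K : Set G)) {x : V} (hx : K ≤ MulAction.stabilizer G x) :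
    ElementaryBy (cosetFunctor X K) (cosetFunctor X K ⋙ finL2Functor) where
  exists_iso := ⟨Iso.refl _, fun _ _ _ => rfl⟩
  isCompact_stabilizer y := by
    obtain ⟨c, rfl⟩ := cosetPoint_surjective K y
    obtain ⟨g, rfl⟩ := QuotientGroup.mk_surjective c
    rw [stabilizer_cosetPoint]
    exact ((Homeomorph.mulLeft g⁻¹).trans (Homeomorph.mulRight g)).isCompact_preimage.2 hKc
  isOpen_stabilizer y := by
    obtain ⟨c, rfl⟩ := cosetPoint_surjective K y
    obtain ⟨g, rfl⟩ := QuotientGroup.mk_surjective c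
    rw [stabilizer_cosetPoint]
    exact hK.preimage (by fun_prop)
  stabilizer_le y := by
    obtain ⟨c, rfl⟩ := cosetPoint_surjective K y
    obtain ⟨g, rfl⟩ := QuotientGroup.mk_surjective c
    refine ⟨⟨{g • x}, X.singleton_mem _⟩, fun h hh => ?_⟩
    rw [← SetLike.mem_coe, stabilizer_cosetPoint] at hh
    have h1 : (g⁻¹ * h * g) • x = x := hx hh
    refine Subtype.ext ?_
    change cellSMul h {g • x} = {g • x}
    rw [cellSMul_singleton, ← mul_smul]
    rw [mul_assoc, mul_smul, inv_smul_eq_iff] at h1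
    rw [h1]
  proj_surjective A q := by
    obtain ⟨c, rfl⟩ := mkVertex_surjective _ q
    exact ⟨cosetPoint X K c, map_proj_cosetPoint K A c⟩
  proj_eq_iff A y z := by
    obtain ⟨c, rfl⟩ := cosetPoint_surjective K y
    obtain ⟨d, rfl⟩ := cosetPoint_surjective K z
    rw [map_proj_cosetPoint, map_proj_cosetPoint]
    refine (eq_comm.trans (mkVertex_eq (Γ := A.Γ) (x := d) (y := c))).trans ?_
    simp only [smul_cosetPoint, (cosetPoint_injective K).eq_iff]
  finite_orbits := by
    have : Subsingleton (MulAction.orbitRel.Quotient G (Fiber (cosetFunctor X K))) := by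
      refine ⟨fun a b => ?_⟩
      obtain ⟨y, rfl⟩ := Quotient.mk''_surjective a
      obtain ⟨z, rfl⟩ := Quotient.mk''_surjective b
      obtain ⟨c, rfl⟩ := cosetPoint_surjective K y
      obtain ⟨d, rfl⟩ := cosetPoint_surjective K z
      obtain ⟨g, e⟩ := MulAction.exists_smul_eq G d c
      exact Quotient.sound' ⟨g, by
        change g • cosetPoint X K d = cosetPoint X K c
        rw [smul_cosetPoint, e]⟩
    exact Finite.of_subsingleton

theorem IsElementary.isSemiElementary {F : X.QuotCat ⥤ PHil.{u}} (hF : IsElementary F) :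
    IsSemiElementary F := by
  obtain ⟨S, hS⟩ := hF
  -- the complement is the zero functor, that is, functions on the empty set
  let F' : X.QuotCat ⥤ PHil.{u} := (Functor.const _).obj PEmpty.{u + 1} ⋙ finL2Functor
  have hF' : ∀ (A : X.QuotCat) (v : (F'.obj A).carrier), v = 0 := fun A v =>
    Finsupp.ext (α := PEmpty.{u + 1}) fun y => y.elim
  obtain ⟨η, hη⟩ := hS.exists_iso
  let θ : F ≅ directSum F F' := NatIso.ofComponents (fun A =>
    { hom := (((WithLp.linearEquiv 2 ℂ ((F.obj A).carrier × (F'.obj A).carrier)).symm.toLinearMap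
        ∘ₗ LinearMap.inl ℂ _ _ : (F.obj A).carrier →ₗ[ℂ] _))
      inv := ((LinearMap.fst ℂ _ _ ∘ₗ
        (WithLp.linearEquiv 2 ℂ ((F.obj A).carrier × (F'.obj A).carrier)).toLinearMap :
          WithLp 2 ((F.obj A).carrier × (F'.obj A).carrier) →ₗ[ℂ] (F.obj A).carrier))
      hom_inv_id := LinearMap.ext fun v => rfl
      inv_hom_id := LinearMap.ext fun v => by
        change WithLp.toLp 2 (v.fst, 0) = v
        rw [← hF' A v.snd]
        rfl }) fun {A B} f => LinearMap.ext fun v => by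
      change WithLp.toLp 2 (PHil.lin (F.map f) v, (0 : (F'.obj B).carrier)) =
        WithLp.toLp 2 (PHil.lin (F.map f) v, PHil.lin (F'.map f) 0)
      rw [map_zero]
  refine ⟨F', S, ⟨⟨η ≪≫ θ, fun A φ ψ => ?_⟩, hS.isCompact_stabilizer, hS.isOpen_stabilizer,
    hS.stabilizer_le, hS.proj_surjective, hS.proj_eq_iff, hS.finite_orbits⟩⟩
  rw [← hη A φ ψ]
  refine (WithLp.prod_inner_apply (𝕜 := ℂ) (E := (F.obj A).carrier) (F := (F'.obj A).carrier)
    (WithLp.toLp 2 (PHil.lin (η.hom.app A) φ, 0))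
    (WithLp.toLp 2 (PHil.lin (η.hom.app A) ψ, 0))).trans ?_
  simp

end CosetFunctor

/-! ### The Ramanujan property in terms of representations of the group -/

section Criteria

open GComplex GComplex.QuotCat

variable {G : Type u} {V : Type v} [Group G] [TopologicalSpace G] [IsTopologicalGroup G]
  [LocallyCompactSpace G] [T2Space G] [MeasurableSpace G] [BorelSpace G]
  (μ : Measure G) [μ.IsHaarMeasure] [μ.IsMulRightInvariant] [MulAction G V] {X : GComplex G V}

theorem ElementaryBy.fRamanujan_iff {S : X.QuotCat ⥤ Type u} {F : X.QuotCat ⥤ PHil.{u}}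
    (hS : ElementaryBy S F) {t : ℕ} (R : OrbitReps G (Fiber S) t) (A : X.QuotCat) :
    FRamanujan F A ↔ ∀ W : UnitaryRep G, W.IsIrreducible →
      W.IsWeaklyContained (X.L2Quotient A.isQuotient μ) →
      (⨆ n, W.fixed (MulAction.stabilizer G (R.rep n))) ≠ ⊥ →
      X.IsTempered μ W ∨ W.HasFiniteAction := by
  have := hS.compactOpenStabilizers
  obtain ⟨M, hM⟩ := hS.exists_summand
  simp_rw [M.fRamanujan_iff μ hS.isOrbitFunctor R A,
    M.nontrivial_rep_iff μ hS.isOrbitFunctor R fun φ => hM (base X) φ]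

theorem UnitaryRep.hasFiniteAction_of_subsingleton [Subsingleton G] (W : UnitaryRep G) :
    W.HasFiniteAction := Set.finite_range W.π

/-- Every irreducible representation is seen by the elementary functor `Γ \ X ↦ Γ \ G / K` of a
small subgroup `K`. -/
theorem completelyRamanujan_iff [TotallyDisconnectedSpace G] (A : X.QuotCat) :
    CompletelyRamanujan A ↔ ∀ W : UnitaryRep G, W.IsIrreducible →
      W.IsWeaklyContained (X.L2Quotient A.isQuotient μ) →
      X.IsTempered μ W ∨ W.HasFiniteAction := by
  constructor
  · intro h W hW hWA
    rcases isEmpty_or_nonempty V with hV | ⟨⟨x⟩⟩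
    · have := X.subsingleton_of_isEmpty
      exact Or.inr W.hasFiniteAction_of_subsingleton
    have := hW.1
    -- a subgroup which is small enough for `W` to have nonzero fixed vectors
    obtain ⟨K, hKx, hK, hKc, hWK⟩ := W.exists_fixed_ne_bot μ (K₀ := MulAction.stabilizer G x)
      (X.isOpen_smul_eq x) (X.isCompact_smul_eq x)
    have hS := elementaryBy_cosetFunctor (X := X) K hK hKc hKx
    obtain ⟨t, ⟨R⟩⟩ := exists_orbitReps hS.finite_orbits
    refine (hS.fRamanujan_iff μ R A).1 (h _ (IsElementary.isSemiElementary ⟨_, hS⟩)) W hW hWA ?_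
    -- the stabilizer of the representative of the orbit is conjugate to `K`
    obtain ⟨n, ⟨g, hg⟩, -⟩ := R.existsUnique (cosetPoint X K ((1 : G) : G ⧸ K))
    obtain ⟨w, hw, hw0⟩ := (Submodule.ne_bot_iff _).1 hWK
    intro hbot
    have hmem : W.π g⁻¹ w ∈ W.fixed (MulAction.stabilizer G (R.rep n)) := fun k hk => by
      have hk' : g * k * g⁻¹ ∈ K := by
        have : g * k * g⁻¹ ∈
            (MulAction.stabilizer G (cosetPoint X K ((1 : G) : G ⧸ K)) : Set G) := by
          rw [SetLike.mem_coe, MulAction.mem_stabilizer_iff, ← hg]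
          change (g * k * g⁻¹) • g • R.rep n = g • R.rep n
          rw [← mul_smul, inv_mul_cancel_right, mul_smul, MulAction.mem_stabilizer_iff.1 hk]
        rw [stabilizer_cosetPoint] at this
        simpa using this
      have e := congrArg (W.π g⁻¹) (hw _ hk')
      rwa [← W.π_mul, mul_assoc, inv_mul_cancel_left, W.π_mul] at e
    have h0 : W.π g⁻¹ w = 0 := by
      rw [← Submodule.mem_bot ℂ, ← hbot]
      exact Submodule.mem_iSup_of_mem n hmem
    exact hw0 ((W.π g⁻¹).map_eq_zero_iff.1 h0)
  · rintro h F ⟨F', S, hS⟩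
    have := hS.compactOpenStabilizers
    obtain ⟨M, -⟩ := hS.exists_summand
    obtain ⟨t, ⟨R⟩⟩ := exists_orbitReps hS.finite_orbits
    exact (M.fst.fRamanujan_iff μ hS.isOrbitFunctor R A).2 fun W hW hWA _ => h W hW hWA

end Criteria

/-! ### Finite quotients -/

section FiniteQuotient

variable {G : Type u} [Group G] [TopologicalSpace G]

theorem UnitaryRep.continuous_coef (H : UnitaryRep G) : Continuous H.coef :=
  continuous_pi fun g => continuous_id.inner (H.π g).continuous

/-- If `H^K` is finite-dimensional, then a positive definite function which is a limit of
coefficients of bounded vectors of `H^K` is itself such a coefficient; hence weak containment is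
containment. -/
theorem UnitaryRep.IsIrreducible.isContained_of_finiteDimensional_fixed [IsTopologicalGroup G]
    [T2Space G] [MeasurableSpace G] [BorelSpace G] (μ : Measure G) [μ.IsHaarMeasure]
    {V H : UnitaryRep G} (hV : V.IsIrreducible) (hVH : V.IsWeaklyContained H) {K : Subgroup G}
    (hK : IsOpen (K : Set G)) (hKc : IsCompact (K : Set G)) (hVK : V.fixed K ≠ ⊥)
    [FiniteDimensional ℂ (H.fixed K)] : V.IsContained H := by
  obtain ⟨v, hv, hv0⟩ := (Submodule.ne_bot_iff _).1 hVK
  have hc : IsCompact {p | p ∈ H.fixed K ∧ ‖p‖ ≤ ‖v‖ + 1} := by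
    have h := (isCompact_closedBall (0 : H.fixed K) (‖v‖ + 1)).image continuous_subtype_val
    convert h using 1
    ext p
    constructor
    · rintro ⟨hp, hpn⟩
      exact ⟨⟨p, hp⟩, mem_closedBall_zero_iff.2 hpn, rfl⟩
    · rintro ⟨q, hq, rfl⟩
      exact ⟨q.2, mem_closedBall_zero_iff.1 hq⟩
  have hcoef := hVH.coef_mem_closure_fixed μ hK hKc hv
  rw [(hc.image H.continuous_coef).isClosed.closure_eq] at hcoef
  obtain ⟨p, -, hp⟩ := hcoef
  have hgram : ∀ g h : G, inner ℂ (V.π g v) (V.π h v) = inner ℂ (H.π g p) (H.π h p) := by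
    intro g h
    have e := congrFun hp (g⁻¹ * h)
    rw [← V.π_apply_inv g (V.π h v), LinearIsometryEquiv.inner_map_map, ← V.π_mul,
      ← H.π_apply_inv g (H.π h p), LinearIsometryEquiv.inner_map_map, ← H.π_mul]
    exact e.symm
  have hd : Dense (Submodule.span ℂ (Set.range fun g : G => V.π g v) : Set V.carrier) :=
    hV.dense_span (Ω := G) (fun g h => V.π_mul g h v) fun h => hv0 (by
      have := congrFun h 1
      rwa [V.π_one] at this)
  obtain ⟨θ, hθ⟩ := exists_linearIsometry_of_gram hd hgram
  refine ⟨θ, fun g w => ?_⟩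
  -- both sides are continuous in `w`, and agree on the orbit of `v`
  have heq : Set.EqOn (fun w => θ (V.π g w)) (fun w => H.π g (θ w))
      (Submodule.span ℂ (Set.range fun g : G => V.π g v)) := by
    intro w hw
    have := LinearMap.eqOn_span (s := Set.range fun g : G => V.π g v)
      (f := θ.toLinearMap ∘ₗ (V.π g).toLinearEquiv.toLinearMap)
      (g := (H.π g).toLinearEquiv.toLinearMap ∘ₗ θ.toLinearMap) (by
        rintro _ ⟨h, rfl⟩
        change θ (V.π g (V.π h v)) = H.π g (θ (V.π h v))
        rw [← V.π_mul, hθ, hθ, H.π_mul]) hw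
    exact this
  exact congrFun (Continuous.ext_on hd (θ.continuous.comp (V.π g).continuous)
    ((H.π g).continuous.comp θ.continuous) heq) w

/-- A totally disconnected group acts on a finite-dimensional representation through a discrete
quotient. -/
theorem UnitaryRep.exists_fixed_eq_top [IsTopologicalGroup G] [T2Space G]
    [TotallyDisconnectedSpace G] [MeasurableSpace G] [BorelSpace G] (μ : Measure G)
    [μ.IsHaarMeasure] (V : UnitaryRep G) [FiniteDimensional ℂ V.carrier] {K₀ : Subgroup G}
    (hK₀ : IsOpen (K₀ : Set G)) (hK₀c : IsCompact (K₀ : Set G)) :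
    ∃ K : Subgroup G, IsOpen (K : Set G) ∧ IsCompact (K : Set G) ∧ V.fixed K = ⊤ := by
  obtain ⟨_, ⟨K, hK, hKc, rfl⟩, hmax⟩ := (wellFounded_gt (α := Submodule ℂ V.carrier)).has_min
    {W | ∃ K : Subgroup G, IsOpen (K : Set G) ∧ IsCompact (K : Set G) ∧ V.fixed K = W}
    ⟨_, K₀, hK₀, hK₀c, rfl⟩
  refine ⟨K, hK, hKc, ?_⟩
  -- `V^K` is maximal, hence contains all smooth vectors, which are dense
  have hle : ∀ K' : Subgroup G, IsOpen (K' : Set G) → V.fixed K' ≤ V.fixed K := by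
    intro K' hK'
    have h1 : V.fixed K ≤ V.fixed (K ⊓ K') := fun w hw k hk => hw k hk.1
    have h2 : V.fixed K' ≤ V.fixed (K ⊓ K') := fun w hw k hk => hw k hk.2
    have h3 := hmax (V.fixed (K ⊓ K')) ⟨K ⊓ K', hK.inter hK',
      hKc.inter_right (Subgroup.isClosed_of_isOpen K' hK'), rfl⟩
    exact h2.trans (h1.eq_of_not_lt h3).ge
  refine
    (Submodule.closed_of_finiteDimensional (V.fixed K)).submodule_topologicalClosure_eq.symm.trans
    ((V.fixed K).dense_iff_topologicalClosure_eq_top.1 fun w => Metric.mem_closure_iff.2 ?_)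
  intro ε hε
  obtain ⟨K', -, hK', -, p, hp, hpw⟩ := V.exists_smooth_near μ hK₀ hK₀c w (half_pos hε)
  refine ⟨p, hle K' hK' hp, ?_⟩
  rw [dist_comm, dist_eq_norm]
  linarith

end FiniteQuotient

namespace RightCosets

variable {G : Type u} [Group G] [TopologicalSpace G] [IsTopologicalGroup G] {Γ : Subgroup G}

theorem mulRight_mul (g h : G) (q : RightCosets Γ) :
    mulRight Γ (g * h) q = mulRight Γ h (mulRight Γ g q) := by
  obtain ⟨x, rfl⟩ := mk_surjective Γ q
  rw [mulRight_mk, mulRight_mk, mulRight_mk, mul_assoc]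

theorem mulRight_one (q : RightCosets Γ) : mulRight Γ 1 q = q := by
  obtain ⟨x, rfl⟩ := mk_surjective Γ q
  rw [mulRight_mk, mul_one]

/-- The equivalence relation on `Γ \ G` whose classes are the orbits of `K`. -/
def orbitSetoid (Γ K : Subgroup G) : Setoid (RightCosets Γ) where
  r q q' := ∃ k ∈ K, mulRight Γ k q = q'
  iseqv :=
    { refl := fun q => ⟨1, K.one_mem, mulRight_one q⟩
      symm := by
        rintro q _ ⟨k, hk, rfl⟩
        exact ⟨k⁻¹, K.inv_mem hk, by rw [← mulRight_mul, mul_inv_cancel, mulRight_one]⟩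
      trans := by
        rintro q _ _ ⟨k, hk, rfl⟩ ⟨l, hl, rfl⟩
        exact ⟨k * l, K.mul_mem hk hl, mulRight_mul k l q⟩ }

variable [SecondCountableTopology G] [MeasurableSpace G] [BorelSpace G]

theorem finite_of_invariant [CompactSpace (RightCosets Γ)] {Y : Type*} {K : Subgroup G}
    (hK : IsOpen (K : Set G)) {f : RightCosets Γ → Y}
    (hf : ∀ k ∈ K, ∀ q, f (mulRight Γ k q) = f q) : (Set.range f).Finite := by
  let : TopologicalSpace Y := ⊥
  have : DiscreteTopology Y := ⟨rfl⟩
  exact (isCompact_range (continuous_of_invariant hK hf)).finite_of_discrete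

variable [T2Space G] [LocallyCompactSpace G] [DiscreteTopology Γ] (μ : Measure G) [μ.IsHaarMeasure]
  [μ.IsMulRightInvariant]

instance : (measure Γ μ).IsOpenPosMeasure := by
  have : Countable Γ := TopologicalSpace.separableSpace_iff_countable.1 inferInstance
  refine ⟨fun U hU hne h0 => ?_⟩
  have hU' : IsOpen (mk Γ ⁻¹' U) := hU.preimage (isOpenQuotientMap_mk Γ).continuous
  have hne' : (mk Γ ⁻¹' U).Nonempty := hne.preimage (mk_surjective Γ)
  refine (hU'.measure_pos μ hne').ne' ?_
  rw [measure, Measure.map_apply (isOpenQuotientMap_mk Γ).continuous.measurable hU.measurableSet,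
    Measure.restrict_apply hU'.measurableSet] at h0
  refine (isFundamentalDomain Γ μ).measure_zero_of_invariant _ (fun γ => ?_) h0
  ext x
  rw [Set.mem_smul_set_iff_inv_smul_mem, Set.mem_preimage, Set.mem_preimage]
  have : mk Γ (γ⁻¹ • x) = mk Γ x := mk_eq_mk.2 (by
    rw [Subgroup.smul_def, smul_eq_mul, mul_inv_rev, mul_inv_cancel_left]
    exact Γ.inv_mem (γ⁻¹).2)
  rw [this]

/-- If `Γ \ G` is compact, then `Γ \ G / K` is finite, and a `K`-invariant vector of `L²(Γ \ G)` is
determined by its integrals over the double cosets. -/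
theorem finiteDimensional_fixed [CompactSpace (RightCosets Γ)] {K : Subgroup G}
    (hK : IsOpen (K : Set G)) (hKc : IsCompact (K : Set G)) :
    FiniteDimensional ℂ ((UnitaryRep.L2RightCosets Γ μ).fixed K) := by
  set ν := measure Γ μ
  let p : RightCosets Γ → Quotient (orbitSetoid Γ K) := Quotient.mk _
  have hp : ∀ k ∈ K, ∀ q, p (mulRight Γ k q) = p q := fun k hk q =>
    Quotient.sound (Setoid.symm' (orbitSetoid Γ K) ⟨k, hk, rfl⟩)
  have hfin : Finite (Quotient (orbitSetoid Γ K)) := by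
    have := finite_of_invariant hK hp
    rw [Set.range_eq_univ.2 Quotient.mk_surjective] at this
    exact Set.finite_univ_iff.1 this
  let : Fintype (Quotient (orbitSetoid Γ K)) := Fintype.ofFinite _
  have hopen : ∀ y, IsOpen (p ⁻¹' {y}) := by
    let : TopologicalSpace (Quotient (orbitSetoid Γ K)) := ⊥
    have : DiscreteTopology (Quotient (orbitSetoid Γ K)) := ⟨rfl⟩
    exact fun y => (isOpen_discrete {y}).preimage (continuous_of_invariant hK hp)
  have hmeas : ∀ y, MeasurableSet (p ⁻¹' {y}) := fun y => (hopen y).measurableSet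
  have hlt : ∀ y, ν (p ⁻¹' {y}) ≠ ⊤ := fun y => measure_ne_top ν _
  let χ : Quotient (orbitSetoid Γ K) → Lp ℂ 2 ν := fun y =>
    indicatorConstLp 2 (hmeas y) (hlt y) (1 : ℂ)
  let T : (UnitaryRep.L2RightCosets Γ μ).carrier →ₗ[ℂ] (Quotient (orbitSetoid Γ K) → ℂ) :=
    LinearMap.pi fun y => (innerSL ℂ (χ y)).toLinearMap
  refine FiniteDimensional.of_injective
    (T ∘ₗ ((UnitaryRep.L2RightCosets Γ μ).fixed K).subtype)
    ((injective_iff_map_eq_zero _).2 fun φ hφ => ?_)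
  obtain ⟨f, hf, hφf⟩ := exists_invariant μ hK hKc φ.2
  have hint : ∀ y, ∫ q in p ⁻¹' {y}, f q ∂ν = 0 := fun y => by
    have h1 : inner ℂ (χ y) (show Lp ℂ 2 ν from φ.1) = 0 := congrFun hφ y
    rw [L2.inner_indicatorConstLp_one] at h1
    rw [← h1]
    exact integral_congr_ae (ae_restrict_of_ae (hφf.symm))
  have hf0 : ∀ q, f q = 0 := by
    intro q
    have h1 : ∫ q' in p ⁻¹' {p q}, f q' ∂ν = ∫ q' in p ⁻¹' {p q}, f q ∂ν := by
      refine setIntegral_congr_fun (hmeas _) fun q' hq' => ?_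
      obtain ⟨k, hk, e⟩ := Quotient.exact (s := orbitSetoid Γ K) hq'
      rw [← e, hf k hk]
    rw [hint, setIntegral_const] at h1
    refine (smul_eq_zero.1 h1.symm).resolve_left fun h0 => ?_
    rw [Measure.real, ENNReal.toReal_eq_zero_iff] at h0
    exact ((hopen (p q)).measure_pos ν ⟨q, rfl⟩).ne' (h0.resolve_right (hlt _))
  refine Subtype.ext ?_
  refine (Lp.eq_zero_iff_ae_eq_zero (f := (show Lp ℂ 2 ν from φ.1))).2 ?_
  filter_upwards [hφf] with q hq
  exact hq.trans (hf0 q)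

/-- If `Γ \ G` is compact, then finite-dimensional subrepresentations of `L²(Γ \ G)` have finite
action: the kernel `N` is open, the vectors are functions on the finite set `Γ N \ G`, and the
normal core of `Γ N` acts trivially on such functions. -/
theorem hasFiniteAction_of_isContained [TotallyDisconnectedSpace G] [CompactSpace (RightCosets Γ)]
    {K₀ : Subgroup G} (hK₀ : IsOpen (K₀ : Set G)) (hK₀c : IsCompact (K₀ : Set G))
    {W : UnitaryRep G} (hW : W.IsFiniteDimensional)
    (hWL : W.IsContained (UnitaryRep.L2RightCosets Γ μ)) : W.HasFiniteAction := by
  have : FiniteDimensional ℂ W.carrier := hW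
  obtain ⟨K, hK, hKc, hKtop⟩ := W.exists_fixed_eq_top μ hK₀ hK₀c
  let N : Subgroup G := MonoidHom.ker W.π
  have hKN : K ≤ N := fun k hk => MonoidHom.mem_ker.2 (LinearIsometryEquiv.ext fun w =>
    (show w ∈ W.fixed K from hKtop ▸ Submodule.mem_top) k hk)
  let M : Subgroup G := Γ ⊔ N
  have hM : M.FiniteIndex := by
    let p : RightCosets Γ → Quotient (QuotientGroup.rightRel M) :=
      Quotient.map' id fun x y h => by
        rw [QuotientGroup.rightRel_apply] at h ⊢
        exact Subgroup.mem_sup_left h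
    have hp : Function.Surjective p := by
      intro y
      obtain ⟨x, rfl⟩ := Quotient.mk_surjective y
      exact ⟨mk Γ x, rfl⟩
    have hpK : ∀ k ∈ K, ∀ q, p (mulRight Γ k q) = p q := by
      intro k hk q
      obtain ⟨x, rfl⟩ := mk_surjective Γ q
      refine Quotient.sound' ?_
      rw [QuotientGroup.rightRel_apply]
      have hn : x * k⁻¹ * x⁻¹ ∈ N :=
        (MonoidHom.normal_ker W.π).conj_mem _ (hKN (K.inv_mem hk)) x
      have := Subgroup.mem_sup_right (S := Γ) hn
      simpa [mul_assoc] using this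
    have hfin := finite_of_invariant hK hpK
    rw [Set.range_eq_univ.2 hp, Set.finite_univ_iff] at hfin
    have : Finite (G ⧸ M) :=
      Finite.of_equiv _ (QuotientGroup.quotientRightRelEquivQuotientLeftRel M)
    exact Subgroup.finiteIndex_of_finite_quotient
  obtain ⟨θ, hθ⟩ := hWL
  refine UnitaryRep.hasFiniteAction_of_le_ker (N := M.normalCore) fun c hc =>
    LinearIsometryEquiv.ext fun w => θ.injective ?_
  change θ (W.π c w) = θ w
  have hfix : ∀ n ∈ N, (UnitaryRep.L2RightCosets Γ μ).π n (θ w) = θ w := fun n hn => by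
    rw [← hθ, MonoidHom.mem_ker.1 hn]
    rfl
  obtain ⟨f, hf, hθf⟩ := exists_invariant μ hK hKc fun k hk => hfix k (hKN hk)
  have hfc : Continuous f := continuous_of_invariant hK hf
  have hmul : ∀ g, (toFn μ ((UnitaryRep.L2RightCosets Γ μ).π g (θ w))) =ᵐ[measure Γ μ]
      f ∘ mulRight Γ g := fun g =>
    (coeFn_π μ g (θ w)).trans
      ((measurePreserving_mulRight Γ μ g).quasiMeasurePreserving.ae_eq_comp hθf)
  -- almost everywhere equal continuous functions agree
  have hfN : ∀ n ∈ N, ∀ q, f (mulRight Γ n q) = f q := by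
    intro n hn
    have h := hmul n
    rw [hfix n hn] at h
    exact congrFun ((hfc.comp ((continuous_mulRight Γ).comp
      (Continuous.prodMk_right n))).ae_eq_iff_eq (measure Γ μ) hfc |>.1 (h.symm.trans hθf))
  have hfM : ∀ q, f (mulRight Γ c q) = f q := by
    intro q
    obtain ⟨x, rfl⟩ := mk_surjective Γ q
    have hx : x * c * x⁻¹ ∈ M := hc x
    rw [← SetLike.mem_coe, Subgroup.mul_normal Γ N] at hx
    obtain ⟨γ, hγ, n, hn, e⟩ := hx
    have e' : mk Γ (x * c) = mk Γ (x * (x⁻¹ * n * x)) := mk_eq_mk.2 (by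
      have : x * c = γ * n * x := by
        change γ * n = _ at e
        rw [e]
        group
      rw [this]
      convert Γ.inv_mem hγ using 1
      group)
    rw [mulRight_mk, e', ← mulRight_mk]
    refine hfN _ ?_ _
    have := (MonoidHom.normal_ker W.π).conj_mem n hn x⁻¹
    rwa [inv_inv] at this
  rw [hθ]
  refine Lp.ext (f := ((UnitaryRep.L2RightCosets Γ μ).π c (θ w) : Lp ℂ 2 (measure Γ μ)))
    (g := (θ w : Lp ℂ 2 (measure Γ μ))) ?_
  refine (hmul c).trans (Filter.EventuallyEq.trans ?_ hθf.symm)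
  exact Filter.Eventually.of_forall hfM

end RightCosets

namespace GComplex

variable {G : Type u} {V : Type v} [Group G] [TopologicalSpace G] [MulAction G V]

theorem exists_isOpen_isCompact (X : GComplex G V) :
    ∃ K : Subgroup G, IsOpen (K : Set G) ∧ IsCompact (K : Set G) := by
  rcases isEmpty_or_nonempty V with hV | ⟨⟨x⟩⟩
  · have := X.subsingleton_of_isEmpty
    exact ⟨⊤, isOpen_univ, (Set.subsingleton_of_subsingleton (s := Set.univ)).isCompact⟩
  · exact ⟨MulAction.stabilizer G x, X.isOpen_smul_eq x, X.isCompact_smul_eq x⟩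

/-- `Γ \ G` is covered by the images of finitely many cosets of the stabilizer of a vertex `x`, one
for each `Γ`-orbit in `G x`. -/
theorem IsFiniteQuotient.compactSpace [IsTopologicalGroup G] {X : GComplex G V} {Γ : Subgroup G}
    (h : X.IsFiniteQuotient Γ) : CompactSpace (RightCosets Γ) := by
  rcases isEmpty_or_nonempty V with hV | ⟨⟨x⟩⟩
  · have := X.subsingleton_of_isEmpty
    have : Subsingleton (RightCosets Γ) := (RightCosets.mk_surjective Γ).subsingleton
    infer_instance
  · have : Finite (MulAction.orbitRel.Quotient Γ X.Cell) := h
    let p : G → MulAction.orbitRel.Quotient Γ X.Cell := fun g =>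
      Quotient.mk'' ⟨{g • x}, X.singleton_mem _⟩
    choose r hr using fun q : Set.range p => q.2
    let K : Set G := {g | g • x = x}
    have hcover : (Set.univ : Set (RightCosets Γ)) =
        ⋃ q : Set.range p, (fun k => RightCosets.mk Γ (r q * k)) '' K := by
      refine (Set.eq_univ_of_forall fun y => ?_).symm
      obtain ⟨g, rfl⟩ := RightCosets.mk_surjective Γ y
      -- `γ` moves the vertex `g x` to the chosen vertex in its orbit
      obtain ⟨γ, hγ⟩ := Quotient.exact (hr ⟨p g, Set.mem_range_self g⟩)
      refine Set.mem_iUnion.2 ⟨⟨p g, Set.mem_range_self g⟩, ?_⟩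
      generalize r ⟨p g, Set.mem_range_self g⟩ = a at hγ ⊢
      have hγ' : (γ : G) • g • x = a • x := by
        have e : cellSMul (γ : G) {g • x} = {a • x} := congrArg Subtype.val hγ
        rwa [cellSMul_singleton, Finset.singleton_inj] at e
      refine ⟨a⁻¹ * (γ * g), ?_, ?_⟩
      · change (a⁻¹ * (γ * g)) • x = x
        rw [mul_smul, mul_smul, hγ', inv_smul_smul]
      · change RightCosets.mk Γ (a * (a⁻¹ * (γ * g))) = _
        rw [mul_inv_cancel_left, RightCosets.mk_eq_mk, mul_inv_rev, mul_inv_cancel_left]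
        exact Γ.inv_mem γ.2
    refine ⟨hcover ▸ isCompact_iUnion fun q => (X.isCompact_smul_eq x).image ?_⟩
    exact (RightCosets.isOpenQuotientMap_mk Γ).continuous.comp (continuous_const_mul _)

section L2

variable [IsTopologicalGroup G] [LocallyCompactSpace G] [T2Space G] [TotallyDisconnectedSpace G]
  [MeasurableSpace G] [BorelSpace G] (μ : Measure G) [μ.IsHaarMeasure] [μ.IsMulRightInvariant]
  {X : GComplex G V} {Γ : Subgroup G} (hΓ : X.IsQuotient Γ)

theorem IsFiniteQuotient.isWeaklyContained_iff (h : X.IsFiniteQuotient Γ) {W : UnitaryRep G}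
    (hW : W.IsIrreducible) :
    W.IsWeaklyContained (X.L2Quotient hΓ μ) ↔ W.IsContained (X.L2Quotient hΓ μ) := by
  refine ⟨fun hWΓ => ?_, UnitaryRep.isWeaklyContained_of_isContained⟩
  have := h.compactSpace
  have := X.secondCountableTopology
  have := hΓ.discreteTopology
  have := hW.1
  obtain ⟨K₀, hK₀, hK₀c⟩ := X.exists_isOpen_isCompact
  obtain ⟨K, -, hK, hKc, hWK⟩ := W.exists_fixed_ne_bot μ hK₀ hK₀c
  have : FiniteDimensional ℂ ((X.L2Quotient hΓ μ).fixed K) :=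
    RightCosets.finiteDimensional_fixed μ hK hKc
  exact hW.isContained_of_finiteDimensional_fixed μ hWΓ hK hKc hWK

theorem IsFiniteQuotient.hasFiniteAction_iff (h : X.IsFiniteQuotient Γ) {W : UnitaryRep G}
    (hW : W.IsIrreducible) (hWΓ : W.IsContained (X.L2Quotient hΓ μ)) :
    W.HasFiniteAction ↔ W.IsFiniteDimensional := by
  refine ⟨hW.finiteDimensional, fun hfd => ?_⟩
  have := h.compactSpace
  have := X.secondCountableTopology
  have := hΓ.discreteTopology
  obtain ⟨K₀, hK₀, hK₀c⟩ := X.exists_isOpen_isCompact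
  exact RightCosets.hasFiniteAction_of_isContained μ hK₀ hK₀c hfd hWΓ

end L2

end GComplex

end RamanujanQuotients

end

theorem mainTheorem3 {G : Type u} [Group G] [TopologicalSpace G] [IsTopologicalGroup G]
    [LocallyCompactSpace G] [T2Space G] [TotallyDisconnectedSpace G]
    [MeasurableSpace G] [BorelSpace G]
    (μ : Measure G) [μ.IsHaarMeasure] [μ.IsMulRightInvariant]
    {V : Type v} [MulAction G V] (X : GComplex G V) (hX : X.AlmostTransitive)
    (F : X.QuotCat ⥤ PHil.{u}) (S : X.QuotCat ⥤ Type u) (hS : ElementaryBy S F)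
    (t : ℕ) (x : Fin t → GComplex.QuotCat.Fiber S)
    (hx : ∀ y : GComplex.QuotCat.Fiber S, ∃! n : Fin t, y ∈ MulAction.orbit G (x n))
    (Q : X.QuotCat) :
    -- part (i)
    (FRamanujan F Q ↔
      ∀ W : UnitaryRep G, W.IsIrreducible →
        W.IsWeaklyContained (X.L2Quotient Q.isQuotient μ) →
        (⨆ n : Fin t, W.fixed (MulAction.stabilizer G (x n))) ≠ ⊥ →
        X.IsTempered μ W ∨ W.HasFiniteAction) ∧
    -- part (ii)
    (CompletelyRamanujan Q ↔
      ∀ W : UnitaryRep G, W.IsIrreducible →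
        W.IsWeaklyContained (X.L2Quotient Q.isQuotient μ) →
        X.IsTempered μ W ∨ W.HasFiniteAction) ∧
    -- finite quotients: either replacement, and both of them, in (i) and in (ii)
    (X.IsFiniteQuotient Q.Γ →
      ((FRamanujan F Q ↔
        ∀ W : UnitaryRep G, W.IsIrreducible →
          W.IsWeaklyContained (X.L2Quotient Q.isQuotient μ) →
          (⨆ n : Fin t, W.fixed (MulAction.stabilizer G (x n))) ≠ ⊥ →
          X.IsTempered μ W ∨ W.IsFiniteDimensional) ∧
      (FRamanujan F Q ↔
        ∀ W : UnitaryRep G, W.IsIrreducible →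
          W.IsContained (X.L2Quotient Q.isQuotient μ) →
          (⨆ n : Fin t, W.fixed (MulAction.stabilizer G (x n))) ≠ ⊥ →
          X.IsTempered μ W ∨ W.HasFiniteAction) ∧
      (FRamanujan F Q ↔
        ∀ W : UnitaryRep G, W.IsIrreducible →
          W.IsContained (X.L2Quotient Q.isQuotient μ) →
          (⨆ n : Fin t, W.fixed (MulAction.stabilizer G (x n))) ≠ ⊥ →
          X.IsTempered μ W ∨ W.IsFiniteDimensional)) ∧
      ((CompletelyRamanujan Q ↔
        ∀ W : UnitaryRep G, W.IsIrreducible →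
          W.IsWeaklyContained (X.L2Quotient Q.isQuotient μ) →
          X.IsTempered μ W ∨ W.IsFiniteDimensional) ∧
      (CompletelyRamanujan Q ↔
        ∀ W : UnitaryRep G, W.IsIrreducible →
          W.IsContained (X.L2Quotient Q.isQuotient μ) →
          X.IsTempered μ W ∨ W.HasFiniteAction) ∧
      (CompletelyRamanujan Q ↔
        ∀ W : UnitaryRep G, W.IsIrreducible →
          W.IsContained (X.L2Quotient Q.isQuotient μ) →
          X.IsTempered μ W ∨ W.IsFiniteDimensional))) := by
  have h1 := hS.fRamanujan_iff μ ⟨x, hx⟩ Q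
  have h2 := completelyRamanujan_iff (X := X) μ Q
  refine ⟨h1, h2, fun hfin => ?_⟩
  -- for a finite quotient the conditions on `W` agree
  have hc := fun (W : UnitaryRep G) (hW : W.IsIrreducible) =>
    hfin.isWeaklyContained_iff μ Q.isQuotient hW
  have hf := fun (W : UnitaryRep G) (hW : W.IsIrreducible)
    (hWQ : W.IsContained (X.L2Quotient Q.isQuotient μ)) =>
    hfin.hasFiniteAction_iff μ Q.isQuotient hW hWQ
  refine ⟨⟨h1.trans ?_, h1.trans ?_, h1.trans ?_⟩, h2.trans ?_, h2.trans ?_, h2.trans ?_⟩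
  · exact forall₂_congr fun W hW => forall_congr' fun hWQ => by
      rw [hf W hW ((hc W hW).1 hWQ)]
  · exact forall₂_congr fun W hW => by rw [hc W hW]
  · exact forall₂_congr fun W hW => by
      rw [hc W hW]
      exact forall_congr' fun hWQ => by rw [hf W hW hWQ]
  · exact forall₂_congr fun W hW => forall_congr' fun hWQ => by
      rw [hf W hW ((hc W hW).1 hWQ)]
  · exact forall₂_congr fun W hW => by rw [hc W hW]
  · exact forall₂_congr fun W hW => by
      rw [hc W hW]
      exact forall_congr' fun hWQ => by rw [hf W hW hWQ]
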